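/- For each $n$ consider the linear model $\mathbf y=X\beta^0+\epsilon$ with an $n\times p$ design matrix $X$, $p=p_n$, and $\epsilon\sim N(0,\sigma_0^2I_n)$, $\sigma_0>0$ fixed, where $X$ is deterministic, or random and independent of $\epsilon$. A model is a subset $\gamma\subseteq\{1,\dots,p\}$; the true model is $\gamma^0=\{j:\beta^0_j\neq0\}$. Write $Z=(\mathbf y,X)$ and let $p(\gamma\mid Z)$ be the posterior probability of $\gamma$ under the hierarchical prior $$\mathbf y\mid\beta,\sigma^2\sim N(X\beta,\sigma^2I_n),\quad \beta_j\mid\gamma,\sigma^2,c\ \stackrel{\text{ind.}}{\sim}\ \begin{cases}N(0,c\sigma^2),& j\in\gamma,\\ \delta_0,& j\notin\gamma,\end{cases}\quad 1/\sigma^2\sim\chi^2_\nu,\quad c\sim g,\quad \gamma\sim p(\gamma),$$ where $\nu>0$ and the probability distribution $g$ on $[0,\infty)$ do not depend on $n$, and $p(\cdot)$ is a probability distribution on the set of models (which may depend on $n$); $p(\gamma\mid Z)$ is obtained by integrating out $\beta,\sigma^2$ and $c$. Suppose that, for all large $n$ and constants $C_0,\bar c>0$ not depending on $n$: $\gamma^0\ne\emptyset$;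 $\max_\gamma p(\gamma)/p(\gamma^0)\le C_0$; almost surely all eigenvalues of $\frac1nX^TX$ lie in $[1/\bar c,\bar c]$; and $\min_{j\in\gamma^0}|\beta^0_j|\ge\psi_n$ for a positive sequence $\psi_n\asymp n^{-1/4}\sqrt{\log n}$. Suppose also $\|\beta^0\|_2=O(1)$ and $|\gamma^0|=O(1)$ as $n\to\infty$. Here $a_n\asymp b_n$ means that $|a_n|/|b_n|$ is eventually bounded above and away from zero. (i) If the support of $g$ is contained in $[\underline\phi,\bar\phi]$ with $0<\underline\phi\le\bar\phi<\infty$, and $p\asymp n^r$ for some $0<r<1/2$, then $\max_{\gamma\ne\gamma^0}p(\gamma\mid Z)/p(\gamma^0\mid Z)\to0$ in probability. (ii) If $g$ is any probability distribution on $[0,\infty)$ other than the point mass at $0$ (for instance, any distribution with a density), and $p\asymp n^r$ for some $0<r<1/4$, then $p(\gamma^0\mid Z)\to1$ in probability. -/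

import Mathlib

open MeasureTheory ProbabilityTheory Filter Topology Asymptotics
open scoped NNReal ENNReal

noncomputable section

namespace BayesVarSel

/-- The model (state vector) of a coefficient vector: the set of indices of its nonzero entries.
A state vector in `{0,1}^p` is identified with the set of indices where it equals `1`. -/
def trueModel {p : ℕ} (β : Fin p → ℝ) : Finset (Fin p) :=
  Finset.univ.filter fun j => β j ≠ 0

/-- The prior law of `β ∈ ℝ^p` given the model `γ`, with slab variance `v`: independent
coordinates, `β_j ∼ N(0, v)` for `j ∈ γ` and `β_j = 0` for `j ∉ γ`. -/
def coefPrior {p : ℕ} (γ : Finset (Fin p)) (v : ℝ≥0) : Measure (Fin p → ℝ) :=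
  Measure.pi fun j => if j ∈ γ then gaussianReal 0 v else Measure.dirac 0

/-- The density at `y` of the law `N(X β, v I_n)`. -/
def likelihood {n p : ℕ} (X : Matrix (Fin n) (Fin p) ℝ) (y : Fin n → ℝ) (β : Fin p → ℝ)
    (v : ℝ≥0) : ℝ≥0∞ :=
  ∏ i, gaussianPDF (X.mulVec β i) v (y i)

/-- The chi-square distribution with `ν` degrees of freedom, `Gamma(ν/2, 1/2)`. -/
def chiSquareMeasure (ν : ℝ) : Measure ℝ := gammaMeasure (ν / 2) (1 / 2)

/-- The marginal likelihood of the model `γ` for the data `(y, X)`: the likelihood integrated over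
`c ∼ g`, then `τ = 1/σ² ∼ χ²_ν`, then `β | γ, σ², c`, whose nonzero coordinates are
`N(0, c σ²)`. -/
def marginalLikelihood {n p : ℕ} (ν : ℝ) (g : Measure ℝ≥0) (X : Matrix (Fin n) (Fin p) ℝ)
    (y : Fin n → ℝ) (γ : Finset (Fin p)) : ℝ≥0∞ :=
  ∫⁻ c, ∫⁻ τ, ∫⁻ β, likelihood X y β (τ.toNNReal)⁻¹
    ∂(coefPrior γ (c * (τ.toNNReal)⁻¹)) ∂(chiSquareMeasure ν) ∂g

/-- The posterior probability `p(γ | Z)` of the model `γ` given the data `Z = (y, X)`, by Bayes'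
formula, for the prior `π` on models. -/
def posterior {n p : ℕ} (ν : ℝ) (g : Measure ℝ≥0) (π : PMF (Finset (Fin p)))
    (X : Matrix (Fin n) (Fin p) ℝ) (y : Fin n → ℝ) (γ : Finset (Fin p)) : ℝ :=
  (π γ * marginalLikelihood ν g X y γ /
    ∑ γ' : Finset (Fin p), π γ' * marginalLikelihood ν g X y γ').toReal

/-- The largest posterior odds ratio `max_{γ ≠ γ₀} p(γ | Z) / p(γ₀ | Z)`. -/
def maxPosteriorOdds {n p : ℕ} (ν : ℝ) (g : Measure ℝ≥0) (π : PMF (Finset (Fin p)))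
    (X : Matrix (Fin n) (Fin p) ℝ) (y : Fin n → ℝ) (γ₀ : Finset (Fin p)) : ℝ :=
  ⨆ γ : {γ : Finset (Fin p) // γ ≠ γ₀},
    posterior ν g π X y (γ : Finset (Fin p)) / posterior ν g π X y γ₀

/-- All eigenvalues of `Xᵀ X / n` lie in `[1/b, b]`. -/
def WellConditioned {n p : ℕ} (b : ℝ) (X : Matrix (Fin n) (Fin p) ℝ) : Prop :=
  spectrum ℝ ((n : ℝ)⁻¹ • (X.transpose * X)) ⊆ Set.Icc (1 / b) b

end BayesVarSel

end

namespace BayesVarSel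

/-! Write `y = Xβ₀ + e`, `v = σ₀²`, `S = nsq β₀` (squared norm). The proof shows that, off an event
of vanishing probability, the marginal likelihoods of all wrong models sum to at most `θ` times that
of the true model `γ₀`, for every `θ > 0`. Bounded prior odds turn this into both claims.

Integrating out `β` needs no projections or determinants. Suppose `nsq (e - Xδ) ≥ T + 2A nsq δ` for
`δ` supported in `γ`, with `A` of order `n`. Completing squares coordinatewise gives a factor
`(Ac)^(-1/2)` per covariate and a Gaussian kernel with residual `T + S/(c + 1/A)`
(`condMarginal_le_of_precise`). A symmetrization gives a matching lower bound for `γ₀`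
(`le_condMarginal`). Integrating over the precision turns a residual `T` into a constant times `(1 +
T)^(-(n+ν)/2)` (`exists_tauInt_eq`), so differences of residuals become exponents with rate about
`1/(2v)`.

The noise fitted by `γ` is controlled by `fitStat`, a Gaussian integral proportional to the
exponential of a multiple of the squared projection of `e` on the columns in `γ`. Its mean is at
most `R^|γ|` (`lintegral_fitStat_le`), and a bound `G` on it yields `T = nsq e - 2z²v log G` with `z
> 1` close to `1`. A superset with `m` extra covariates then has odds at most `W_m G^(z³)`. By
Markov's inequality the sum of `u_m · fitStat`, with `u_m = n^(-r'm) m!` and `r' > r`, is at most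
`1` with high probability. Once `W_m ≤ ε u_m^(z³)`, the odds of all supersets sum to at most `ε`
(`sum_superset_le`).

The weight `W_m` depends on `c`. If `c` is bounded below, each extra covariate costs a factor of
order `n^(-1/2)`, hence `r < 1/2`. In general (`regime_dichotomy`) either `c` is so small that
shrinking the true coefficients is prohibitive, or `(m+1)c` is at least of order `n^(-1/2)`. The
cost is then of order `√(m+1) n^(-1/4)`, hence `r < 1/4`; the factor `√(m+1)^m` is absorbed by `m!`.

A model that misses a true covariate has its residual raised by order `nψ² ≍ √n log n`. This beats
the number `2^p` of models and the noise `O(p)` fitted by the full model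
(`marginalLikelihood_le_of_missing`). -/

/-! ### Integrals and densities for product measures. -/

theorem lintegral_pi_prod {n : ℕ} (μ : Fin n → Measure ℝ) [∀ i, SigmaFinite (μ i)]
    (f : Fin n → ℝ → ℝ≥0∞) (hf : ∀ i, Measurable (f i)) :
    ∫⁻ x, ∏ i, f i (x i) ∂Measure.pi μ = ∏ i, ∫⁻ x, f i x ∂μ i := by
  induction n with
  | zero => simp
  | succ n ih =>
    have h := (measurePreserving_piFinSuccAbove μ 0).symm
    rw [← h.lintegral_comp_emb (MeasurableEquiv.measurableEmbedding _)]
    simp_rw [Fin.prod_univ_succ, MeasurableEquiv.piFinSuccAbove_symm_apply]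
    simp only [Fin.insertNthEquiv_apply, Fin.insertNth_zero', Fin.cons_zero, Fin.cons_succ,
      Fin.zero_succAbove]
    rw [← ih (fun i => μ i.succ) (fun i => f i.succ) (fun i => hf _)]
    exact lintegral_prod_mul (hf 0).aemeasurable
      (Finset.measurable_fun_prod _ fun i _ =>
        (hf _).comp (measurable_pi_apply i)).aemeasurable

theorem pi_withDensity {n : ℕ} (μ : Fin n → Measure ℝ) [∀ i, SigmaFinite (μ i)]
    (f : Fin n → ℝ → ℝ≥0∞) (hf : ∀ i, Measurable (f i))
    [∀ i, SigmaFinite ((μ i).withDensity (f i))] :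
    Measure.pi (fun i => (μ i).withDensity (f i)) =
      (Measure.pi μ).withDensity fun x => ∏ i, f i (x i) := by
  refine Measure.pi_eq fun s hs => ?_
  rw [withDensity_apply _ (MeasurableSet.univ_pi hs), ← lintegral_indicator
    (MeasurableSet.univ_pi hs)]
  have : ∀ x : Fin n → ℝ, (Set.univ.pi s).indicator (fun x => ∏ i, f i (x i)) x =
      ∏ i, (s i).indicator (f i) (x i) := by
    intro x
    by_cases h : x ∈ Set.univ.pi s
    · rw [Set.indicator_of_mem h]
      exact Finset.prod_congr rfl fun i _ => by
        rw [Set.indicator_of_mem (h i (Set.mem_univ i))]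
    · rw [Set.indicator_of_notMem h]
      simp only [Set.mem_pi, Set.mem_univ, true_imp_iff, not_forall] at h
      obtain ⟨i, hi⟩ := h
      exact (Finset.prod_eq_zero (Finset.mem_univ i) (Set.indicator_of_notMem hi _)).symm
  simp_rw [this]
  rw [lintegral_pi_prod μ _ fun i => (hf i).indicator (hs i)]
  exact Finset.prod_congr rfl fun i _ => by
    rw [lintegral_indicator (hs i), withDensity_apply _ (hs i)]

/-! ### Coordinate subspaces and their symmetries. -/

/-- Lebesgue measure on the coordinate subspace of vectors supported in `γ`. -/
noncomputable def slab {p : ℕ} (γ : Finset (Fin p)) : Measure (Fin p → ℝ) :=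
  Measure.pi fun j => if j ∈ γ then volume else Measure.dirac 0

instance slabFactor_sigmaFinite {p : ℕ} (γ : Finset (Fin p)) (j : Fin p) :
    SigmaFinite (if j ∈ γ then (volume : Measure ℝ) else Measure.dirac 0) := by
  split_ifs <;> infer_instance

instance coefFactor_isProbabilityMeasure {p : ℕ} (γ : Finset (Fin p)) (v : ℝ≥0) (j : Fin p) :
    IsProbabilityMeasure (if j ∈ γ then gaussianReal 0 v else Measure.dirac 0) := by
  split_ifs <;> infer_instance

instance {p : ℕ} (γ : Finset (Fin p)) : SigmaFinite (slab γ) := by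
  unfold slab; infer_instance

instance {p : ℕ} (γ : Finset (Fin p)) (v : ℝ≥0) : IsProbabilityMeasure (coefPrior γ v) := by
  unfold coefPrior; infer_instance

theorem ae_slab_support {p : ℕ} (γ : Finset (Fin p)) :
    ∀ᵐ δ ∂slab γ, ∀ j ∉ γ, δ j = 0 := by
  rw [ae_all_iff]
  intro j
  by_cases hj : j ∈ γ
  · simp [hj]
  · have : ∀ᵐ x ∂(if j ∈ γ then (volume : Measure ℝ) else Measure.dirac 0), x = 0 := by
      simp [hj, ae_dirac_eq]
    filter_upwards [Measure.tendsto_eval_ae_ae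
      (μ := fun j => if j ∈ γ then (volume : Measure ℝ) else Measure.dirac 0) this] with x hx _
    exact hx

theorem ae_coefPrior_support {p : ℕ} (γ : Finset (Fin p)) (v : ℝ≥0) :
    ∀ᵐ δ ∂coefPrior γ v, ∀ j ∉ γ, δ j = 0 := by
  rw [ae_all_iff]
  intro j
  by_cases hj : j ∈ γ
  · simp [hj]
  · have : ∀ᵐ x ∂(if j ∈ γ then gaussianReal 0 v else Measure.dirac 0), x = 0 := by
      simp [hj, ae_dirac_eq]
    filter_upwards [Measure.tendsto_eval_ae_ae
      (μ := fun j => if j ∈ γ then gaussianReal 0 v else Measure.dirac 0) this] with x hx _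
    exact hx

theorem slab_measurePreserving_add {p : ℕ} {γ : Finset (Fin p)} {δ₀ : Fin p → ℝ}
    (h : ∀ j ∉ γ, δ₀ j = 0) : MeasurePreserving (fun δ => δ + δ₀) (slab γ) (slab γ) := by
  refine measurePreserving_pi _ _ (f := fun j x => x + δ₀ j) fun j => ?_
  by_cases hj : j ∈ γ
  · simpa [hj] using measurePreserving_add_right volume (δ₀ j)
  · simp only [hj, if_false, h j hj, add_zero]
    exact MeasurePreserving.id _

theorem slab_measurePreserving_neg {p : ℕ} (γ : Finset (Fin p)) :
    MeasurePreserving (fun δ => -δ) (slab γ) (slab γ) := by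
  refine measurePreserving_pi _ _ (f := fun j x => -x) fun j => ?_
  by_cases hj : j ∈ γ
  · simpa [hj] using Measure.measurePreserving_neg (volume : Measure ℝ)
  · simp only [hj, if_false]
    exact ⟨measurable_neg, by simp [Measure.map_dirac' measurable_neg]⟩

theorem lintegral_slab_add {p : ℕ} {γ : Finset (Fin p)} {δ₀ : Fin p → ℝ}
    (h : ∀ j ∉ γ, δ₀ j = 0) (f : (Fin p → ℝ) → ℝ≥0∞) :
    ∫⁻ δ, f (δ + δ₀) ∂slab γ = ∫⁻ δ, f δ ∂slab γ :=
  (slab_measurePreserving_add h).lintegral_comp_emb (MeasurableEquiv.addRight δ₀).measurableEmbedding f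

theorem lintegral_slab_neg {p : ℕ} (γ : Finset (Fin p)) (f : (Fin p → ℝ) → ℝ≥0∞) :
    ∫⁻ δ, f (-δ) ∂slab γ = ∫⁻ δ, f δ ∂slab γ :=
  (slab_measurePreserving_neg γ).lintegral_comp_emb
    (MeasurableEquiv.neg (Fin p → ℝ)).measurableEmbedding f

/-- An integral over the slab of a function whose logarithm is even plus linear is at least the
integral of its even part. -/
theorem lintegral_slab_even_le {p : ℕ} (γ : Finset (Fin p)) {l q : (Fin p → ℝ) → ℝ}
    (hl : ∀ δ, l (-δ) = -l δ) (hq : ∀ δ, q (-δ) = q δ) (hlm : Measurable l) (hqm : Measurable q) :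
    ∫⁻ δ, ENNReal.ofReal (Real.exp (q δ)) ∂slab γ ≤
      ∫⁻ δ, ENNReal.ofReal (Real.exp (q δ + l δ)) ∂slab γ := by
  -- Averaging the integrand over `δ` and `-δ` replaces `exp l` by `cosh l ≥ 1`.
  have h2 : 2 * ∫⁻ δ, ENNReal.ofReal (Real.exp (q δ + l δ)) ∂slab γ =
      ∫⁻ δ, (ENNReal.ofReal (Real.exp (q δ + l δ)) + ENNReal.ofReal (Real.exp (q δ - l δ)))
        ∂slab γ := by
    rw [lintegral_add_left (by fun_prop), two_mul]
    congr 1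
    rw [← lintegral_slab_neg]
    refine lintegral_congr fun δ => ?_
    rw [hl, hq, sub_eq_add_neg]
  have h3 : 2 * ∫⁻ δ, ENNReal.ofReal (Real.exp (q δ)) ∂slab γ ≤
      2 * ∫⁻ δ, ENNReal.ofReal (Real.exp (q δ + l δ)) ∂slab γ := by
    rw [h2, ← lintegral_const_mul _ (by fun_prop)]
    refine lintegral_mono fun δ => ?_
    rw [← ENNReal.ofReal_add (Real.exp_nonneg _) (Real.exp_nonneg _),
      show (2 : ℝ≥0∞) = ENNReal.ofReal 2 by simp, ← ENNReal.ofReal_mul (by norm_num)]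
    refine ENNReal.ofReal_le_ofReal ?_
    rw [sub_eq_add_neg, Real.exp_add, Real.exp_add, ← mul_add, mul_comm]
    have := Real.one_le_cosh (l δ)
    rw [Real.cosh_eq] at this
    exact mul_le_mul_of_nonneg_left (by linarith) (Real.exp_nonneg _)
  exact (ENNReal.mul_le_mul_iff_right (by norm_num) (by norm_num)).1 h3

theorem coefPrior_eq_withDensity {p : ℕ} (γ : Finset (Fin p)) {v : ℝ≥0} (hv : v ≠ 0) :
    coefPrior γ v = (slab γ).withDensity
      fun β => ∏ j, if j ∈ γ then gaussianPDF 0 v (β j) else 1 := by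
  have hm : ∀ j : Fin p, Measurable (if j ∈ γ then gaussianPDF 0 v else fun _ => (1 : ℝ≥0∞)) := by
    intro j; split_ifs <;> [exact measurable_gaussianPDF 0 v; exact measurable_const]
  have he : ∀ j, (if j ∈ γ then (volume : Measure ℝ) else Measure.dirac 0).withDensity
      (if j ∈ γ then gaussianPDF 0 v else fun _ => (1 : ℝ≥0∞)) =
      if j ∈ γ then gaussianReal 0 v else Measure.dirac 0 := by
    intro j; split_ifs
    · rw [gaussianReal_of_var_ne_zero 0 hv]
    · exact withDensity_one
  have hs : ∀ j, SigmaFinite ((if j ∈ γ then (volume : Measure ℝ) else Measure.dirac 0).withDensity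
      (if j ∈ γ then gaussianPDF 0 v else fun _ => (1 : ℝ≥0∞))) := by
    intro j; rw [he]; infer_instance
  have := pi_withDensity (fun j => if j ∈ γ then (volume : Measure ℝ) else Measure.dirac 0)
    (fun j => if j ∈ γ then gaussianPDF 0 v else fun _ => (1 : ℝ≥0∞)) hm
  simp_rw [he] at this
  rw [coefPrior, slab, this]
  congr 1
  ext β
  exact Finset.prod_congr rfl fun j _ => by split_ifs <;> rfl

/-! ### Gaussian integrals in one and several coordinates. -/

theorem lintegral_exp_neg_mul_sq {a : ℝ} (ha : 0 < a) (m : ℝ) :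
    ∫⁻ x, ENNReal.ofReal (Real.exp (-a * (x - m) ^ 2)) = ENNReal.ofReal √(Real.pi / a) := by
  rw [lintegral_sub_right_eq_self (fun x => ENNReal.ofReal (Real.exp (-a * x ^ 2))) m,
    ← ofReal_integral_eq_lintegral_ofReal (integrable_exp_neg_mul_sq ha)
      (ae_of_all _ fun x => Real.exp_nonneg _), integral_gaussian]

/-- The term `x² / (2v)` cancels the Gaussian weight of the prior, so that what is integrated is a
Gaussian centred at `m`. -/
theorem lintegral_gaussianReal_exp_quadratic {v : ℝ≥0} (hv : v ≠ 0) {a : ℝ} (ha : 0 < a) (m : ℝ) :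
    ∫⁻ x, ENNReal.ofReal (Real.exp (x ^ 2 / (2 * v) - a * (x - m) ^ 2)) ∂gaussianReal 0 v =
      ENNReal.ofReal √(1 / (2 * a * v)) := by
  have hv' : (0 : ℝ) < v := by exact_mod_cast pos_iff_ne_zero.2 hv
  rw [gaussianReal_of_var_ne_zero 0 hv,
    lintegral_withDensity_eq_lintegral_mul _ (measurable_gaussianPDF 0 v) (by fun_prop)]
  have : ∀ x : ℝ, (gaussianPDF 0 v * fun x => ENNReal.ofReal (Real.exp (x ^ 2 / (2 * v)
      - a * (x - m) ^ 2))) x = ENNReal.ofReal (√(2 * Real.pi * v))⁻¹ *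
        ENNReal.ofReal (Real.exp (-a * (x - m) ^ 2)) := by
    intro x
    rw [Pi.mul_apply, gaussianPDF, gaussianPDFReal, ENNReal.ofReal_mul (by positivity), mul_assoc,
      ← ENNReal.ofReal_mul (by positivity), ← Real.exp_add]
    congr 3
    ring_nf
  simp_rw [this]
  rw [lintegral_const_mul _ (by fun_prop), lintegral_exp_neg_mul_sq ha,
    ← ENNReal.ofReal_mul (by positivity), ← Real.sqrt_inv, ← Real.sqrt_mul (by positivity)]
  congr 2
  field_simp

theorem lintegral_gaussianReal_exp_mul_sq {v : ℝ≥0} (hv : v ≠ 0) {s : ℝ} (hs : 2 * s * v < 1) :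
    ∫⁻ x, ENNReal.ofReal (Real.exp (s * x ^ 2)) ∂gaussianReal 0 v =
      ENNReal.ofReal √(1 / (1 - 2 * s * v)) := by
  have hv' : (0 : ℝ) < v := by exact_mod_cast pos_iff_ne_zero.2 hv
  have ha : 0 < 1 / (2 * v) - s := by
    rw [sub_pos, lt_div_iff₀ (by positivity)]; linarith
  have := lintegral_gaussianReal_exp_quadratic hv ha 0
  have h1 : ∀ x : ℝ, x ^ 2 / (2 * v) - (1 / (2 * v) - s) * (x - 0) ^ 2 = s * x ^ 2 := fun x => by
    ring
  have h2 : 2 * (1 / (2 * v) - s) * v = 1 - 2 * s * v := by field_simp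
  simp_rw [h1, h2] at this
  exact this

theorem lintegral_gaussianReal_exp_mul (v : ℝ≥0) (t : ℝ) :
    ∫⁻ x, ENNReal.ofReal (Real.exp (t * x)) ∂gaussianReal 0 v =
      ENNReal.ofReal (Real.exp (v * t ^ 2 / 2)) := by
  rw [← ofReal_integral_eq_lintegral_ofReal (integrable_exp_mul_gaussianReal t)
      (ae_of_all _ fun x => Real.exp_nonneg _)]
  have := congrFun (mgf_fun_id_gaussianReal (μ := 0) (v := v)) t
  rw [mgf] at this
  rw [this]; simp

/-- The squared Euclidean norm. -/
def nsq {n : ℕ} (v : Fin n → ℝ) : ℝ := ∑ i, v i ^ 2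

theorem nsq_nonneg {n : ℕ} (v : Fin n → ℝ) : 0 ≤ nsq v := Finset.sum_nonneg fun _ _ => sq_nonneg _

theorem nsq_neg {n : ℕ} (v : Fin n → ℝ) : nsq (-v) = nsq v := by simp [nsq]

theorem nsq_smul {n : ℕ} (a : ℝ) (v : Fin n → ℝ) : nsq (a • v) = a ^ 2 * nsq v := by
  simp [nsq, mul_pow, Finset.mul_sum]

theorem nsq_add {n : ℕ} (v w : Fin n → ℝ) : nsq (v + w) = nsq v + 2 * (v ⬝ᵥ w) + nsq w := by
  simp only [nsq, dotProduct, Finset.mul_sum, ← Finset.sum_add_distrib, Pi.add_apply]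
  exact Finset.sum_congr rfl fun i _ => by ring

theorem nsq_sub {n : ℕ} (v w : Fin n → ℝ) : nsq (v - w) = nsq v - 2 * (v ⬝ᵥ w) + nsq w := by
  rw [sub_eq_add_neg, nsq_add, nsq_neg, dotProduct_neg]; ring

@[fun_prop]
theorem measurable_nsq {n : ℕ} : Measurable (nsq : (Fin n → ℝ) → ℝ) := by
  unfold nsq; fun_prop

@[fun_prop]
theorem measurable_mulVec {n p : ℕ} (X : Matrix (Fin n) (Fin p) ℝ) :
    Measurable fun δ => X.mulVec δ := by
  refine measurable_pi_lambda _ fun i => ?_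
  simp only [Matrix.mulVec, dotProduct]
  fun_prop

@[fun_prop]
theorem measurable_dotProduct {n : ℕ} (v : Fin n → ℝ) : Measurable fun w => v ⬝ᵥ w := by
  simp only [dotProduct]
  fun_prop

theorem lintegral_coefPrior_exp_sum {p : ℕ} (γ : Finset (Fin p)) (v : ℝ≥0) (h : Fin p → ℝ → ℝ)
    (hm : ∀ j, Measurable (h j)) (h0 : ∀ j ∉ γ, h j 0 = 0) {C : ℝ≥0∞}
    (hC : ∀ j ∈ γ, ∫⁻ x, ENNReal.ofReal (Real.exp (h j x)) ∂gaussianReal 0 v = C) :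
    ∫⁻ β, ENNReal.ofReal (Real.exp (∑ j, h j (β j))) ∂coefPrior γ v = C ^ γ.card := by
  simp_rw [Real.exp_sum, ENNReal.ofReal_prod_of_nonneg fun i _ => Real.exp_nonneg _]
  rw [coefPrior, lintegral_pi_prod _ (fun j x => ENNReal.ofReal (Real.exp (h j x)))
    fun j => by have := hm j; fun_prop]
  rw [← Finset.prod_const, ← Finset.prod_subset (Finset.subset_univ γ)]
  · exact Finset.prod_congr rfl fun j hj => by simp [hj, hC j hj]
  · intro j _ hj
    simp [hj, h0 j hj, lintegral_dirac]

theorem lintegral_slab_exp_neg_mul_nsq {p : ℕ} (γ : Finset (Fin p)) {a : ℝ} (ha : 0 < a) :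
    ∫⁻ β, ENNReal.ofReal (Real.exp (-a * nsq β)) ∂slab γ =
      ENNReal.ofReal √(Real.pi / a) ^ γ.card := by
  simp_rw [nsq, Finset.mul_sum, Real.exp_sum,
    ENNReal.ofReal_prod_of_nonneg fun i _ => Real.exp_nonneg _]
  rw [slab, lintegral_pi_prod _ (fun j x => ENNReal.ofReal (Real.exp (-a * x ^ 2)))
    fun j => by fun_prop]
  rw [← Finset.prod_const, ← Finset.prod_subset (Finset.subset_univ γ)]
  · refine Finset.prod_congr rfl fun j hj => ?_
    simpa [hj] using lintegral_exp_neg_mul_sq ha 0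
  · intro j _ hj
    simp [hj, lintegral_dirac]

theorem likelihood_eq {n p : ℕ} (X : Matrix (Fin n) (Fin p) ℝ) (y : Fin n → ℝ) (β : Fin p → ℝ)
    {t : ℝ≥0} (ht : t ≠ 0) :
    likelihood X y β t⁻¹ =
      ENNReal.ofReal (√(t / (2 * Real.pi)) ^ n * Real.exp (-(t / 2) * nsq (y - X.mulVec β))) := by
  have ht' : (0 : ℝ) < t := by exact_mod_cast pos_iff_ne_zero.2 ht
  simp only [likelihood, gaussianPDF]
  rw [← ENNReal.ofReal_prod_of_nonneg fun i _ => gaussianPDFReal_nonneg _ _ _]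
  congr 1
  simp only [gaussianPDFReal, Finset.prod_mul_distrib, Finset.prod_const, Finset.card_univ,
    Fintype.card_fin, ← Real.exp_sum]
  congr 2
  · rw [← Real.sqrt_inv]
    congr 1
    push_cast
    field_simp
  · rw [nsq, Finset.mul_sum]
    refine Finset.sum_congr rfl fun i _ => ?_
    simp only [Pi.sub_apply]
    push_cast
    field_simp

/-! ### Marginal likelihood at fixed `c` and precision. -/

/-- The likelihood integrated over the coefficients, given the model, `c` and `1/σ² = t`. -/
noncomputable def condMarginal {n p : ℕ} (X : Matrix (Fin n) (Fin p) ℝ) (y : Fin n → ℝ)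
    (γ : Finset (Fin p)) (c t : ℝ≥0) : ℝ≥0∞ :=
  ∫⁻ β, likelihood X y β t⁻¹ ∂coefPrior γ (c * t⁻¹)

/-- The Gaussian likelihood kernel with precision `t` and residual sum of squares `T`. -/
noncomputable def kernelExp (n : ℕ) (t T : ℝ) : ℝ :=
  √(t / (2 * Real.pi)) ^ n * Real.exp (-(t / 2) * T)

theorem kernelExp_nonneg (n : ℕ) (t T : ℝ) : 0 ≤ kernelExp n t T := by
  unfold kernelExp; positivity

/-- The left side is the minimum over `x` of the right side; after clearing denominators the
difference is a perfect square. It is the least combined cost of misfit and shrinkage for a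
coefficient of true value `u`. -/
theorem shrink_coord {A c : ℝ} (hA : 0 < A) (hc : 0 < c) (x u : ℝ) :
    u ^ 2 / (c + 1 / A) ≤ A * x ^ 2 + (x + u) ^ 2 / c := by
  rw [div_le_iff₀ (by positivity)]
  have h : (A * x ^ 2 + (x + u) ^ 2 / c) * (c + 1 / A) - u ^ 2 =
      (A * c * x + (x + u)) ^ 2 / (A * c) := by
    field_simp; ring
  have : 0 ≤ (A * c * x + (x + u)) ^ 2 / (A * c) := by positivity
  linarith

theorem shrink_nsq {p : ℕ} {A c : ℝ} (hA : 0 < A) (hc : 0 < c) (β β₀ : Fin p → ℝ) :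
    nsq β₀ / (c + 1 / A) ≤ A * nsq (β - β₀) + nsq β / c := by
  simp only [nsq, Finset.sum_div, Finset.mul_sum, ← Finset.sum_add_distrib]
  refine Finset.sum_le_sum fun j _ => ?_
  have := shrink_coord hA hc (β j - β₀ j) (β₀ j)
  simpa using this

section Bounds

variable {n p : ℕ} {X : Matrix (Fin n) (Fin p) ℝ} {e : Fin n → ℝ} {β₀ : Fin p → ℝ}
  {γ : Finset (Fin p)} {T A : ℝ}

theorem residual_eq (X : Matrix (Fin n) (Fin p) ℝ) (e : Fin n → ℝ) (β β₀ : Fin p → ℝ) :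
    X.mulVec β₀ + e - X.mulVec β = e - X.mulVec (β - β₀) := by
  rw [Matrix.mulVec_sub]; abel

/-- Half of the curvature `2A` is paired with the prior exponent `nsq β / c` and gives the shrinkage
cost through `shrink_nsq`. The other half makes the integral over `β` a Gaussian one, of value
`(Ac)^(-1/2)` per covariate. -/
theorem condMarginal_le_of_precise (hA : 0 < A) (hβ₀ : ∀ j ∉ γ, β₀ j = 0)
    (hR : ∀ δ : Fin p → ℝ, (∀ j ∉ γ, δ j = 0) → T + 2 * A * nsq δ ≤ nsq (e - X.mulVec δ))
    {c t : ℝ≥0} (hc : c ≠ 0) (ht : t ≠ 0) :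
    condMarginal X (X.mulVec β₀ + e) γ c t ≤
      ENNReal.ofReal √(1 / (A * c)) ^ γ.card *
        ENNReal.ofReal (kernelExp n t (T + nsq β₀ / (c + 1 / A))) := by
  have ht' : (0 : ℝ) < t := by exact_mod_cast pos_iff_ne_zero.2 ht
  have hc' : (0 : ℝ) < c := by exact_mod_cast pos_iff_ne_zero.2 hc
  have hv : c * t⁻¹ ≠ 0 := mul_ne_zero hc (inv_ne_zero ht)
  set h : Fin p → ℝ → ℝ := fun j x => x ^ 2 / (2 * ((c * t⁻¹ : ℝ≥0) : ℝ)) -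
    (t * A / 2) * (x - β₀ j) ^ 2 with hh
  have hint := lintegral_coefPrior_exp_sum γ (c * t⁻¹) h (fun j => by simp only [hh]; fun_prop)
    (fun j hj => by simp [hh, hβ₀ j hj])
    (fun j _ => lintegral_gaussianReal_exp_quadratic hv (by positivity) (β₀ j))
  have e1 : 1 / (2 * (t * A / 2) * ((c * t⁻¹ : ℝ≥0) : ℝ)) = 1 / (A * c) := by
    push_cast; field_simp
  rw [e1] at hint
  rw [← hint, mul_comm, ← lintegral_const_mul _ (by simp only [hh]; fun_prop)]
  refine lintegral_mono_ae ?_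
  filter_upwards [ae_coefPrior_support γ (c * t⁻¹)] with β hβ
  rw [likelihood_eq _ _ _ ht, ← ENNReal.ofReal_mul (kernelExp_nonneg _ _ _), kernelExp, mul_assoc,
    ← Real.exp_add]
  refine ENNReal.ofReal_le_ofReal (mul_le_mul_of_nonneg_left (Real.exp_le_exp.2 ?_) (by positivity))
  have h1 := hR (β - β₀) fun j hj => by simp [hβ j hj, hβ₀ j hj]
  have h2 := shrink_nsq hA hc' β β₀
  have h3 : ∑ j, h j (β j) = t / 2 * (nsq β / c - A * nsq (β - β₀)) := by
    simp only [hh, nsq, Finset.sum_sub_distrib, Finset.sum_div, Finset.mul_sum, mul_sub,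
      Pi.sub_apply]
    congr 1 <;> refine Finset.sum_congr rfl fun j _ => ?_
    · push_cast; field_simp
    · ring
  rw [residual_eq, h3]
  nlinarith

/-- The factor `(Ac)^(-1/2)` of the precise bound explodes as `c → 0`. Here only half of the prior
exponent is spent on shrinkage and the other half keeps the prior integrable at a cost `√2` per
covariate, uniformly in `c`. -/
theorem condMarginal_le_of_diffuse (hA : 0 < A) (hβ₀ : ∀ j ∉ γ, β₀ j = 0)
    (hR : ∀ δ : Fin p → ℝ, (∀ j ∉ γ, δ j = 0) → T + 2 * A * nsq δ ≤ nsq (e - X.mulVec δ))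
    (c : ℝ≥0) {t : ℝ≥0} (ht : t ≠ 0) :
    condMarginal X (X.mulVec β₀ + e) γ c t ≤
      ENNReal.ofReal √2 ^ γ.card *
        ENNReal.ofReal (kernelExp n t (T + nsq β₀ / (2 * c + 1 / A))) := by
  have ht' : (0 : ℝ) < t := by exact_mod_cast pos_iff_ne_zero.2 ht
  rcases eq_or_ne c 0 with rfl | hc
  · have hone : (1 : ℝ≥0∞) ≤ ENNReal.ofReal √2 ^ γ.card := by
      refine one_le_pow₀ ?_
      rw [ENNReal.one_le_ofReal, Real.one_le_sqrt]; norm_num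
    refine le_trans ?_ (le_mul_of_one_le_left zero_le hone)
    rw [condMarginal, zero_mul]
    have hz : ∀ᵐ β ∂coefPrior γ 0, β = 0 := by
      have : coefPrior γ 0 = coefPrior ∅ 0 := by simp [coefPrior]
      rw [this]
      filter_upwards [ae_coefPrior_support ∅ 0] with β hβ
      ext j; simpa using hβ j
    have : ∫⁻ β, likelihood X (X.mulVec β₀ + e) β t⁻¹ ∂coefPrior γ 0 ≤
        ∫⁻ β, ENNReal.ofReal (kernelExp n t (T + nsq β₀ / (2 * (0 : ℝ≥0) + 1 / A)))
          ∂coefPrior γ 0 := by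
      refine lintegral_mono_ae ?_
      filter_upwards [hz] with β hβ
      subst hβ
      rw [likelihood_eq _ _ _ ht, kernelExp]
      refine ENNReal.ofReal_le_ofReal
        (mul_le_mul_of_nonneg_left (Real.exp_le_exp.2 ?_) (by positivity))
      have h1 := hR (0 - β₀) fun j hj => by simp [hβ₀ j hj]
      have h2 : nsq (0 - β₀) = nsq β₀ := by rw [zero_sub, nsq_neg]
      rw [residual_eq]
      rw [h2] at h1
      have h3 : nsq β₀ / (2 * ((0 : ℝ≥0) : ℝ) + 1 / A) = A * nsq β₀ := by
        simp; ring
      rw [h3]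
      have h4 : 0 ≤ A * nsq β₀ := mul_nonneg hA.le (nsq_nonneg _)
      nlinarith
    simpa using this
  have hc' : (0 : ℝ) < c := by exact_mod_cast pos_iff_ne_zero.2 hc
  have hv : c * t⁻¹ ≠ 0 := mul_ne_zero hc (inv_ne_zero ht)
  set h : Fin p → ℝ → ℝ := fun j x => t / (4 * c) * x ^ 2 with hh
  have e0 : 2 * ((t : ℝ) / (4 * c)) * ((c * t⁻¹ : ℝ≥0) : ℝ) = 1 / 2 := by
    push_cast; field_simp; norm_num
  have hint := lintegral_coefPrior_exp_sum γ (c * t⁻¹) h (fun j => by simp only [hh]; fun_prop)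
    (fun j hj => by simp [hh])
    (fun j _ => lintegral_gaussianReal_exp_mul_sq hv (by rw [e0]; norm_num))
  rw [e0, show (1 : ℝ) / (1 - 1 / 2) = 2 by norm_num] at hint
  rw [← hint, mul_comm, ← lintegral_const_mul _ (by simp only [hh]; fun_prop)]
  refine lintegral_mono_ae ?_
  filter_upwards [ae_coefPrior_support γ (c * t⁻¹)] with β hβ
  rw [likelihood_eq _ _ _ ht, ← ENNReal.ofReal_mul (kernelExp_nonneg _ _ _), kernelExp, mul_assoc,
    ← Real.exp_add]
  refine ENNReal.ofReal_le_ofReal (mul_le_mul_of_nonneg_left (Real.exp_le_exp.2 ?_) (by positivity))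
  have h1 := hR (β - β₀) fun j hj => by simp [hβ j hj, hβ₀ j hj]
  have h2 := shrink_nsq hA (by positivity : (0 : ℝ) < 2 * c) β β₀
  have h3 : ∑ j, h j (β j) = t / 2 * (nsq β / (2 * c)) := by
    simp only [hh, nsq, ← Finset.mul_sum]
    field_simp; ring
  have h4 : 0 ≤ A * nsq (β - β₀) := mul_nonneg hA.le (nsq_nonneg _)
  rw [residual_eq, h3]
  nlinarith

/-- Almost surely under the prior `β j = 0`, so `β` stays at distance at least `ψ` from `β₀` and the
likelihood is bounded pointwise. Since `β - β₀` is not supported in `γ`, the curvature bound is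
required for all `δ`. -/
theorem condMarginal_le_of_missing (hA : 0 < A)
    (hR : ∀ δ : Fin p → ℝ, T + 2 * A * nsq δ ≤ nsq (e - X.mulVec δ)) {ψ : ℝ} (hψ : 0 ≤ ψ)
    {j : Fin p} (hj : j ∉ γ) (hjψ : ψ ≤ |β₀ j|) (c : ℝ≥0) {t : ℝ≥0} (ht : t ≠ 0) :
    condMarginal X (X.mulVec β₀ + e) γ c t ≤
      ENNReal.ofReal (kernelExp n t (T + 2 * A * ψ ^ 2)) := by
  have : condMarginal X (X.mulVec β₀ + e) γ c t ≤
      ∫⁻ β, ENNReal.ofReal (kernelExp n t (T + 2 * A * ψ ^ 2)) ∂coefPrior γ (c * t⁻¹) := by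
    refine lintegral_mono_ae ?_
    filter_upwards [ae_coefPrior_support γ (c * t⁻¹)] with β hβ
    rw [likelihood_eq _ _ _ ht, kernelExp]
    refine ENNReal.ofReal_le_ofReal
      (mul_le_mul_of_nonneg_left (Real.exp_le_exp.2 ?_) (by positivity))
    have h1 := hR (β - β₀)
    have h2 : ψ ^ 2 ≤ nsq (β - β₀) := by
      calc ψ ^ 2 ≤ |β₀ j| ^ 2 := pow_le_pow_left₀ hψ hjψ 2
        _ = (β - β₀) j ^ 2 := by simp [hβ j hj]
        _ ≤ _ := Finset.single_le_sum (f := fun i => (β - β₀) i ^ 2)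
          (fun _ _ => sq_nonneg _) (Finset.mem_univ j)
    rw [residual_eq, neg_mul, neg_mul, neg_le_neg_iff]
    refine mul_le_mul_of_nonneg_left (le_trans ?_ h1) (by positivity)
    have := mul_le_mul_of_nonneg_left h2 (by positivity : 0 ≤ 2 * A)
    linarith
  simpa using this

/-- After the shift `β = β₀ + δ` the log integrand is an even quadratic plus a linear form in `δ`.
The linear form only increases the integral (`lintegral_slab_even_le`); what remains is bounded
below by an explicit Gaussian integral. -/
theorem le_condMarginal {D : ℝ} (hD : 0 ≤ D) (hβ₀ : ∀ j ∉ γ, β₀ j = 0)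
    (hX : ∀ δ : Fin p → ℝ, nsq (X.mulVec δ) ≤ D * nsq δ) {c t : ℝ≥0} (hc : c ≠ 0) (ht : t ≠ 0) :
    ENNReal.ofReal √(1 / (1 + c * D)) ^ γ.card *
        ENNReal.ofReal (kernelExp n t (nsq e + nsq β₀ / c)) ≤
      condMarginal X (X.mulVec β₀ + e) γ c t := by
  have ht' : (0 : ℝ) < t := by exact_mod_cast pos_iff_ne_zero.2 ht
  have hc' : (0 : ℝ) < c := by exact_mod_cast pos_iff_ne_zero.2 hc
  have hv : c * t⁻¹ ≠ 0 := mul_ne_zero hc (inv_ne_zero ht)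
  set N : ℝ := √(t / (2 * Real.pi)) ^ n * (√(2 * Real.pi * ((c * t⁻¹ : ℝ≥0) : ℝ)))⁻¹ ^ γ.card
    with hN
  have hN0 : 0 ≤ N := by positivity
  set q : (Fin p → ℝ) → ℝ := fun δ =>
    -(t / 2) * (nsq e + nsq (X.mulVec δ) + (nsq δ + nsq β₀) / c) with hq
  set l : (Fin p → ℝ) → ℝ := fun δ => -(t / 2) * (-2 * (e ⬝ᵥ X.mulVec δ) + 2 * (β₀ ⬝ᵥ δ) / c)
    with hl
  have hqm : Measurable q := by simp only [hq]; fun_prop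
  have hlm : Measurable l := by simp only [hl]; fun_prop
  have key : condMarginal X (X.mulVec β₀ + e) γ c t =
      ENNReal.ofReal N * ∫⁻ δ, ENNReal.ofReal (Real.exp (q δ + l δ)) ∂slab γ := by
    have hlik : ∀ β, likelihood X (X.mulVec β₀ + e) β t⁻¹ = ENNReal.ofReal
        (√(t / (2 * Real.pi)) ^ n * Real.exp (-(t / 2) * nsq (X.mulVec β₀ + e - X.mulVec β))) :=
      fun β => likelihood_eq _ _ _ ht
    rw [condMarginal, coefPrior_eq_withDensity γ hv]
    simp_rw [hlik]
    rw [lintegral_withDensity_eq_lintegral_mul _ _ (by fun_prop)]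
    swap
    · refine Finset.measurable_fun_prod _ fun j _ => ?_
      split_ifs
      · exact (measurable_gaussianPDF _ _).comp (measurable_pi_apply j)
      · exact measurable_const
    rw [← lintegral_const_mul _ (by fun_prop), ← lintegral_slab_add hβ₀]
    refine lintegral_congr_ae ?_
    filter_upwards [ae_slab_support γ] with δ hδ
    have hprod : (∏ j, if j ∈ γ then gaussianPDF 0 (c * t⁻¹) ((δ + β₀) j) else 1) =
        ENNReal.ofReal ((√(2 * Real.pi * ((c * t⁻¹ : ℝ≥0) : ℝ)))⁻¹ ^ γ.card *
          Real.exp (-(t / 2) * (nsq (δ + β₀) / c))) := by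
      rw [Finset.prod_ite_mem, Finset.univ_inter]
      simp only [gaussianPDF]
      rw [← ENNReal.ofReal_prod_of_nonneg fun i _ => gaussianPDFReal_nonneg _ _ _]
      congr 1
      simp only [gaussianPDFReal, Finset.prod_mul_distrib, Finset.prod_const, ← Real.exp_sum]
      congr 2
      rw [nsq, Finset.sum_div, Finset.mul_sum, ← Finset.sum_subset (Finset.subset_univ γ)]
      · refine Finset.sum_congr rfl fun j _ => ?_
        push_cast
        field_simp
        ring
      · intro j _ hj
        simp [hδ j hj, hβ₀ j hj]
    rw [Pi.mul_apply, hprod, ← ENNReal.ofReal_mul (by positivity), ← ENNReal.ofReal_mul hN0]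
    congr 1
    rw [residual_eq, add_sub_cancel_right]
    have : q δ + l δ = -(t / 2) * (nsq (δ + β₀) / c) + -(t / 2) * nsq (e - X.mulVec δ) := by
      simp only [hq, hl, nsq_add, nsq_sub, dotProduct_comm δ β₀]
      ring
    rw [this, Real.exp_add, hN]
    ring
  rw [key]
  refine le_trans ?_ (mul_le_mul_right (lintegral_slab_even_le γ (l := l) (q := q) ?_ ?_ hlm hqm) _)
  · have h1 : ∫⁻ δ, ENNReal.ofReal (Real.exp (-(t / 2) * (nsq e + nsq β₀ / c)) *
        Real.exp (-(t / 2 * (D + 1 / c)) * nsq δ)) ∂slab γ ≤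
        ∫⁻ δ, ENNReal.ofReal (Real.exp (q δ)) ∂slab γ := by
      refine lintegral_mono fun δ => ENNReal.ofReal_le_ofReal ?_
      rw [← Real.exp_add, Real.exp_le_exp]
      simp only [hq]
      have h := mul_le_mul_of_nonneg_left (hX δ) (by positivity : (0 : ℝ) ≤ t / 2)
      have h' : (nsq δ + nsq β₀) / c = nsq δ * (1 / c) + nsq β₀ / c := by ring
      rw [h']
      linarith
    refine le_trans (le_of_eq ?_) (mul_le_mul_right h1 _)
    simp_rw [ENNReal.ofReal_mul (Real.exp_nonneg (-(t / 2) * (nsq e + nsq β₀ / c)))]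
    rw [lintegral_const_mul _ (by fun_prop), lintegral_slab_exp_neg_mul_nsq γ (by positivity),
      ← ENNReal.ofReal_pow (by positivity), ← ENNReal.ofReal_pow (by positivity),
      ← ENNReal.ofReal_mul (by positivity), ← ENNReal.ofReal_mul (by positivity),
      ← ENNReal.ofReal_mul (by positivity)]
    congr 1
    have h2 : √(1 / (1 + c * D)) =
        (√(2 * Real.pi * ((c * t⁻¹ : ℝ≥0) : ℝ)))⁻¹ * √(Real.pi / (t / 2 * (D + 1 / c))) := by
      rw [← Real.sqrt_inv, ← Real.sqrt_mul (by positivity)]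
      congr 1
      push_cast
      field_simp
      ring
    rw [h2, hN, mul_pow, kernelExp]
    ring
  · intro δ; simp only [hl, Matrix.mulVec_neg, dotProduct_neg]; ring
  · intro δ; simp only [hq, Matrix.mulVec_neg, nsq_neg]

end Bounds

/-! ### Integration over the precision. -/

theorem measurable_gammaPDF (a r : ℝ) : Measurable (gammaPDF a r) :=
  (measurable_gammaPDFReal a r).ennreal_ofReal

theorem ae_chiSquare_pos (ν : ℝ) : ∀ᵐ τ ∂chiSquareMeasure ν, 0 < τ := by
  rw [chiSquareMeasure, gammaMeasure, ae_withDensity_iff (measurable_gammaPDF _ _)]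
  filter_upwards [Measure.ae_ne volume (0 : ℝ)] with τ h0 hτ
  rcases lt_trichotomy τ 0 with h | h | h
  · exact absurd (gammaPDF_of_neg h) hτ
  · exact absurd h h0
  · exact h

theorem lintegral_chiSquare_mono {ν : ℝ} {f g : ℝ≥0 → ℝ≥0∞} (h : ∀ t, t ≠ 0 → f t ≤ g t) :
    ∫⁻ τ, f τ.toNNReal ∂chiSquareMeasure ν ≤ ∫⁻ τ, g τ.toNNReal ∂chiSquareMeasure ν := by
  refine lintegral_mono_ae ?_
  filter_upwards [ae_chiSquare_pos ν] with τ hτ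
  exact h _ (Real.toNNReal_pos.2 hτ).ne'

/-- The Gaussian likelihood kernel integrated over the precision. -/
noncomputable def tauInt (n : ℕ) (ν T : ℝ) : ℝ≥0∞ :=
  ∫⁻ τ, ENNReal.ofReal (kernelExp n τ.toNNReal T) ∂chiSquareMeasure ν

/-- Kernel times chi-square density is an unnormalized gamma density of shape `(n + ν) / 2` and rate
`(1 + T) / 2`. The constant `K` is free of `T`, so it cancels in every comparison. -/
theorem exists_tauInt_eq (n : ℕ) {ν : ℝ} (hν : 0 < ν) :
    ∃ K : ℝ, 0 < K ∧ ∀ T : ℝ, -1 < T →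
      tauInt n ν T = ENNReal.ofReal (K * ((1 + T) / 2) ^ (-((n + ν) / 2))) := by
  have hG : 0 < Real.Gamma (ν / 2) := Real.Gamma_pos_of_pos (by positivity)
  have ha : 0 < (n + ν) / 2 := by positivity
  have hG' : 0 < Real.Gamma ((n + ν) / 2) := Real.Gamma_pos_of_pos ha
  refine ⟨(1 / 2 : ℝ) ^ (ν / 2) / Real.Gamma (ν / 2) * (√(1 / (2 * Real.pi))) ^ n *
    Real.Gamma ((n + ν) / 2), by positivity, fun T hT => ?_⟩
  have hr : 0 < (1 + T) / 2 := by linarith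
  have h1 : tauInt n ν T = ∫⁻ τ, ENNReal.ofReal ((1 / 2 : ℝ) ^ (ν / 2) / Real.Gamma (ν / 2) *
      (√(1 / (2 * Real.pi))) ^ n * Real.Gamma ((n + ν) / 2) * ((1 + T) / 2) ^ (-((n + ν) / 2))) *
      gammaPDF ((n + ν) / 2) ((1 + T) / 2) τ := by
    rw [tauInt, chiSquareMeasure, gammaMeasure, lintegral_withDensity_eq_lintegral_mul _
      (measurable_gammaPDF _ _) (by unfold kernelExp; fun_prop)]
    refine lintegral_congr_ae ?_
    filter_upwards [Measure.ae_ne volume (0 : ℝ)] with τ h0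
    rw [Pi.mul_apply]
    rcases lt_or_gt_of_ne h0 with h | h
    · simp [gammaPDF_of_neg h]
    · rw [gammaPDF_of_nonneg h.le, gammaPDF_of_nonneg h.le, ← ENNReal.ofReal_mul (by positivity),
        ← ENNReal.ofReal_mul (by positivity)]
      congr 1
      have e1 : √(τ / (2 * Real.pi)) ^ n = √(1 / (2 * Real.pi)) ^ n * τ ^ ((n : ℝ) / 2) := by
        rw [div_eq_mul_one_div, mul_comm, Real.sqrt_mul (by positivity), mul_pow,
          Real.sqrt_eq_rpow τ, ← Real.rpow_natCast (τ ^ (1 / 2 : ℝ)), ← Real.rpow_mul h.le]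
        congr 2; ring
      have e2 : τ ^ ((n + ν) / 2 - 1) = τ ^ (ν / 2 - 1) * τ ^ ((n : ℝ) / 2) := by
        rw [← Real.rpow_add h]; congr 1; ring
      have e3 : Real.exp (-((1 + T) / 2 * τ)) =
          Real.exp (-(1 / 2 * τ)) * Real.exp (-(τ / 2) * T) := by
        rw [← Real.exp_add]; congr 1; ring
      have e4 : ((1 + T) / 2) ^ (-((n + ν) / 2)) * ((1 + T) / 2) ^ ((n + ν) / 2) = 1 := by
        rw [← Real.rpow_add hr]; simp
      rw [kernelExp, Real.coe_toNNReal _ h.le, e1, e2, e3]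
      have hg := hG'.ne'
      calc _ = (1 / 2 : ℝ) ^ (ν / 2) / Real.Gamma (ν / 2) * √(1 / (2 * Real.pi)) ^ n *
            (τ ^ (ν / 2 - 1) * τ ^ ((n : ℝ) / 2)) *
            (Real.exp (-(1 / 2 * τ)) * Real.exp (-(τ / 2) * T)) *
            (((1 + T) / 2) ^ (-((n + ν) / 2)) * ((1 + T) / 2) ^ ((n + ν) / 2)) := by
            rw [e4]; ring
        _ = _ := by
          generalize ((1 + T) / 2) ^ (-((n + ν) / 2)) = u
          generalize ((1 + T) / 2) ^ ((n + ν) / 2) = w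
          field_simp
  rw [h1, lintegral_const_mul _ (measurable_gammaPDF _ _),
    lintegral_gammaPDF_eq_one ha hr, mul_one]

theorem tauInt_pos (n : ℕ) {ν T : ℝ} (hν : 0 < ν) (hT : -1 < T) : 0 < tauInt n ν T := by
  obtain ⟨K, hK, h⟩ := exists_tauInt_eq n hν
  have : 0 < (1 + T) / 2 := by linarith
  rw [h T hT, ENNReal.ofReal_pos]; positivity

theorem tauInt_ne_top (n : ℕ) {ν T : ℝ} (hν : 0 < ν) (hT : -1 < T) : tauInt n ν T ≠ ∞ := by
  obtain ⟨K, hK, h⟩ := exists_tauInt_eq n hν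
  rw [h T hT]; exact ENNReal.ofReal_ne_top

theorem tauInt_anti (n : ℕ) (ν : ℝ) {T₁ T₂ : ℝ} (h : T₁ ≤ T₂) : tauInt n ν T₂ ≤ tauInt n ν T₁ := by
  refine lintegral_mono fun τ => ENNReal.ofReal_le_ofReal ?_
  refine mul_le_mul_of_nonneg_left (Real.exp_le_exp.2 ?_) (by positivity)
  have : (0 : ℝ) ≤ τ.toNNReal / 2 := by positivity
  nlinarith

/-- This is `1 + x ≤ exp x` applied to the ratio `(1 + T₂) / (1 + T₁)`. -/
theorem tauInt_le_exp_mul (n : ℕ) {ν T₁ T₂ : ℝ} (hν : 0 < ν) (h₁ : -1 < T₁) (h₂ : -1 < T₂) :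
    tauInt n ν T₁ ≤
      ENNReal.ofReal (Real.exp ((n + ν) / 2 * ((T₂ - T₁) / (1 + T₁)))) * tauInt n ν T₂ := by
  obtain ⟨K, hK, h⟩ := exists_tauInt_eq n hν
  have hr₁ : 0 < 1 + T₁ := by linarith
  have hr₂ : 0 < 1 + T₂ := by linarith
  have ha : 0 ≤ (n + ν) / 2 := by positivity
  rw [h _ h₁, h _ h₂, ← ENNReal.ofReal_mul (Real.exp_nonneg _)]
  refine ENNReal.ofReal_le_ofReal ?_
  have h3 : (1 + T₂) / (1 + T₁) ≤ Real.exp ((T₂ - T₁) / (1 + T₁)) := by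
    have := Real.add_one_le_exp ((T₂ - T₁) / (1 + T₁))
    refine le_trans (le_of_eq ?_) this
    field_simp; ring
  have h4 := Real.rpow_le_rpow (by positivity) h3 ha
  rw [← Real.exp_mul, mul_comm ((T₂ - T₁) / (1 + T₁))] at h4
  have h5 : ((1 + T₁) / 2) ^ (-((n + ν) / 2)) =
      ((1 + T₂) / (1 + T₁)) ^ ((n + ν) / 2) * ((1 + T₂) / 2) ^ (-((n + ν) / 2)) := by
    rw [Real.rpow_neg (by positivity), Real.rpow_neg (by positivity), ← Real.inv_rpow (by positivity),
      ← Real.inv_rpow (by positivity), ← Real.mul_rpow (by positivity) (by positivity)]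
    congr 1
    field_simp
  rw [h5]
  calc K * (((1 + T₂) / (1 + T₁)) ^ ((n + ν) / 2) * ((1 + T₂) / 2) ^ (-((n + ν) / 2)))
      = ((1 + T₂) / (1 + T₁)) ^ ((n + ν) / 2) * (K * ((1 + T₂) / 2) ^ (-((n + ν) / 2))) := by ring
    _ ≤ _ := mul_le_mul_of_nonneg_right h4 (by positivity)

/-- Two exchange rates between residuals and exponents are needed: `κ`, from above, for what `T`
falls short of `S`, and `κ'`, from below, for the penalty `L`. -/
theorem tauInt_add_le (n : ℕ) {ν T L S κ κ' : ℝ} (hν : 0 < ν) (hT : 0 ≤ T) (hL : 0 ≤ L)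
    (hTS : T ≤ S) (hκ : (n + ν) / 2 ≤ κ * (1 + T)) (hκ' : κ' * (1 + T + L) ≤ (n + ν) / 2) :
    tauInt n ν (T + L) ≤
      ENNReal.ofReal (Real.exp (κ * (S - T) - κ' * L)) * tauInt n ν S := by
  have h2 := tauInt_le_exp_mul n hν (T₁ := T + L) (T₂ := S) (by linarith) (by linarith)
  have h3 : (n + ν) / 2 * ((S - (T + L)) / (1 + (T + L))) ≤ κ * (S - T) - κ' * L := by
    have hden : 0 < 1 + (T + L) := by linarith
    have hκ0 : 0 < κ := by
      by_contra h
      have : κ * (1 + T) ≤ 0 := mul_nonpos_of_nonpos_of_nonneg (not_lt.1 h) (by linarith)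
      have : 0 < (n + ν) / 2 := by positivity
      linarith
    rw [← mul_div_assoc, div_le_iff₀ hden]
    have e1 : (n + ν) / 2 * (S - T) ≤ κ * (S - T) * (1 + (T + L)) := by
      calc (n + ν) / 2 * (S - T) ≤ (κ * (1 + T)) * (S - T) :=
            mul_le_mul_of_nonneg_right hκ (by linarith)
        _ ≤ (κ * (1 + (T + L))) * (S - T) := by
            refine mul_le_mul_of_nonneg_right (mul_le_mul_of_nonneg_left ?_ hκ0.le) ?_ <;> linarith
        _ = _ := by ring
    have e2 := mul_le_mul_of_nonneg_right hκ' hL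
    nlinarith
  exact h2.trans (mul_le_mul_left (ENNReal.ofReal_le_ofReal (Real.exp_le_exp.2 h3)) _)

/-! ### Comparison of marginal likelihoods at fixed and integrated `c`. -/

/-- The marginal likelihood of a model given `c`. -/
noncomputable def margAt {n p : ℕ} (ν : ℝ) (X : Matrix (Fin n) (Fin p) ℝ) (y : Fin n → ℝ)
    (γ : Finset (Fin p)) (c : ℝ≥0) : ℝ≥0∞ :=
  ∫⁻ τ, condMarginal X y γ c τ.toNNReal ∂chiSquareMeasure ν

theorem marginalLikelihood_eq {n p : ℕ} (ν : ℝ) (g : Measure ℝ≥0) (X : Matrix (Fin n) (Fin p) ℝ)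
    (y : Fin n → ℝ) (γ : Finset (Fin p)) :
    marginalLikelihood ν g X y γ = ∫⁻ c, margAt ν X y γ c ∂g := rfl

theorem margAt_le_of_forall {n p : ℕ} {ν : ℝ} {X : Matrix (Fin n) (Fin p) ℝ} {y : Fin n → ℝ}
    {γ : Finset (Fin p)} {c : ℝ≥0} {K : ℝ≥0∞} (hK : K ≠ ∞) {T : ℝ}
    (h : ∀ t : ℝ≥0, t ≠ 0 → condMarginal X y γ c t ≤ K * ENNReal.ofReal (kernelExp n t T)) :
    margAt ν X y γ c ≤ K * tauInt n ν T := by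
  rw [tauInt, ← lintegral_const_mul' _ _ hK]
  exact lintegral_chiSquare_mono h

theorem le_margAt_of_forall {n p : ℕ} {ν : ℝ} {X : Matrix (Fin n) (Fin p) ℝ} {y : Fin n → ℝ}
    {γ : Finset (Fin p)} {c : ℝ≥0} {K : ℝ≥0∞} (hK : K ≠ ∞) {T : ℝ}
    (h : ∀ t : ℝ≥0, t ≠ 0 → K * ENNReal.ofReal (kernelExp n t T) ≤ condMarginal X y γ c t) :
    K * tauInt n ν T ≤ margAt ν X y γ c := by
  rw [tauInt, ← lintegral_const_mul' _ _ hK]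
  exact lintegral_chiSquare_mono h

section Bounds

variable {n p : ℕ} {ν : ℝ} {X : Matrix (Fin n) (Fin p) ℝ} {e : Fin n → ℝ} {β₀ : Fin p → ℝ}
  {γ γ₀ : Finset (Fin p)} {T A D : ℝ}

theorem le_margAt (hD : 0 ≤ D) (hβ₀ : ∀ j ∉ γ, β₀ j = 0)
    (hX : ∀ δ : Fin p → ℝ, nsq (X.mulVec δ) ≤ D * nsq δ) {c : ℝ≥0} (hc : c ≠ 0) :
    ENNReal.ofReal (√(1 / (1 + c * D)) ^ γ.card) * tauInt n ν (nsq e + nsq β₀ / c) ≤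
      margAt ν X (X.mulVec β₀ + e) γ c := by
  refine le_margAt_of_forall ENNReal.ofReal_ne_top fun t ht => ?_
  rw [ENNReal.ofReal_pow (by positivity)]
  exact le_condMarginal hD hβ₀ hX hc ht

theorem tauInt_le_margAt (hD : 0 ≤ D) (hβ₀ : ∀ j ∉ γ, β₀ j = 0)
    (hX : ∀ δ : Fin p → ℝ, nsq (X.mulVec δ) ≤ D * nsq δ) {c : ℝ≥0} (hc : c ≠ 0) :
    tauInt n ν (nsq e + nsq β₀ / c) ≤
      ENNReal.ofReal (√(1 + c * D) ^ γ.card) * margAt ν X (X.mulVec β₀ + e) γ c := by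
  have h := mul_le_mul_right (le_margAt (ν := ν) (e := e) hD hβ₀ hX hc)
    (ENNReal.ofReal (√(1 + c * D) ^ γ.card))
  refine le_trans (le_of_eq ?_) h
  have hc' : (0 : ℝ) < 1 + c * D := by positivity
  rw [← mul_assoc, ← ENNReal.ofReal_mul (by positivity), ← mul_pow, ← Real.sqrt_mul hc'.le,
    mul_one_div_cancel hc'.ne', Real.sqrt_one, one_pow, ENNReal.ofReal_one, one_mul]

/-- Comparison of the marginal likelihoods of two models at the same value of `c`. -/
theorem margAt_le_margAt (hν : 0 < ν) (hA : 0 < A) (hD : 0 ≤ D)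
    (hγ : γ₀ ⊆ γ) (hβ₀ : ∀ j ∉ γ₀, β₀ j = 0)
    (hX : ∀ δ : Fin p → ℝ, nsq (X.mulVec δ) ≤ D * nsq δ)
    (hR : ∀ δ : Fin p → ℝ, (∀ j ∉ γ, δ j = 0) → T + 2 * A * nsq δ ≤ nsq (e - X.mulVec δ))
    {c : ℝ≥0} (hc : c ≠ 0) (hT : 0 ≤ T) {κ Δ : ℝ} (hκ : (n + ν) / 2 ≤ κ * (1 + T))
    (hΔ0 : 0 ≤ Δ) (hΔ : nsq e - T + (nsq β₀ / c - nsq β₀ / (c + 1 / A)) ≤ Δ) :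
    margAt ν X (X.mulVec β₀ + e) γ c ≤
      ENNReal.ofReal (√(1 / (A * c)) ^ γ.card * √(1 + c * D) ^ γ₀.card * Real.exp (κ * Δ)) *
        margAt ν X (X.mulVec β₀ + e) γ₀ c := by
  have hc' : (0 : ℝ) < c := by exact_mod_cast pos_iff_ne_zero.2 hc
  have hs : 0 ≤ nsq β₀ / (c + 1 / A) := div_nonneg (nsq_nonneg _) (by positivity)
  have hs' : 0 ≤ nsq β₀ / c := div_nonneg (nsq_nonneg _) (by positivity)
  have h1 : margAt ν X (X.mulVec β₀ + e) γ c ≤ ENNReal.ofReal (√(1 / (A * c)) ^ γ.card) *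
      tauInt n ν (T + nsq β₀ / (c + 1 / A)) := by
    refine margAt_le_of_forall ENNReal.ofReal_ne_top fun t ht => ?_
    rw [ENNReal.ofReal_pow (by positivity)]
    exact condMarginal_le_of_precise hA (fun j hj => hβ₀ j fun h => hj (hγ h)) hR hc ht
  have h2 := tauInt_le_exp_mul n hν (T₁ := T + nsq β₀ / (c + 1 / A)) (T₂ := nsq e + nsq β₀ / c)
    (by linarith) (by have := nsq_nonneg e; linarith)
  have h3 : (n + ν) / 2 * ((nsq e + nsq β₀ / c - (T + nsq β₀ / (c + 1 / A))) /
      (1 + (T + nsq β₀ / (c + 1 / A)))) ≤ κ * Δ := by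
    have hden : 0 < 1 + (T + nsq β₀ / (c + 1 / A)) := by linarith
    have hκ0 : 0 < κ := by
      by_contra h
      have : κ * (1 + T) ≤ 0 := mul_nonpos_of_nonpos_of_nonneg (not_lt.1 h) (by linarith)
      have : 0 < (n + ν) / 2 := by positivity
      linarith
    rw [← mul_div_assoc, div_le_iff₀ hden]
    calc (n + ν) / 2 * (nsq e + nsq β₀ / c - (T + nsq β₀ / (c + 1 / A)))
        ≤ (n + ν) / 2 * Δ := mul_le_mul_of_nonneg_left (by linarith) (by positivity)
      _ ≤ (κ * (1 + T)) * Δ := mul_le_mul_of_nonneg_right hκ hΔ0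
      _ ≤ (κ * (1 + (T + nsq β₀ / (c + 1 / A)))) * Δ := by
        refine mul_le_mul_of_nonneg_right (mul_le_mul_of_nonneg_left ?_ hκ0.le) hΔ0
        linarith
      _ = _ := by ring
  refine h1.trans ((mul_le_mul_right (h2.trans (mul_le_mul' (ENNReal.ofReal_le_ofReal
    (Real.exp_le_exp.2 h3)) (tauInt_le_margAt hD hβ₀ hX hc))) _).trans (le_of_eq ?_))
  rw [ENNReal.ofReal_mul (by positivity), ENNReal.ofReal_mul (by positivity)]
  ring

/-- Lower bound for the marginal likelihood of the true model. -/
theorem tauInt_le_marginalLikelihood (g : Measure ℝ≥0) (hD : 0 ≤ D) (hβ₀ : ∀ j ∉ γ, β₀ j = 0)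
    (hX : ∀ δ : Fin p → ℝ, nsq (X.mulVec δ) ≤ D * nsq δ) {φ Φ : ℝ≥0} (hφ : φ ≠ 0) :
    g (Set.Icc φ Φ) * tauInt n ν (nsq e + nsq β₀ / φ) ≤
      ENNReal.ofReal (√(1 + Φ * D) ^ γ.card) *
        marginalLikelihood ν g X (X.mulVec β₀ + e) γ := by
  rw [marginalLikelihood_eq, ← lintegral_const_mul' _ _ ENNReal.ofReal_ne_top]
  -- Only `c ∈ [φ, Φ]` is kept. There the shrinkage cost is largest at `φ` and the dimension cost at
  -- `Φ`.
  refine le_trans ?_ (setLIntegral_le_lintegral (Set.Icc φ Φ) _)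
  rw [mul_comm, ← setLIntegral_const]
  refine setLIntegral_mono' measurableSet_Icc fun c hc => ?_
  have hc0 : c ≠ 0 := ((pos_iff_ne_zero.2 hφ).trans_le hc.1).ne'
  have hφ' : (0 : ℝ) < φ := by exact_mod_cast pos_iff_ne_zero.2 hφ
  have h1 : (φ : ℝ) ≤ c := by exact_mod_cast hc.1
  have h2 : (c : ℝ) ≤ Φ := by exact_mod_cast hc.2
  refine (tauInt_anti n ν ?_).trans ((tauInt_le_margAt hD hβ₀ hX hc0).trans
    (mul_le_mul_left (ENNReal.ofReal_le_ofReal ?_) _))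
  · have := div_le_div_of_nonneg_left (nsq_nonneg β₀) hφ' h1
    linarith
  · gcongr

/-- Upper bound for the marginal likelihood given a small value of `c`. -/
theorem margAt_le_tauInt_of_diffuse (hν : 0 < ν) (hA : 0 < A)
    (hβ₀ : ∀ j ∉ γ, β₀ j = 0)
    (hR : ∀ δ : Fin p → ℝ, (∀ j ∉ γ, δ j = 0) → T + 2 * A * nsq δ ≤ nsq (e - X.mulVec δ))
    {c : ℝ≥0} (hT : 0 ≤ T) {κ κ' S L : ℝ} (hκ : (n + ν) / 2 ≤ κ * (1 + T)) (hL : 0 ≤ L)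
    (hLc : L ≤ nsq β₀ / (2 * c + 1 / A)) (hκ' : κ' * (1 + T + L) ≤ (n + ν) / 2)
    (hTS : T ≤ S) :
    margAt ν X (X.mulVec β₀ + e) γ c ≤
      ENNReal.ofReal (√2 ^ γ.card * Real.exp (κ * (S - T) - κ' * L)) * tauInt n ν S := by
  have h1 : margAt ν X (X.mulVec β₀ + e) γ c ≤ ENNReal.ofReal (√2 ^ γ.card) *
      tauInt n ν (T + nsq β₀ / (2 * c + 1 / A)) := by
    refine margAt_le_of_forall ENNReal.ofReal_ne_top fun t ht => ?_
    rw [ENNReal.ofReal_pow (by positivity)]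
    exact condMarginal_le_of_diffuse hA hβ₀ hR c ht
  have h2 := tauInt_add_le n hν hT hL hTS hκ hκ'
  refine h1.trans ((mul_le_mul_right ((tauInt_anti n ν (by linarith)).trans (h2)) _).trans (le_of_eq ?_))
  rw [ENNReal.ofReal_mul (by positivity)]
  ring

/-- Upper bound for the marginal likelihood of a model that misses a true coefficient. -/
theorem marginalLikelihood_le_tauInt_of_missing (g : Measure ℝ≥0) [IsProbabilityMeasure g]
    (hν : 0 < ν) (hA : 0 < A)
    (hR : ∀ δ : Fin p → ℝ, T + 2 * A * nsq δ ≤ nsq (e - X.mulVec δ)) {ψ : ℝ} (hψ : 0 ≤ ψ)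
    {j : Fin p} (hj : j ∉ γ) (hjψ : ψ ≤ |β₀ j|) (hT : 0 ≤ T) {κ κ' S : ℝ}
    (hκ : (n + ν) / 2 ≤ κ * (1 + T)) (hκ' : κ' * (1 + T + 2 * A * ψ ^ 2) ≤ (n + ν) / 2)
    (hTS : T ≤ S) :
    marginalLikelihood ν g X (X.mulVec β₀ + e) γ ≤
      ENNReal.ofReal (Real.exp (κ * (S - T) - κ' * (2 * A * ψ ^ 2))) * tauInt n ν S := by
  set L := 2 * A * ψ ^ 2 with hLdef
  have hL : 0 ≤ L := by positivity
  have h1 : ∀ c, margAt ν X (X.mulVec β₀ + e) γ c ≤ 1 * tauInt n ν (T + L) := by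
    refine fun c => margAt_le_of_forall ENNReal.one_ne_top fun t ht => ?_
    rw [one_mul]
    exact condMarginal_le_of_missing hA hR hψ hj hjψ c ht
  have h2 := tauInt_add_le n hν hT hL hTS hκ hκ'
  rw [marginalLikelihood_eq]
  refine (lintegral_mono h1).trans ?_
  simp only [one_mul, lintegral_const, measure_univ, mul_one]
  exact h2

/-- The marginal likelihood is finite. -/
theorem marginalLikelihood_ne_top (g : Measure ℝ≥0) [IsProbabilityMeasure g] (hν : 0 < ν)
    (X : Matrix (Fin n) (Fin p) ℝ) (y : Fin n → ℝ) (γ : Finset (Fin p)) :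
    marginalLikelihood ν g X y γ ≠ ∞ := by
  have h1 : ∀ c, margAt ν X y γ c ≤ 1 * tauInt n ν 0 := by
    refine fun c => margAt_le_of_forall ENNReal.one_ne_top fun t ht => ?_
    rw [one_mul]
    have : condMarginal X y γ c t ≤
        ∫⁻ β, ENNReal.ofReal (kernelExp n t 0) ∂coefPrior γ (c * t⁻¹) := by
      refine lintegral_mono fun β => ?_
      rw [likelihood_eq _ _ _ ht, kernelExp]
      refine ENNReal.ofReal_le_ofReal
        (mul_le_mul_of_nonneg_left (Real.exp_le_exp.2 ?_) (by positivity))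
      have : 0 ≤ (t : ℝ) / 2 * nsq (y - X.mulVec β) := mul_nonneg (by positivity) (nsq_nonneg _)
      linarith
    simpa using this
  rw [marginalLikelihood_eq]
  refine ((lintegral_mono h1).trans_lt ?_).ne
  simpa using (tauInt_ne_top n hν (by norm_num)).lt_top

end Bounds

/-! ### The eigenvalue condition as a bound on quadratic forms. -/

/-- The quadratic-form version of the eigenvalue condition on `Xᵀ X / n`. -/
def IsConditioned {n p : ℕ} (b : ℝ) (X : Matrix (Fin n) (Fin p) ℝ) : Prop :=
  ∀ v : Fin p → ℝ, n / b * nsq v ≤ nsq (X.mulVec v) ∧ nsq (X.mulVec v) ≤ n * b * nsq v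

theorem nsq_eq_dotProduct {n : ℕ} (v : Fin n → ℝ) : nsq v = v ⬝ᵥ v := by
  simp [nsq, dotProduct, sq]

theorem le_dotProduct_mulVec_of_spectrum {p : ℕ} {M : Matrix (Fin p) (Fin p) ℝ}
    (hM : M.IsHermitian) {r : ℝ} (h : ∀ x ∈ spectrum ℝ M, r ≤ x) (v : Fin p → ℝ) :
    r * nsq v ≤ v ⬝ᵥ M.mulVec v := by
  have hB : (M - algebraMap ℝ _ r).IsHermitian := by
    refine hM.sub ?_
    rw [Matrix.algebraMap_eq_diagonal]
    exact Matrix.isHermitian_diagonal _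
  have hpos : (M - algebraMap ℝ _ r).PosSemidef := by
    rw [hB.posSemidef_iff_eigenvalues_nonneg]
    intro i
    have := hB.eigenvalues_mem_spectrum_real i
    rw [← spectrum.sub_singleton_eq, Set.sub_singleton] at this
    obtain ⟨x, hx, hxe⟩ := this
    have := h x hx
    simp only [Pi.zero_apply, ← hxe]
    linarith
  have := hpos.dotProduct_mulVec_nonneg v
  rw [Matrix.sub_mulVec, dotProduct_sub, Algebra.algebraMap_eq_smul_one, Matrix.smul_mulVec,
    Matrix.one_mulVec, dotProduct_smul, smul_eq_mul, star_trivial, ← nsq_eq_dotProduct] at this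
  linarith

theorem isConditioned_of_wellConditioned {n p : ℕ} {b : ℝ} (hn : 0 < n)
    {X : Matrix (Fin n) (Fin p) ℝ} (h : WellConditioned b X) : IsConditioned b X := by
  have hn' : (0 : ℝ) < n := by exact_mod_cast hn
  set M := (n : ℝ)⁻¹ • (X.transpose * X) with hMdef
  have hM : M.IsHermitian := by
    have := Matrix.isHermitian_conjTranspose_mul_self X
    rw [Matrix.conjTranspose_eq_transpose_of_trivial] at this
    exact this.smul (IsSelfAdjoint.all _)
  have hq : ∀ v, v ⬝ᵥ M.mulVec v = (n : ℝ)⁻¹ * nsq (X.mulVec v) := by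
    intro v
    rw [hMdef, Matrix.smul_mulVec, dotProduct_smul, smul_eq_mul, ← Matrix.mulVec_mulVec,
      Matrix.dotProduct_mulVec, Matrix.vecMul_transpose, nsq_eq_dotProduct]
  intro v
  have h1 := le_dotProduct_mulVec_of_spectrum hM (fun x hx => (h hx).1) v
  have h2 := le_dotProduct_mulVec_of_spectrum (r := -b) hM.neg (fun x hx => by
    rw [← spectrum.neg_eq] at hx
    have := (h hx).2
    linarith) v
  rw [Matrix.neg_mulVec, dotProduct_neg] at h2
  rw [hq] at h1 h2
  constructor
  · have := mul_le_mul_of_nonneg_left h1 hn'.le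
    rw [mul_inv_cancel_left₀ hn'.ne'] at this
    calc _ = n * (1 / b * nsq v) := by ring
      _ ≤ _ := this
  · have := mul_le_mul_of_nonneg_left h2 hn'.le
    rw [mul_neg, mul_inv_cancel_left₀ hn'.ne'] at this
    linarith

theorem isClosed_isConditioned (n p : ℕ) (b : ℝ) :
    IsClosed {x : Fin n → Fin p → ℝ | IsConditioned b (Matrix.of x)} := by
  have hc : ∀ v : Fin p → ℝ, Continuous fun x : Fin n → Fin p → ℝ =>
      nsq ((Matrix.of x).mulVec v) := by
    intro v
    simp only [nsq, Matrix.mulVec, dotProduct, Matrix.of_apply]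
    fun_prop
  simp only [IsConditioned, Set.ofPred_forall, Set.ofPred_and]
  exact isClosed_iInter fun v =>
    (isClosed_le continuous_const (hc v)).inter (isClosed_le (hc v) continuous_const)

/-! ### The fit statistic and its mean. -/

/-- An exponential of the squared length of the projection of `e` on the columns of `X` in `γ`,
as a Gaussian integral. -/
noncomputable def fitStat {n p : ℕ} (a b : ℝ) (γ : Finset (Fin p)) (X : Matrix (Fin n) (Fin p) ℝ)
    (e : Fin n → ℝ) : ℝ≥0∞ :=
  ENNReal.ofReal (√(n * b / (2 * Real.pi)) ^ γ.card) *
    ∫⁻ δ, ENNReal.ofReal (Real.exp (a * (e ⬝ᵥ X.mulVec δ) - nsq (X.mulVec δ) / 2)) ∂slab γ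

theorem measurable_fitStat {n p : ℕ} (a b : ℝ) (γ : Finset (Fin p)) :
    Measurable fun z : (Fin n → Fin p → ℝ) × (Fin n → ℝ) => fitStat a b γ (Matrix.of z.1) z.2 := by
  unfold fitStat
  refine Measurable.const_mul ?_ _
  refine Measurable.lintegral_prod_right' (f := fun q : ((Fin n → Fin p → ℝ) × (Fin n → ℝ)) ×
    (Fin p → ℝ) => ENNReal.ofReal (Real.exp (a * (q.1.2 ⬝ᵥ (Matrix.of q.1.1).mulVec q.2) -
      nsq ((Matrix.of q.1.1).mulVec q.2) / 2))) ?_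
  simp only [nsq, dotProduct, Matrix.mulVec, Matrix.of_apply]
  fun_prop

/-- Recentre the integral at `δ₀` and discard the linear term by symmetrization. The prefactor of
`fitStat` is exactly the inverse of the remaining Gaussian integral once `nsq (Xδ)` is replaced by
its upper bound `n b nsq δ`. Hence `log fitStat` dominates the exponent at every `δ₀`, in particular
its maximum. -/
theorem le_fitStat {n p : ℕ} {a b : ℝ} (hn : 0 < n) (hb : 0 < b) {γ : Finset (Fin p)}
    {X : Matrix (Fin n) (Fin p) ℝ} (hX : IsConditioned b X) (e : Fin n → ℝ) {δ₀ : Fin p → ℝ}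
    (hδ₀ : ∀ j ∉ γ, δ₀ j = 0) :
    ENNReal.ofReal (Real.exp (a * (e ⬝ᵥ X.mulVec δ₀) - nsq (X.mulVec δ₀) / 2)) ≤
      fitStat a b γ X e := by
  have hn' : (0 : ℝ) < n := by exact_mod_cast hn
  set E := a * (e ⬝ᵥ X.mulVec δ₀) - nsq (X.mulVec δ₀) / 2 with hE
  set l : (Fin p → ℝ) → ℝ := fun δ => a * (e ⬝ᵥ X.mulVec δ) - X.mulVec δ₀ ⬝ᵥ X.mulVec δ with hl
  have hlm : Measurable l := by simp only [hl]; fun_prop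
  have h1 : ∫⁻ δ, ENNReal.ofReal (Real.exp (a * (e ⬝ᵥ X.mulVec δ) - nsq (X.mulVec δ) / 2)) ∂slab γ
      = ENNReal.ofReal (Real.exp E) *
        ∫⁻ δ, ENNReal.ofReal (Real.exp (-(nsq (X.mulVec δ) / 2) + l δ)) ∂slab γ := by
    rw [← lintegral_slab_add hδ₀, ← lintegral_const_mul _ (by fun_prop)]
    refine lintegral_congr fun δ => ?_
    rw [← ENNReal.ofReal_mul (Real.exp_nonneg _), ← Real.exp_add]
    congr 2
    rw [Matrix.mulVec_add, nsq_add, dotProduct_add, dotProduct_comm (X.mulVec δ)]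
    ring
  have h2 := lintegral_slab_even_le γ (l := l) (q := fun δ => -(nsq (X.mulVec δ) / 2))
    (fun δ => by simp only [hl, Matrix.mulVec_neg, dotProduct_neg]; ring)
    (fun δ => by simp only [Matrix.mulVec_neg, nsq_neg]) hlm (by fun_prop)
  have h3 : ∫⁻ δ, ENNReal.ofReal (Real.exp (-(n * b / 2) * nsq δ)) ∂slab γ ≤
      ∫⁻ δ, ENNReal.ofReal (Real.exp (-(nsq (X.mulVec δ) / 2))) ∂slab γ := by
    refine lintegral_mono fun δ => ENNReal.ofReal_le_ofReal (Real.exp_le_exp.2 ?_)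
    have := (hX δ).2
    linarith
  rw [lintegral_slab_exp_neg_mul_nsq γ (by positivity)] at h3
  rw [fitStat, h1]
  refine le_trans (le_of_eq ?_) (mul_le_mul_right (mul_le_mul_right (h3.trans h2) _) _)
  rw [← ENNReal.ofReal_pow (by positivity), mul_left_comm, ← ENNReal.ofReal_mul (by positivity),
    ← mul_pow, ← Real.sqrt_mul (by positivity)]
  have : n * b / (2 * Real.pi) * (Real.pi / (n * b / 2)) = 1 := by field_simp
  simp [this]

theorem one_le_fitStat {n p : ℕ} {a b : ℝ} (hn : 0 < n) (hb : 0 < b) {γ : Finset (Fin p)}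
    {X : Matrix (Fin n) (Fin p) ℝ} (hX : IsConditioned b X) (e : Fin n → ℝ) :
    1 ≤ fitStat a b γ X e := by
  simpa [nsq] using le_fitStat (a := a) hn hb (γ := γ) hX e (δ₀ := 0) (by simp)

theorem lintegral_pi_gaussian_exp_dotProduct {n : ℕ} (v : ℝ≥0) (a : ℝ) (u : Fin n → ℝ) :
    ∫⁻ e, ENNReal.ofReal (Real.exp (a * (e ⬝ᵥ u))) ∂(Measure.pi fun _ : Fin n => gaussianReal 0 v) =
      ENNReal.ofReal (Real.exp (a ^ 2 * v / 2 * nsq u)) := by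
  simp_rw [dotProduct, Finset.mul_sum, Real.exp_sum,
    ENNReal.ofReal_prod_of_nonneg fun i _ => Real.exp_nonneg _]
  rw [lintegral_pi_prod _ (fun i x => ENNReal.ofReal (Real.exp (a * (x * u i))))
    fun i => by fun_prop]
  have : ∀ i, ∫⁻ x, ENNReal.ofReal (Real.exp (a * (x * u i))) ∂gaussianReal 0 v =
      ENNReal.ofReal (Real.exp (v * (a * u i) ^ 2 / 2)) := by
    intro i
    rw [← lintegral_gaussianReal_exp_mul]
    refine lintegral_congr fun x => ?_
    congr 2; ring
  simp_rw [this]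
  rw [← ENNReal.ofReal_prod_of_nonneg fun i _ => Real.exp_nonneg _, ← Real.exp_sum, nsq,
    Finset.mul_sum]
  congr 2
  exact Finset.sum_congr rfl fun i _ => by ring

/-- Integrating over `e` first, the Gaussian moment generating function changes the exponent to `-η
nsq (Xδ) / 2`. As `a²v < 1`, the integral over `δ` converges, uniformly over well-conditioned
designs. -/
theorem lintegral_fitStat_le {n p : ℕ} {a b η : ℝ} {v : ℝ≥0} (hn : 0 < n) (hb : 0 < b)
    (hη : 0 < η) (hav : a ^ 2 * v = 1 - η) (γ : Finset (Fin p)) {X : Matrix (Fin n) (Fin p) ℝ}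
    (hX : IsConditioned b X) :
    ∫⁻ e, fitStat a b γ X e ∂(Measure.pi fun _ : Fin n => gaussianReal 0 v) ≤
      ENNReal.ofReal (√(b ^ 2 / η) ^ γ.card) := by
  have hn' : (0 : ℝ) < n := by exact_mod_cast hn
  unfold fitStat
  rw [lintegral_const_mul' _ _ ENNReal.ofReal_ne_top, lintegral_lintegral_swap]
  swap
  · refine Measurable.aemeasurable ?_
    simp only [Function.uncurry_def, nsq, dotProduct, Matrix.mulVec]
    fun_prop
  have h1 : ∀ δ : Fin p → ℝ, ∫⁻ e, ENNReal.ofReal (Real.exp (a * (e ⬝ᵥ X.mulVec δ) -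
      nsq (X.mulVec δ) / 2)) ∂(Measure.pi fun _ : Fin n => gaussianReal 0 v) ≤
      ENNReal.ofReal (Real.exp (-(η * n / (2 * b)) * nsq δ)) := by
    intro δ
    have : ∀ e : Fin n → ℝ, ENNReal.ofReal (Real.exp (a * (e ⬝ᵥ X.mulVec δ) -
        nsq (X.mulVec δ) / 2)) = ENNReal.ofReal (Real.exp (-(nsq (X.mulVec δ) / 2))) *
          ENNReal.ofReal (Real.exp (a * (e ⬝ᵥ X.mulVec δ))) := by
      intro e
      rw [← ENNReal.ofReal_mul (Real.exp_nonneg _), ← Real.exp_add]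
      congr 2; ring
    simp_rw [this]
    rw [lintegral_const_mul' _ _ ENNReal.ofReal_ne_top, lintegral_pi_gaussian_exp_dotProduct,
      ← ENNReal.ofReal_mul (Real.exp_nonneg _), ← Real.exp_add, hav]
    refine ENNReal.ofReal_le_ofReal (Real.exp_le_exp.2 ?_)
    have h2 := mul_le_mul_of_nonneg_left (hX δ).1 (by positivity : 0 ≤ η / 2)
    have h3 : η / 2 * (n / b * nsq δ) = η * n / (2 * b) * nsq δ := by field_simp
    linarith
  refine (mul_le_mul_right (lintegral_mono h1) _).trans (le_of_eq ?_)
  rw [lintegral_slab_exp_neg_mul_nsq γ (by positivity), ← ENNReal.ofReal_pow (by positivity),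
    ← ENNReal.ofReal_mul (by positivity), ← mul_pow, ← Real.sqrt_mul (by positivity)]
  congr 3
  field_simp

/-! ### Exponential tails of the squared length of the errors. -/

theorem lintegral_pi_gaussian_exp_mul_nsq (n : ℕ) {v : ℝ≥0} (hv : v ≠ 0) {s : ℝ}
    (hs : 2 * s * v < 1) :
    ∫⁻ e, ENNReal.ofReal (Real.exp (s * nsq e)) ∂(Measure.pi fun _ : Fin n => gaussianReal 0 v) =
      ENNReal.ofReal √(1 / (1 - 2 * s * v)) ^ n := by
  simp_rw [nsq, Finset.mul_sum, Real.exp_sum,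
    ENNReal.ofReal_prod_of_nonneg fun i _ => Real.exp_nonneg _]
  rw [lintegral_pi_prod _ (fun i x => ENNReal.ofReal (Real.exp (s * x ^ 2)))
    fun i => by fun_prop]
  simp [lintegral_gaussianReal_exp_mul_sq hv hs]

/-- Chernoff bound for the squared norm of a Gaussian vector. -/
theorem pi_gaussian_chernoff (n : ℕ) {v : ℝ≥0} (hv : v ≠ 0) {s l : ℝ}
    (hs : 2 * s * v < 1) {S : Set (Fin n → ℝ)} (hS : ∀ e ∈ S, s * (l * n * v) ≤ s * nsq e) :
    (Measure.pi fun _ : Fin n => gaussianReal 0 v) S ≤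
      ENNReal.ofReal (Real.exp (-(s * l * v)) * √(1 / (1 - 2 * s * v))) ^ n := by
  have h1 := meas_le_lintegral₀ (μ := Measure.pi fun _ : Fin n => gaussianReal 0 v)
    (f := fun e => ENNReal.ofReal (Real.exp (-(s * (l * n * v)))) *
      ENNReal.ofReal (Real.exp (s * nsq e))) (s := S) (by fun_prop) fun e he => by
        rw [← ENNReal.ofReal_mul (Real.exp_nonneg _), ← Real.exp_add, ENNReal.one_le_ofReal,
          Real.one_le_exp_iff]
        have := hS e he
        linarith
  refine h1.trans (le_of_eq ?_)
  rw [lintegral_const_mul' _ _ ENNReal.ofReal_ne_top, lintegral_pi_gaussian_exp_mul_nsq n hv hs,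
    ENNReal.ofReal_mul (Real.exp_nonneg _), mul_pow, ← ENNReal.ofReal_pow (Real.exp_nonneg _),
    ← Real.exp_nat_mul]
  congr 3
  ring_nf

theorem exists_nsq_lower_tail {l : ℝ} (hl0 : 0 < l) (hl : l < 1) :
    ∃ q : ℝ, 0 ≤ q ∧ q < 1 ∧ ∀ (n : ℕ) (v : ℝ≥0), v ≠ 0 →
      (Measure.pi fun _ : Fin n => gaussianReal 0 v) {e | nsq e < l * n * v} ≤
        ENNReal.ofReal q ^ n := by
  refine ⟨Real.exp ((1 - l) * l / 2) * √(1 / (2 - l)), by positivity, ?_, fun n v hv => ?_⟩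
  · have h1 : Real.exp ((1 - l) * l / 2) = √(Real.exp ((1 - l) * l)) := by
      rw [← Real.exp_half]
    rw [h1, ← Real.sqrt_mul (Real.exp_nonneg _), Real.sqrt_lt' one_pos, one_pow,
      mul_one_div, div_lt_one (by linarith)]
    have h2 := Real.one_sub_le_exp_neg ((1 - l) * l)
    rw [Real.exp_neg] at h2
    have h4 : 0 < 1 - (1 - l) * l := by nlinarith [sq_nonneg (l - 1 / 2)]
    have h5 := (le_inv_comm₀ h4 (Real.exp_pos _)).1 h2
    refine h5.trans_lt ?_
    rw [inv_lt_comm₀ h4 (by linarith), inv_lt_iff_one_lt_mul₀ (by linarith)]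
    -- The claim is `(2 - l)(1 - (1 - l)l) > 1`, and the difference of the two sides is `(1 - l)³`.
    nlinarith [mul_pos (mul_pos (sub_pos.2 hl) (sub_pos.2 hl)) (sub_pos.2 hl)]
  · have hv' : (0 : ℝ) < v := by exact_mod_cast pos_iff_ne_zero.2 hv
    have hsv : 2 * (-(1 - l) / (2 * v)) * v = -(1 - l) := by field_simp
    have h := pi_gaussian_chernoff n hv (s := -(1 - l) / (2 * v)) (l := l)
      (S := {e | nsq e < l * n * v}) (by rw [hsv]; linarith) fun e he =>
        mul_le_mul_of_nonpos_left (le_of_lt he)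
          (div_nonpos_of_nonpos_of_nonneg (by linarith) (by positivity))
    rw [hsv] at h
    convert h using 5
    · field_simp
    · ring

theorem exists_nsq_upper_tail :
    ∃ q : ℝ, 0 ≤ q ∧ q < 1 ∧ ∀ (n : ℕ) (v : ℝ≥0), v ≠ 0 →
      (Measure.pi fun _ : Fin n => gaussianReal 0 v) {e | 4 * n * v < nsq e} ≤
        ENNReal.ofReal q ^ n := by
  refine ⟨Real.exp (-1) * √2, by positivity, ?_, fun n v hv => ?_⟩
  · rw [Real.exp_neg, inv_mul_lt_iff₀ (Real.exp_pos _), mul_one]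
    have h1 := Real.add_one_le_exp (1 : ℝ)
    have h2 : √2 < 2 := by rw [Real.sqrt_lt' (by norm_num)]; norm_num
    linarith
  · have hv' : (0 : ℝ) < v := by exact_mod_cast pos_iff_ne_zero.2 hv
    have hsv : 2 * (1 / (4 * v)) * (v : ℝ) = 1 / 2 := by field_simp; norm_num
    have h := pi_gaussian_chernoff n hv (s := 1 / (4 * v)) (l := 4)
      (S := {e | 4 * n * v < nsq e}) (by rw [hsv]; norm_num) fun e he =>
        mul_le_mul_of_nonneg_left (le_of_lt he) (by positivity)
    rw [hsv] at h
    convert h using 5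
    · field_simp
    · norm_num

/-! ### Deterministic bounds on posterior odds. -/

section Deterministic

variable {n p : ℕ} {X : Matrix (Fin n) (Fin p) ℝ} {e : Fin n → ℝ} {β₀ : Fin p → ℝ}
  {γ γ₀ : Finset (Fin p)}

theorem le_nsq_residual {a w l : ℝ} (ha : 0 < a) (hw : 0 < w)
    (h : ∀ δ : Fin p → ℝ, (∀ j ∉ γ, δ j = 0) → a * (e ⬝ᵥ X.mulVec δ) - nsq (X.mulVec δ) / 2 ≤ l)
    {δ : Fin p → ℝ} (hδ : ∀ j ∉ γ, δ j = 0) :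
    nsq e - 2 * l / (a ^ 2 * w) + (1 - w) * nsq (X.mulVec δ) ≤ nsq (e - X.mulVec δ) := by
  -- The scale `a * w` makes the hypothesis read `2 e·Xδ - w nsq (Xδ) ≤ 2l / (a²w)`, so a fraction
  -- `1 - w` of the curvature survives.
  have h1 := h ((a * w) • δ) fun j hj => by simp [hδ j hj]
  rw [Matrix.mulVec_smul, dotProduct_smul, nsq_smul, smul_eq_mul] at h1
  rw [nsq_sub]
  have h2 : 2 * (e ⬝ᵥ X.mulVec δ) ≤ 2 * l / (a ^ 2 * w) + w * nsq (X.mulVec δ) := by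
    have h3 : 2 * (e ⬝ᵥ X.mulVec δ) - w * nsq (X.mulVec δ) ≤ 2 * l / (a ^ 2 * w) := by
      rw [le_div_iff₀ (by positivity)]
      nlinarith
    linarith
  linarith

theorem fit_le_log {a b : ℝ} (hn : 0 < n) (hb : 0 < b) (hX : IsConditioned b X) {G : ℝ}
    (hG : fitStat a b γ X e ≤ ENNReal.ofReal G) {δ : Fin p → ℝ} (hδ : ∀ j ∉ γ, δ j = 0) :
    a * (e ⬝ᵥ X.mulVec δ) - nsq (X.mulVec δ) / 2 ≤ Real.log G := by
  have h1 := (le_fitStat hn hb hX e hδ).trans hG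
  have h0 : 0 < G := by
    have := (one_le_fitStat hn hb hX e).trans hG
    rw [ENNReal.one_le_ofReal] at this
    linarith
  rw [ENNReal.ofReal_le_ofReal_iff h0.le] at h1
  rwa [Real.le_log_iff_exp_le h0]

/-- The residual sum of squares of a model, from the exponential fit statistic. -/
theorem le_nsq_residual_of_fitStat {b v z G : ℝ} (hn : 0 < n) (hb : 0 < b) (hv : 0 < v)
    (hz : 1 < z) (hX : IsConditioned b X) (hG : fitStat √(1 / (z * v)) b γ X e ≤ ENNReal.ofReal G)
    {δ : Fin p → ℝ} (hδ : ∀ j ∉ γ, δ j = 0) :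
    nsq e - 2 * z ^ 2 * v * Real.log G + 2 * ((1 - 1 / z) / (2 * b) * n) * nsq δ ≤
      nsq (e - X.mulVec δ) := by
  have hz0 : 0 < z := by linarith
  -- With `a² = 1/(zv)` and `w = 1/z` the noise term is `2z²v log G`. Multiplied later by the rate
  -- `z/(2v)` it gives the exponent `z³ log G`.
  have h1 := le_nsq_residual (w := 1 / z) (Real.sqrt_pos.2 (by positivity)) (by positivity)
    (fun δ hδ => fit_le_log hn hb hX hG hδ) hδ
  rw [Real.sq_sqrt (by positivity)] at h1
  have h2 : 2 * Real.log G / (1 / (z * v) * (1 / z)) = 2 * z ^ 2 * v * Real.log G := by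
    field_simp
  have h3 : 0 ≤ 1 - 1 / z := by
    rw [sub_nonneg, div_le_one hz0]; exact hz.le
  have h4 := mul_le_mul_of_nonneg_left (hX δ).1 h3
  rw [h2] at h1
  have h5 : (1 - 1 / z) * (n / b * nsq δ) = 2 * ((1 - 1 / z) / (2 * b) * n) * nsq δ := by
    field_simp
  linarith

/-- Posterior odds bound for a model that strictly contains the true one. -/
theorem marginalLikelihood_le_of_superset {ν b v z A G l₁ L κ' B' W₁ W₂ : ℝ} (g : Measure ℝ≥0)
    [IsProbabilityMeasure g] (hn : 0 < n) (hb : 0 < b) (hν : 0 < ν) (hv : 0 < v) (hz : 1 < z)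
    (hA : A = (1 - 1 / z) / (2 * b) * n) (hX : IsConditioned b X)
    (hβ₀ : ∀ j ∉ γ₀, β₀ j = 0) (hγ : γ₀ ⊆ γ)
    (hG : fitStat √(1 / (z * v)) b γ X e ≤ ENNReal.ofReal G)
    (hl₁ : fitStat √(1 / (z * v)) b Finset.univ X e ≤ ENNReal.ofReal (Real.exp l₁))
    (hT : 0 ≤ nsq e - 2 * z ^ 2 * v * l₁)
    (hκ : (n + ν) / 2 ≤ z / (2 * v) * (1 + (nsq e - 2 * z ^ 2 * v * l₁)))
    (hL : 0 ≤ L) (hκ'0 : 0 ≤ κ') (hκ' : κ' * (1 + nsq e + L) ≤ (n + ν) / 2)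
    {φ Φ : ℝ≥0} (hφ : φ ≠ 0) (hg : g (Set.Icc φ Φ) ≠ 0) (hB' : nsq β₀ / φ ≤ B')
    (hW₁ : 0 ≤ W₁) (hW₂ : 0 ≤ W₂)
    (hsmall : √2 ^ γ.card * √(1 + Φ * (n * b)) ^ γ₀.card * Real.exp (z / (2 * v) * B' - κ' * L) ≤
      W₂ * (g (Set.Icc φ Φ)).toReal)
    (hc : ∀ᵐ c : ℝ≥0 ∂g, (c ≠ 0 ∧ nsq β₀ / c - nsq β₀ / (c + 1 / A) ≤ 1 ∧
      √(1 / (A * c)) ^ γ.card * √(1 + c * (n * b)) ^ γ₀.card ≤ W₁) ∨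
        L ≤ nsq β₀ / (2 * c + 1 / A)) :
    marginalLikelihood ν g X (X.mulVec β₀ + e) γ ≤
      ENNReal.ofReal ((W₁ * Real.exp (z / (2 * v)) + W₂) * G ^ (z ^ 3)) *
        marginalLikelihood ν g X (X.mulVec β₀ + e) γ₀ := by
  have hn' : (0 : ℝ) < n := by exact_mod_cast hn
  have hz0 : 0 < z := by linarith
  have hz1 : 0 < 1 - 1 / z := by
    rw [sub_pos, div_lt_one hz0]; exact hz
  have hA0 : 0 < A := by rw [hA]; positivity
  have hD : 0 ≤ n * b := by positivity
  have hG1 : 1 ≤ G := by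
    have := (one_le_fitStat hn hb hX e).trans hG
    rwa [ENNReal.one_le_ofReal] at this
  -- Both the fit of `γ` and that of the full model bound the fitted noise. The minimum keeps `T`
  -- above a level common to all models, so `κ = z/(2v)` serves them all, while `exp (z³ l) ≤
  -- G^(z³)` still holds.
  set l := min (Real.log G) l₁ with hldef
  have hl₁0 : 0 ≤ l₁ := by
    have := (one_le_fitStat hn hb hX e).trans hl₁
    rwa [ENNReal.one_le_ofReal, Real.one_le_exp_iff] at this
  have hl0 : 0 ≤ l := le_min (Real.log_nonneg hG1) hl₁0
  set T := nsq e - 2 * z ^ 2 * v * l with hTdef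
  have hcoef : 0 ≤ 2 * z ^ 2 * v := by positivity
  have hTT : nsq e - 2 * z ^ 2 * v * l₁ ≤ T := by
    have := mul_le_mul_of_nonneg_left (min_le_right (Real.log G) l₁) hcoef
    simp only [hTdef]; linarith
  have hT0 : 0 ≤ T := hT.trans hTT
  have hTe : T ≤ nsq e := by
    have := mul_nonneg hcoef hl0
    simp only [hTdef]; linarith
  have hκT : (n + ν) / 2 ≤ z / (2 * v) * (1 + T) :=
    hκ.trans (mul_le_mul_of_nonneg_left (by linarith) (by positivity))
  have hR : ∀ δ : Fin p → ℝ, (∀ j ∉ γ, δ j = 0) → T + 2 * A * nsq δ ≤ nsq (e - X.mulVec δ) := by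
    intro δ hδ
    rcases min_choice (Real.log G) l₁ with h | h
    · rw [hTdef, hldef, h, hA]
      exact le_nsq_residual_of_fitStat hn hb hv hz hX hG hδ
    · rw [hTdef, hldef, h, hA]
      have := le_nsq_residual_of_fitStat hn hb hv hz hX hl₁ (δ := δ) (by simp)
      rwa [Real.log_exp] at this
  have hXD : ∀ δ : Fin p → ℝ, nsq (X.mulVec δ) ≤ n * b * nsq δ := fun δ => (hX δ).2
  have hβ₀γ : ∀ j ∉ γ, β₀ j = 0 := fun j hj => hβ₀ j fun h => hj (hγ h)
  have hGs : Real.exp (z ^ 3 * l) ≤ G ^ (z ^ 3) := by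
    rw [Real.rpow_def_of_pos (by linarith), Real.exp_le_exp, mul_comm]
    exact mul_le_mul_of_nonneg_right (min_le_left _ _) (by positivity)
  have hGs0 : 0 ≤ G ^ (z ^ 3) := by positivity
  have hκΔ : ∀ s, z / (2 * v) * (2 * z ^ 2 * v * l + s) = z ^ 3 * l + z / (2 * v) * s := by
    intro s; field_simp
  set M₀ := marginalLikelihood ν g X (X.mulVec β₀ + e) γ₀ with hM₀
  -- For larger `c` the two models are compared at the same `c`; for small `c` the bound is against
  -- the whole marginal likelihood `M₀`. Integrating in `c` gives the two summands of the claim.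
  have hpt : ∀ᵐ c ∂g, margAt ν X (X.mulVec β₀ + e) γ c ≤
      ENNReal.ofReal (W₁ * Real.exp (z / (2 * v)) * G ^ (z ^ 3)) *
        margAt ν X (X.mulVec β₀ + e) γ₀ c + ENNReal.ofReal (W₂ * G ^ (z ^ 3)) * M₀ := by
    filter_upwards [hc] with c hc
    rcases hc with ⟨hc0, hdrop, hW⟩ | hLc
    · refine le_trans ?_ le_self_add
      refine (margAt_le_margAt (T := T) (A := A) (Δ := 2 * z ^ 2 * v * l + 1) hν hA0 hD hγ hβ₀ hXD
        hR hc0 hT0 hκT (by positivity) (by simp only [hTdef]; linarith)).trans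
        (mul_le_mul_left (ENNReal.ofReal_le_ofReal ?_) _)
      rw [hκΔ, Real.exp_add, mul_one]
      calc _ ≤ W₁ * (G ^ (z ^ 3) * Real.exp (z / (2 * v))) :=
            mul_le_mul hW (mul_le_mul_of_nonneg_right hGs (Real.exp_nonneg _))
              (by positivity) hW₁
        _ = _ := by ring
    · refine le_trans ?_ le_add_self
      have hφ' : (0 : ℝ) < φ := by exact_mod_cast pos_iff_ne_zero.2 hφ
      have hS0 : 0 ≤ nsq β₀ / φ := div_nonneg (nsq_nonneg _) hφ'.le
      have h1 := margAt_le_tauInt_of_diffuse (S := nsq e + nsq β₀ / φ) (L := L) (κ' := κ') hν hA0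
        hβ₀γ hR hT0 hκT hL hLc
        ((mul_le_mul_of_nonneg_left (by linarith) hκ'0).trans hκ') (by linarith)
      have h2 := tauInt_le_marginalLikelihood (ν := ν) (e := e) g hD hβ₀ hXD (Φ := Φ) hφ
      have hgt : g (Set.Icc φ Φ) ≠ ∞ := measure_ne_top _ _
      have hg0 : 0 < (g (Set.Icc φ Φ)).toReal := ENNReal.toReal_pos hg hgt
      rw [← hM₀] at h2
      have h3 : tauInt n ν (nsq e + nsq β₀ / φ) ≤
          ENNReal.ofReal (√(1 + Φ * (n * b)) ^ γ₀.card / (g (Set.Icc φ Φ)).toReal) * M₀ := by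
        rw [ENNReal.ofReal_div_of_pos hg0, ENNReal.ofReal_toReal hgt, ENNReal.div_eq_inv_mul,
          mul_assoc, ← ENNReal.div_eq_inv_mul, ENNReal.le_div_iff_mul_le (Or.inl hg) (Or.inl hgt),
          mul_comm]
        exact h2
      refine (h1.trans (mul_le_mul_right h3 _)).trans ?_
      rw [← mul_assoc, ← ENNReal.ofReal_mul (by positivity)]
      refine mul_le_mul_left (ENNReal.ofReal_le_ofReal ?_) _
      have h4 : z / (2 * v) * (nsq e + nsq β₀ / φ - T) - κ' * L ≤
          z ^ 3 * l + (z / (2 * v) * B' - κ' * L) := by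
        have : nsq e + nsq β₀ / φ - T = 2 * z ^ 2 * v * l + nsq β₀ / φ := by
          simp only [hTdef]; ring
        rw [this, hκΔ]
        have := mul_le_mul_of_nonneg_left hB' (by positivity : 0 ≤ z / (2 * v))
        linarith
      have h5 := Real.exp_le_exp.2 h4
      rw [Real.exp_add] at h5
      rw [mul_div_assoc', div_le_iff₀ hg0]
      calc √2 ^ γ.card * Real.exp (z / (2 * v) * (nsq e + nsq β₀ / φ - T) - κ' * L) *
            √(1 + Φ * (n * b)) ^ γ₀.card
          ≤ √2 ^ γ.card * (G ^ (z ^ 3) * Real.exp (z / (2 * v) * B' - κ' * L)) *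
            √(1 + Φ * (n * b)) ^ γ₀.card := by
            refine mul_le_mul_of_nonneg_right (mul_le_mul_of_nonneg_left (h5.trans ?_)
              (by positivity)) (by positivity)
            exact mul_le_mul_of_nonneg_right hGs (Real.exp_nonneg _)
        _ = (√2 ^ γ.card * √(1 + Φ * (n * b)) ^ γ₀.card *
            Real.exp (z / (2 * v) * B' - κ' * L)) * G ^ (z ^ 3) := by ring
        _ ≤ (W₂ * (g (Set.Icc φ Φ)).toReal) * G ^ (z ^ 3) :=
            mul_le_mul_of_nonneg_right hsmall hGs0
        _ = _ := by ring
  rw [marginalLikelihood_eq]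
  refine (lintegral_mono_ae hpt).trans (le_of_eq ?_)
  rw [lintegral_add_right _ measurable_const, lintegral_const_mul' _ _ ENNReal.ofReal_ne_top,
    lintegral_const, measure_univ, mul_one, ← marginalLikelihood_eq, ← hM₀, ← add_mul,
    ← ENNReal.ofReal_add (by positivity) (by positivity), add_mul]

/-- Posterior odds bound for a model that misses a true coefficient. -/
theorem marginalLikelihood_le_of_missing {ν b v z l₁ κ' B' W ψ : ℝ} (g : Measure ℝ≥0)
    [IsProbabilityMeasure g] (hn : 0 < n) (hb : 0 < b) (hν : 0 < ν) (hv : 0 < v) (hz : 1 < z)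
    (hX : IsConditioned b X) (hβ₀ : ∀ j ∉ γ₀, β₀ j = 0)
    (hψ : 0 ≤ ψ) {j : Fin p} (hj : j ∉ γ) (hjψ : ψ ≤ |β₀ j|)
    (hl₁ : fitStat √(1 / (z * v)) b Finset.univ X e ≤ ENNReal.ofReal (Real.exp l₁))
    (hT : 0 ≤ nsq e - 2 * z ^ 2 * v * l₁)
    (hκ : (n + ν) / 2 ≤ z / (2 * v) * (1 + (nsq e - 2 * z ^ 2 * v * l₁)))
    (hκ'0 : 0 ≤ κ')
    (hκ' : κ' * (1 + nsq e + (1 - 1 / z) / b * n * ψ ^ 2) ≤ (n + ν) / 2)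
    {φ Φ : ℝ≥0} (hφ : φ ≠ 0) (hg : g (Set.Icc φ Φ) ≠ 0) (hB' : nsq β₀ / φ ≤ B')
    (hW : √(1 + Φ * (n * b)) ^ γ₀.card * Real.exp (z ^ 3 * l₁ + z / (2 * v) * B' -
      κ' * ((1 - 1 / z) / b * n * ψ ^ 2)) ≤ W * (g (Set.Icc φ Φ)).toReal) :
    marginalLikelihood ν g X (X.mulVec β₀ + e) γ ≤
      ENNReal.ofReal W * marginalLikelihood ν g X (X.mulVec β₀ + e) γ₀ := by
  have hn' : (0 : ℝ) < n := by exact_mod_cast hn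
  have hz0 : 0 < z := by linarith
  have hz1 : 0 < 1 - 1 / z := by
    rw [sub_pos, div_lt_one hz0]; exact hz
  set A := (1 - 1 / z) / (2 * b) * n with hA
  have hA0 : 0 < A := by positivity
  have hAψ : (1 - 1 / z) / b * n * ψ ^ 2 = 2 * A * ψ ^ 2 := by
    rw [hA]; field_simp
  rw [hAψ] at hκ' hW
  have hl₁0 : 0 ≤ l₁ := by
    have := (one_le_fitStat hn hb hX e).trans hl₁
    rwa [ENNReal.one_le_ofReal, Real.one_le_exp_iff] at this
  have hcoef : 0 ≤ 2 * z ^ 2 * v := by positivity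
  set T := nsq e - 2 * z ^ 2 * v * l₁ with hTdef
  have hTe : T ≤ nsq e := by
    have := mul_nonneg hcoef hl₁0
    simp only [hTdef]; linarith
  have hR : ∀ δ : Fin p → ℝ, T + 2 * A * nsq δ ≤ nsq (e - X.mulVec δ) := by
    intro δ
    have := le_nsq_residual_of_fitStat hn hb hv hz hX hl₁ (δ := δ) (by simp)
    rwa [Real.log_exp] at this
  have hXD : ∀ δ : Fin p → ℝ, nsq (X.mulVec δ) ≤ n * b * nsq δ := fun δ => (hX δ).2
  have hφ' : (0 : ℝ) < φ := by exact_mod_cast pos_iff_ne_zero.2 hφ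
  have hS0 : 0 ≤ nsq β₀ / φ := div_nonneg (nsq_nonneg _) hφ'.le
  have hAψ0 : 0 ≤ 2 * A * ψ ^ 2 := by positivity
  have h1 := marginalLikelihood_le_tauInt_of_missing (κ' := κ') (S := nsq e + nsq β₀ / φ) g hν hA0
    hR hψ hj hjψ hT hκ ((mul_le_mul_of_nonneg_left (by linarith) hκ'0).trans hκ') (by linarith)
  have h2 := tauInt_le_marginalLikelihood (ν := ν) (e := e) g (by positivity : 0 ≤ n * b)
    hβ₀ hXD (Φ := Φ) hφ
  set M₀ := marginalLikelihood ν g X (X.mulVec β₀ + e) γ₀ with hM₀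
  have hgt : g (Set.Icc φ Φ) ≠ ∞ := measure_ne_top _ _
  have hg0 : 0 < (g (Set.Icc φ Φ)).toReal := ENNReal.toReal_pos hg hgt
  have h3 : tauInt n ν (nsq e + nsq β₀ / φ) ≤
      ENNReal.ofReal (√(1 + Φ * (n * b)) ^ γ₀.card / (g (Set.Icc φ Φ)).toReal) * M₀ := by
    rw [ENNReal.ofReal_div_of_pos hg0, ENNReal.ofReal_toReal hgt, ENNReal.div_eq_inv_mul,
      mul_assoc, ← ENNReal.div_eq_inv_mul, ENNReal.le_div_iff_mul_le (Or.inl hg) (Or.inl hgt),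
      mul_comm]
    exact h2
  refine (h1.trans (mul_le_mul_right h3 _)).trans ?_
  rw [← mul_assoc, ← ENNReal.ofReal_mul (by positivity)]
  refine mul_le_mul_left (ENNReal.ofReal_le_ofReal ?_) _
  have h4 : z / (2 * v) * (nsq e + nsq β₀ / φ - T) - κ' * (2 * A * ψ ^ 2) ≤
      z ^ 3 * l₁ + z / (2 * v) * B' - κ' * (2 * A * ψ ^ 2) := by
    have : z / (2 * v) * (nsq e + nsq β₀ / φ - T) = z ^ 3 * l₁ + z / (2 * v) * (nsq β₀ / φ) := by
      simp only [hTdef]; field_simp; ring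
    rw [this]
    have := mul_le_mul_of_nonneg_left hB' (by positivity : 0 ≤ z / (2 * v))
    linarith
  rw [mul_div_assoc', div_le_iff₀ hg0, mul_comm]
  exact (mul_le_mul_of_nonneg_left (Real.exp_le_exp.2 h4) (by positivity)).trans hW

end Deterministic

/-! ### Asymptotics of the weights of overfitted models. -/

/-- For `n ≥ 1` the factor `(1 + log n)²` dominates `1` and `log n`, so this one form covers all the
comparisons of powers with logarithms below. -/
theorem eventually_mul_rpow_mul_log_sq_le {α β : ℝ} (h : α < β) (K : ℝ) :
    ∀ᶠ n : ℕ in atTop, K * (n : ℝ) ^ α * (1 + Real.log n) ^ 2 ≤ (n : ℝ) ^ β := by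
  have h1 : (fun x : ℝ => (1 + Real.log x) ^ 2) =o[atTop] fun x : ℝ => x ^ (β - α) := by
    have hγ : 0 < (β - α) / 2 := by linarith
    have h2 : (fun x : ℝ => 1 + Real.log x) =o[atTop] fun x : ℝ => x ^ ((β - α) / 2) := by
      refine IsLittleO.add ?_ (isLittleO_log_rpow_atTop hγ)
      rw [isLittleO_const_left]
      exact Or.inr (tendsto_norm_atTop_atTop.comp (tendsto_rpow_atTop hγ))
    refine (h2.pow (n := 2) (by norm_num)).congr' (Eventually.of_forall fun _ => rfl) ?_
    filter_upwards [eventually_gt_atTop 0] with x hx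
    rw [← Real.rpow_natCast, ← Real.rpow_mul hx.le]
    norm_num
  have h2 := (h1.comp_tendsto tendsto_natCast_atTop_atTop).def
    (show (0 : ℝ) < 1 / (|K| + 1) by positivity)
  filter_upwards [h2, eventually_gt_atTop 0] with n hn hn0
  have hn' : (0 : ℝ) < n := by exact_mod_cast hn0
  simp only [Function.comp_apply] at hn
  rw [Real.norm_of_nonneg (by positivity), Real.norm_of_nonneg (by positivity),
    one_div_mul_eq_div, le_div_iff₀ (by positivity)] at hn
  have h3 : (n : ℝ) ^ β = (n : ℝ) ^ α * (n : ℝ) ^ (β - α) := by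
    rw [← Real.rpow_add hn']; congr 1; ring
  rw [h3]
  calc K * (n : ℝ) ^ α * (1 + Real.log n) ^ 2
      ≤ (|K| + 1) * (n : ℝ) ^ α * (1 + Real.log n) ^ 2 := by
        gcongr; linarith [le_abs_self K]
    _ = (n : ℝ) ^ α * ((1 + Real.log n) ^ 2 * (|K| + 1)) := by ring
    _ ≤ _ := mul_le_mul_of_nonneg_left hn (by positivity)

theorem eventually_mul_rpow_neg_le {ζ : ℝ} (hζ : 0 < ζ) (K : ℝ) {ε : ℝ} (hε : 0 < ε) :
    ∀ᶠ n : ℕ in atTop, K * (n : ℝ) ^ (-ζ) ≤ ε := by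
  have h := ((tendsto_rpow_neg_atTop hζ).comp tendsto_natCast_atTop_atTop).const_mul K
  rw [mul_zero] at h
  exact (h.eventually (gt_mem_nhds hε)).mono fun n hn => hn.le

/-- From the exponential series, `(m+1)^m ≤ m! e^(m+1) ≤ m! 9^m` for `m ≥ 1`; take square roots. It
lets the factorial in `u_m` absorb the loss `√(m+1)` per covariate. -/
theorem sqrt_succ_pow_le (m : ℕ) : √((m : ℝ) + 1) ^ m ≤ 3 ^ m * m.factorial := by
  rcases Nat.eq_zero_or_pos m with rfl | hm
  · simp
  have h1 := Real.pow_div_factorial_le_exp (x := (m : ℝ) + 1) (by positivity) m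
  rw [div_le_iff₀ (by positivity)] at h1
  have hf : (1 : ℝ) ≤ m.factorial := by exact_mod_cast Nat.factorial_pos m
  have h2 : Real.exp ((m : ℝ) + 1) ≤ (3 ^ m) ^ 2 := by
    have h3 : Real.exp ((m : ℝ) + 1) ≤ Real.exp (((2 * m : ℕ) : ℝ) * 1) := by
      apply Real.exp_le_exp.2
      have : (1 : ℝ) ≤ m := by exact_mod_cast hm
      push_cast; linarith
    refine h3.trans ?_
    rw [Real.exp_nat_mul, ← pow_mul, mul_comm m 2]
    exact pow_le_pow_left₀ (Real.exp_nonneg _) (by linarith [Real.exp_one_lt_d9]) _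
  have h4 : (√((m : ℝ) + 1) ^ m) ^ 2 ≤ (3 ^ m * (m.factorial : ℝ)) ^ 2 := by
    rw [← pow_mul, mul_comm m 2, pow_mul, Real.sq_sqrt (by positivity), mul_pow]
    refine h1.trans (mul_le_mul h2 ?_ (by positivity) (by positivity))
    nlinarith
  exact (pow_le_pow_iff_left₀ (by positivity) (by positivity) (by norm_num)).1 h4

/-- Since `s r < ρ`, each extra covariate brings a spare factor `n^(-(ρ - s r))`. It beats the
constant `3K₂`, and as `m ≥ 1` at least one copy remains to beat `K₁ / ε`. -/
theorem eventually_precise_weight_le {ρ r s K₁ K₂ ε : ℝ} (hs : 1 ≤ s) (hr : s * r < ρ)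
    (hK₁ : 0 ≤ K₁) (hK₂ : 0 ≤ K₂) (hε : 0 < ε) :
    ∀ᶠ n : ℕ in atTop, ∀ m : ℕ, 1 ≤ m →
      K₁ * (K₂ * (√((m : ℝ) + 1) * (n : ℝ) ^ (-ρ))) ^ m ≤
        ε * (((n : ℝ) ^ (-r)) ^ m * m.factorial) ^ s := by
  have hζ : 0 < ρ - s * r := by linarith
  filter_upwards [eventually_mul_rpow_neg_le hζ (3 * K₂) one_pos,
    eventually_mul_rpow_neg_le hζ (K₁ * (3 * K₂)) hε, eventually_gt_atTop 0] with n h1 h2 hn m hm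
  have hn' : (0 : ℝ) < n := by exact_mod_cast hn
  have hf : (1 : ℝ) ≤ m.factorial := by exact_mod_cast Nat.factorial_pos m
  have e1 : (n : ℝ) ^ (-ρ) = (n : ℝ) ^ (-(ρ - s * r)) * ((n : ℝ) ^ (-r)) ^ s := by
    rw [← Real.rpow_mul hn'.le, ← Real.rpow_add hn']; congr 1; ring
  have e2 : (((n : ℝ) ^ (-r)) ^ m * (m.factorial : ℝ)) ^ s =
      (((n : ℝ) ^ (-r)) ^ s) ^ m * (m.factorial : ℝ) ^ s := by
    rw [Real.mul_rpow (by positivity) (by positivity),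
      ← Real.rpow_pow_comm (by positivity : 0 ≤ (n : ℝ) ^ (-r)) s m]
  rw [e2, e1]
  set w := ((n : ℝ) ^ (-r)) ^ s with hw
  set y := (n : ℝ) ^ (-(ρ - s * r)) with hy
  have hw0 : 0 ≤ w := by positivity
  have hy0 : 0 ≤ y := by positivity
  have hfs : (m.factorial : ℝ) ≤ (m.factorial : ℝ) ^ s := Real.self_le_rpow_of_one_le hf hs
  calc K₁ * (K₂ * (√((m : ℝ) + 1) * (y * w))) ^ m
      = K₁ * (K₂ * y) ^ m * w ^ m * √((m : ℝ) + 1) ^ m := by ring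
    _ ≤ K₁ * (K₂ * y) ^ m * w ^ m * (3 ^ m * m.factorial) :=
        mul_le_mul_of_nonneg_left (sqrt_succ_pow_le m) (by positivity)
    _ = K₁ * (3 * K₂ * y) ^ m * (w ^ m * m.factorial) := by ring
    _ ≤ K₁ * (3 * K₂ * y) * (w ^ m * m.factorial) := by
        refine mul_le_mul_of_nonneg_right (mul_le_mul_of_nonneg_left ?_ hK₁) (by positivity)
        exact pow_le_of_le_one (by positivity) h1 (by omega)
    _ ≤ ε * (w ^ m * m.factorial) := by
        refine mul_le_mul_of_nonneg_right ?_ (by positivity)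
        linarith
    _ ≤ _ := by gcongr

/-- The rate `K₀ + s + 1` is just enough to pay for `n^K₀`, for `2^m ≤ n^m` and for `n^(-s m)`,
leaving a spare `1/n`. -/
theorem eventually_diffuse_weight_le {r s C ε : ℝ} (K₀ : ℕ) (hs : 1 ≤ s) (hr : r ≤ 1)
    (hC : 0 ≤ C) (hε : 0 < ε) :
    ∀ᶠ n : ℕ in atTop, ∀ m : ℕ,
      C * 2 ^ m * (n : ℝ) ^ K₀ * Real.exp (-((K₀ + s + 1) * ((m + 1) * Real.log n))) ≤
        ε * (((n : ℝ) ^ (-r)) ^ m * m.factorial) ^ s := by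
  filter_upwards [eventually_mul_rpow_neg_le one_pos C hε, eventually_ge_atTop 2] with n h1 hn m
  have hn2 : (2 : ℝ) ≤ n := by exact_mod_cast hn
  have hn' : (0 : ℝ) < n := by linarith
  have hf : (1 : ℝ) ≤ m.factorial := by exact_mod_cast Nat.factorial_pos m
  have e1 : Real.exp (-((K₀ + s + 1) * ((m + 1) * Real.log n))) =
      (n : ℝ) ^ (-(K₀ + s + 1) * (m + 1)) := by
    rw [Real.rpow_def_of_pos hn']; congr 1; ring
  have e2 : (n : ℝ) ^ (-(s * m)) ≤ (((n : ℝ) ^ (-r)) ^ m * (m.factorial : ℝ)) ^ s := by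
    have : (n : ℝ) ^ (-(s * m)) ≤ (((n : ℝ) ^ (-r)) ^ m) ^ s := by
      rw [← Real.rpow_natCast, ← Real.rpow_mul hn'.le, ← Real.rpow_mul hn'.le]
      refine Real.rpow_le_rpow_of_exponent_le (by linarith) ?_
      have : 0 ≤ s * m * (1 - r) := by
        have : 0 ≤ 1 - r := by linarith
        positivity
      nlinarith
    refine this.trans (Real.rpow_le_rpow (by positivity) ?_ (by linarith))
    exact le_mul_of_one_le_right (by positivity) hf
  have e3 : (2 : ℝ) ^ m ≤ (n : ℝ) ^ (m : ℝ) := by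
    rw [Real.rpow_natCast]; exact pow_le_pow_left₀ (by norm_num) hn2 m
  rw [e1]
  calc C * 2 ^ m * (n : ℝ) ^ K₀ * (n : ℝ) ^ (-(K₀ + s + 1) * (m + 1))
      ≤ C * (n : ℝ) ^ (m : ℝ) * (n : ℝ) ^ (K₀ : ℝ) * (n : ℝ) ^ (-(K₀ + s + 1) * (m + 1)) := by
        rw [Real.rpow_natCast (n : ℝ) K₀]
        gcongr
    _ = C * (n : ℝ) ^ ((m : ℝ) + K₀ + -(K₀ + s + 1) * (m + 1)) := by
        rw [Real.rpow_add hn', Real.rpow_add hn']; ring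
    _ ≤ C * (n : ℝ) ^ (-(1 : ℝ) + -(s * m)) := by
        refine mul_le_mul_of_nonneg_left
          (Real.rpow_le_rpow_of_exponent_le (by linarith) ?_) hC
        have : 0 ≤ (K₀ : ℝ) * m := by positivity
        nlinarith
    _ = C * (n : ℝ) ^ (-(1 : ℝ)) * (n : ℝ) ^ (-(s * m)) := by
        rw [Real.rpow_add hn']; ring
    _ ≤ _ := by gcongr

/-! ### The two regimes of the slab scale. -/

/-- Either `c` is so small that shrinkage of the true coefficients is heavily penalized, or it is
large enough for the dimension penalty to be effective. -/
theorem regime_dichotomy {a₂ a₃ A₄ q l M S c K : ℝ} (ha₂ : 0 < a₂) (ha₃ : 0 < a₃) (hA₄ : 0 < A₄)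
    (hq0 : 0 < q) (hl : 1 ≤ l) (hM : 1 ≤ M) (hS : a₃ ^ 2 * l / q ≤ S) (hq : K * (M ^ 2 * l) ≤ q)
    (hK₁ : 2 * A₄ / (a₂ * a₃ ^ 2) ≤ K) (hK₂ : 4 * A₄ / a₃ ^ 2 ≤ K)
    (hK₃ : 16 * A₄ ^ 2 / (a₂ * a₃ ^ 2) ≤ K) (hc : 0 ≤ c)
    (h : S / (2 * c + 1 / (a₂ * q ^ 2)) < A₄ * M * l) :
    0 < c ∧ S / c - S / (c + 1 / (a₂ * q ^ 2)) ≤ 1 ∧ 1 ≤ c * q ^ 2 ∧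
      a₃ ^ 2 / (4 * A₄) * q ≤ M * (c * q ^ 2) := by
  have hA : 0 < a₂ * q ^ 2 := by positivity
  have hl0 : 0 < l := by linarith
  have hM0 : 0 < M := by linarith
  have hMM : M ≤ M ^ 2 * l := by nlinarith [mul_pos hM0 hM0]
  have hMl : M ^ 2 ≤ M ^ 2 * l := by nlinarith [mul_pos hM0 hM0]
  have hKM : ∀ k : ℝ, 0 ≤ k → k ≤ K → k * M ≤ q := by
    intro k hk0 hk
    have : k * M ≤ K * (M ^ 2 * l) := mul_le_mul hk hMM hM0.le (hk0.trans hk)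
    linarith
  have hS0 : 0 < S := lt_of_lt_of_le (by positivity) hS
  have hSq : a₃ ^ 2 * l ≤ S * q := by rwa [div_le_iff₀ hq0] at hS
  rw [div_lt_iff₀ (by positivity)] at h
  have h1 := hKM _ (by positivity) hK₁
  rw [div_mul_eq_mul_div, div_le_iff₀ (by positivity)] at h1
  -- This is used with `q = √n`, `l = log n`, `M = m + 1`. The part of the denominator not involving
  -- `c` takes at most half of `S`, so `c` is at least of order `S / (M l)`, which is at least of
  -- order `1 / (M q)`.
  have h2 : A₄ * M * l * (1 / (a₂ * q ^ 2)) ≤ S / 2 := by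
    rw [mul_one_div, div_le_iff₀ hA]
    calc A₄ * M * l = 2 * A₄ * M * l / 2 := by ring
      _ ≤ q * (a₂ * a₃ ^ 2) * l / 2 := by gcongr
      _ = a₂ * q * (a₃ ^ 2 * l) / 2 := by ring
      _ ≤ a₂ * q * (S * q) / 2 := by gcongr
      _ = _ := by ring
  have h3 : S < 4 * c * (A₄ * M * l) := by nlinarith
  have hc0 : 0 < c := by
    rcases hc.lt_or_eq with h | h
    · exact h
    · rw [← h] at h3; linarith
  have h4 : a₃ ^ 2 / (4 * A₄) * q ≤ M * (c * q ^ 2) := by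
    rw [div_mul_eq_mul_div, div_le_iff₀ (by positivity)]
    have h5 : a₃ ^ 2 * l ≤ 4 * c * (A₄ * M * l) * q := hSq.trans (by gcongr)
    have h6 : a₃ ^ 2 ≤ 4 * c * (A₄ * M) * q := by
      have : a₃ ^ 2 * l ≤ (4 * c * (A₄ * M) * q) * l := by linarith
      exact le_of_mul_le_mul_right this hl0
    nlinarith
  refine ⟨hc0, ?_, ?_, h4⟩
  · have e1 : S / c - S / (c + 1 / (a₂ * q ^ 2)) ≤ S / (a₂ * q ^ 2 * c ^ 2) := by
      rw [div_sub_div _ _ hc0.ne' (by positivity), div_le_div_iff₀ (by positivity) (by positivity)]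
      have : S * (c + 1 / (a₂ * q ^ 2)) - c * S = S / (a₂ * q ^ 2) := by field_simp; ring
      rw [this]
      have : S / (a₂ * q ^ 2) * (a₂ * q ^ 2 * c ^ 2) = S * c ^ 2 := by field_simp
      rw [this]
      have : 0 ≤ S * (c * (1 / (a₂ * q ^ 2))) := by positivity
      nlinarith
    refine e1.trans ?_
    rw [div_le_one (by positivity)]
    have h7 : 16 * A₄ ^ 2 / (a₂ * a₃ ^ 2) * (M ^ 2 * l) ≤ q :=
      (mul_le_mul_of_nonneg_right hK₃ (by positivity)).trans hq
    rw [div_mul_eq_mul_div, div_le_iff₀ (by positivity)] at h7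
    have h8 : S ^ 2 ≤ (4 * c * (A₄ * M * l)) ^ 2 := pow_le_pow_left₀ hS0.le h3.le 2
    have h9 : S * (a₃ ^ 2 * l) ≤ (a₂ * q ^ 2 * c ^ 2) * (a₃ ^ 2 * l) := by
      calc S * (a₃ ^ 2 * l) ≤ S * (S * q) := by gcongr
        _ = S ^ 2 * q := by ring
        _ ≤ (4 * c * (A₄ * M * l)) ^ 2 * q := by gcongr
        _ = (16 * A₄ ^ 2 * (M ^ 2 * l)) * (c ^ 2 * l * q) := by ring
        _ ≤ (q * (a₂ * a₃ ^ 2)) * (c ^ 2 * l * q) := by gcongr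
        _ = _ := by ring
    exact le_of_mul_le_mul_right h9 (by positivity)
  · have h5 := hKM _ (by positivity) hK₂
    rw [div_mul_eq_mul_div, div_le_iff₀ (by positivity)] at h5
    rw [div_mul_eq_mul_div, div_le_iff₀ (by positivity)] at h4
    have h6 : M * (4 * A₄) ≤ M * (4 * A₄) * (c * q ^ 2) := by
      calc M * (4 * A₄) = 4 * A₄ * M := by ring
        _ ≤ q * a₃ ^ 2 := h5
        _ = a₃ ^ 2 * q := by ring
        _ ≤ _ := h4
        _ = _ := by ring
    exact le_of_mul_le_mul_left (by linarith) (by positivity : 0 < M * (4 * A₄))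

/-- On the `k₀` true covariates the powers of `√(cN)` from the two models cancel up to constants;
this uses `cN ≥ 1`. Each of the `m` extra ones leaves `(cN)^(-1/2) ≤ t / √a₅`. -/
theorem precise_factor_le {a₂ a₅ b N c t Q : ℝ} {k₀ m K₀ : ℕ} (ha₂ : 0 < a₂) (ha₅ : 0 < a₅)
    (hb : 0 < b) (hN : 0 < N) (ht : 0 < t) (hcN : 1 ≤ c * N) (hct : a₅ ≤ t ^ 2 * (c * N))
    (hk : k₀ ≤ K₀) (hQ1 : 1 ≤ Q) (hQ2 : √(1 / a₂) ≤ Q) (hQ3 : √(1 + b) ≤ Q) :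
    √(1 / (a₂ * N * c)) ^ (k₀ + m) * √(1 + c * (N * b)) ^ k₀ ≤
      Q ^ (2 * K₀) * (Q / √a₅ * t) ^ m := by
  have hx : 0 < c * N := by linarith
  set x := c * N with hxdef
  have h1 : √(1 / (a₂ * N * c)) = √(1 / a₂) * (√x)⁻¹ := by
    rw [← Real.sqrt_inv, ← Real.sqrt_mul (by positivity)]
    congr 1
    have : c ≠ 0 := fun h => by simp [hxdef, h] at hx
    rw [hxdef]; field_simp
  have h2 : √(1 + c * (N * b)) ≤ √(1 + b) * √x := by
    rw [← Real.sqrt_mul (by positivity)]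
    refine Real.sqrt_le_sqrt ?_
    have : c * (N * b) = x * b := by rw [hxdef]; ring
    rw [this]; nlinarith
  have hsx : 0 < √x := Real.sqrt_pos.2 hx
  have hsa : 0 < √a₅ := Real.sqrt_pos.2 ha₅
  have h3 : (√x)⁻¹ ≤ t / √a₅ := by
    rw [inv_le_comm₀ hsx (by positivity), inv_div, div_le_iff₀ ht]
    have : √a₅ ≤ √(t ^ 2 * x) := Real.sqrt_le_sqrt hct
    rwa [Real.sqrt_mul (by positivity), Real.sqrt_sq ht.le, mul_comm] at this
  rw [h1]
  calc (√(1 / a₂) * (√x)⁻¹) ^ (k₀ + m) * √(1 + c * (N * b)) ^ k₀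
      ≤ (Q * (√x)⁻¹) ^ (k₀ + m) * (Q * √x) ^ k₀ := by
        gcongr
        exact h2.trans (mul_le_mul_of_nonneg_right hQ3 hsx.le)
    _ = Q ^ (2 * k₀) * (Q * (√x)⁻¹) ^ m := by
        have : (√x)⁻¹ ^ k₀ * √x ^ k₀ = 1 := by
          rw [← mul_pow, inv_mul_cancel₀ hsx.ne', one_pow]
        calc _ = Q ^ (2 * k₀) * (Q * (√x)⁻¹) ^ m * ((√x)⁻¹ ^ k₀ * √x ^ k₀) := by ring
          _ = _ := by rw [this, mul_one]
    _ ≤ Q ^ (2 * K₀) * (Q * (t / √a₅)) ^ m := by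
        gcongr
    _ = _ := by ring

/-! ### Sums over wrong models. -/

/-- Every term `u G` is at most the whole sum, hence at most `1`, so `(u G)^s ≤ u G` for `s ≥ 1`.
The exponent lost to `z > 1` is thus harmless, and the sum is at most `ε` times a sum bounded by
`1`. -/
theorem sum_superset_le {p : ℕ} {γ₀ : Finset (Fin p)} {F M : Finset (Fin p) → ℝ≥0∞}
    {u W : ℕ → ℝ} {s ε : ℝ} (hs : 1 ≤ s) (hu : ∀ m, 0 < u m)
    (hF : ∑ γ ∈ Finset.univ.filter (γ₀ ⊂ ·), ENNReal.ofReal (u (γ \ γ₀).card) * F γ ≤ 1)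
    (hW : ∀ γ, γ₀ ⊂ γ → W (γ \ γ₀).card ≤ ε * u (γ \ γ₀).card ^ s) (hε : 0 ≤ ε)
    (hM : ∀ γ, γ₀ ⊂ γ → ∀ G : ℝ, F γ ≤ ENNReal.ofReal G →
      M γ ≤ ENNReal.ofReal (W (γ \ γ₀).card * G ^ s) * M γ₀) :
    ∑ γ ∈ Finset.univ.filter (γ₀ ⊂ ·), M γ ≤ ENNReal.ofReal ε * M γ₀ := by
  have key : ∀ γ ∈ Finset.univ.filter (γ₀ ⊂ ·),
      M γ ≤ ENNReal.ofReal ε * M γ₀ * (ENNReal.ofReal (u (γ \ γ₀).card) * F γ) := by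
    intro γ hγ
    have hlt : γ₀ ⊂ γ := by simpa using hγ
    set m := (γ \ γ₀).card with hm
    have h1 : ENNReal.ofReal (u m) * F γ ≤ 1 := (Finset.single_le_sum
      (f := fun γ => ENNReal.ofReal (u (γ \ γ₀).card) * F γ) (fun _ _ => zero_le) hγ).trans hF
    have hFt : F γ ≠ ∞ := by
      intro h
      rw [h, ENNReal.mul_top (by simpa using hu m)] at h1
      simp at h1
    set G := (F γ).toReal with hG
    have hFG : F γ = ENNReal.ofReal G := (ENNReal.ofReal_toReal hFt).symm
    have hG0 : 0 ≤ G := ENNReal.toReal_nonneg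
    rw [hFG, ← ENNReal.ofReal_mul (hu m).le] at h1 ⊢
    rw [ENNReal.ofReal_le_one] at h1
    have huG : 0 ≤ u m * G := mul_nonneg (hu m).le hG0
    refine (hM γ hlt G hFG.le).trans ?_
    rw [mul_right_comm, ← ENNReal.ofReal_mul hε]
    refine mul_le_mul_left (ENNReal.ofReal_le_ofReal ?_) _
    calc W m * G ^ s ≤ ε * u m ^ s * G ^ s :=
          mul_le_mul_of_nonneg_right (hW γ hlt) (Real.rpow_nonneg hG0 _)
      _ = ε * (u m * G) ^ s := by rw [Real.mul_rpow (hu m).le hG0]; ring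
      _ ≤ ε * (u m * G) := mul_le_mul_of_nonneg_left
          (Real.rpow_le_self_of_le_one huG h1 hs) hε
  refine (Finset.sum_le_sum key).trans ?_
  rw [← Finset.mul_sum]
  exact mul_le_of_le_one_right zero_le hF

theorem sum_missing_le {p : ℕ} {γ₀ : Finset (Fin p)} {M : Finset (Fin p) → ℝ≥0∞} {W : ℝ}
    (hM : ∀ γ, ¬ γ₀ ⊆ γ → M γ ≤ ENNReal.ofReal W * M γ₀) :
    ∑ γ ∈ Finset.univ.filter (fun γ => ¬ γ₀ ⊆ γ), M γ ≤ ENNReal.ofReal (2 ^ p * W) * M γ₀ := by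
  calc _ ≤ ∑ γ ∈ Finset.univ.filter (fun γ => ¬ γ₀ ⊆ γ), ENNReal.ofReal W * M γ₀ :=
        Finset.sum_le_sum fun γ hγ => hM γ (by simpa using hγ)
    _ ≤ ∑ γ : Finset (Fin p), ENNReal.ofReal W * M γ₀ :=
        Finset.sum_le_sum_of_subset (Finset.filter_subset _ _)
    _ = _ := by
        rw [Finset.sum_const, Finset.card_univ, Fintype.card_finset, Fintype.card_fin,
          nsmul_eq_mul, ← mul_assoc, ENNReal.ofReal_mul (by positivity),
          ENNReal.ofReal_pow (by norm_num)]
        simp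

theorem sum_ne_eq {p : ℕ} (γ₀ : Finset (Fin p)) (M : Finset (Fin p) → ℝ≥0∞) :
    ∑ γ ∈ Finset.univ.filter (· ≠ γ₀), M γ =
      ∑ γ ∈ Finset.univ.filter (γ₀ ⊂ ·), M γ + ∑ γ ∈ Finset.univ.filter (fun γ => ¬ γ₀ ⊆ γ), M γ := by
  rw [← Finset.sum_filter_add_sum_filter_not (Finset.univ.filter (· ≠ γ₀)) (γ₀ ⊆ ·)]
  simp only [Finset.filter_filter]
  congr 1 <;> refine Finset.sum_congr (Finset.filter_congr fun γ _ => ?_) fun _ _ => rfl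
  · rw [Finset.ssubset_iff_subset_ne]; tauto
  · constructor
    · exact fun h => h.2
    · exact fun h => ⟨fun h' => h (h' ▸ subset_rfl), h⟩

theorem div_sub_div_add_le {S A c : ℝ} (hS : 0 ≤ S) (hA : 0 < A) (hc : 0 < c) :
    S / c - S / (c + 1 / A) ≤ S / (A * c ^ 2) := by
  have h1 : S / c - S / (c + 1 / A) = S / (A * c ^ 2 + c) := by
    field_simp; ring
  rw [h1]
  exact div_le_div_of_nonneg_left hS (by positivity) (by linarith)

/-! ### Conditions that hold for large `n`. -/

theorem eventually_one_le_log : ∀ᶠ n : ℕ in atTop, 1 ≤ Real.log n := by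
  filter_upwards [eventually_ge_atTop 3] with n hn
  have hn' : (3 : ℝ) ≤ n := by exact_mod_cast hn
  rw [Real.le_log_iff_exp_le (by linarith)]
  linarith [Real.exp_one_lt_d9]

theorem eventually_one_le_rpow {r : ℝ} (hr : 0 ≤ r) : ∀ᶠ n : ℕ in atTop, 1 ≤ (n : ℝ) ^ r := by
  filter_upwards [eventually_ge_atTop 1] with n hn
  exact Real.one_le_rpow (by exact_mod_cast hn) hr

/-- Here `√(m+1) n^(-ρ)` is the price of one extra covariate. With `c ≥ φ` the first alternative
always holds and `ρ = 1/2`; without a lower bound on `c`, `regime_dichotomy` gives `ρ = 1/4`. -/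
theorem eventually_regime (g : Measure ℝ≥0) {S : ℕ → ℝ} {a₂ a₃ A₄ B r ρ A₁ : ℝ} {φ : ℝ≥0}
    (p : ℕ → ℕ) (ha₂ : 0 < a₂) (ha₃ : 0 < a₃) (hA₄ : 0 < A₄) (hφ : φ ≠ 0) (hr0 : 0 ≤ r)
    (hA₁ : 0 ≤ A₁) (hp : ∀ᶠ n in atTop, (p n : ℝ) ≤ A₁ * (n : ℝ) ^ r)
    (hS0 : ∀ n, 0 ≤ S n) (hSB : ∀ᶠ n in atTop, S n ≤ B)
    (hS : ∀ᶠ n : ℕ in atTop, a₃ ^ 2 * Real.log n / √n ≤ S n)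
    (hreg : (ρ = 1 / 2 ∧ ∀ᵐ c ∂g, φ ≤ c) ∨ (ρ = 1 / 4 ∧ r < 1 / 4)) :
    ∃ a₅ : ℝ, 0 < a₅ ∧ ∀ᶠ n : ℕ in atTop, ∀ᵐ c : ℝ≥0 ∂g, ∀ m : ℕ, m ≤ p n →
      (c ≠ 0 ∧ S n / c - S n / (c + 1 / (a₂ * n)) ≤ 1 ∧ 1 ≤ c * (n : ℝ) ∧
        a₅ ≤ (√((m : ℝ) + 1) * (n : ℝ) ^ (-ρ)) ^ 2 * (c * n)) ∨
      A₄ * ((m + 1) * Real.log n) ≤ S n / (2 * c + 1 / (a₂ * n)) := by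
  rcases hreg with ⟨rfl, hc⟩ | ⟨rfl, hr⟩
  · have hφ' : (0 : ℝ) < φ := by exact_mod_cast pos_iff_ne_zero.2 hφ
    refine ⟨φ, hφ', ?_⟩
    filter_upwards [hSB, eventually_gt_atTop 0,
      tendsto_natCast_atTop_atTop.eventually_ge_atTop (1 / (φ : ℝ)),
      tendsto_natCast_atTop_atTop.eventually_ge_atTop (B / (a₂ * φ ^ 2))] with n hB hn h1 h2
    have hn' : (0 : ℝ) < n := by exact_mod_cast hn
    filter_upwards [hc] with c hc m _
    have hc' : (φ : ℝ) ≤ c := by exact_mod_cast hc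
    have hc0 : (0 : ℝ) < c := hφ'.trans_le hc'
    left
    refine ⟨fun h => by simp [h] at hc0, ?_, ?_, ?_⟩
    · refine (div_sub_div_add_le (hS0 n) (by positivity) hc0).trans ?_
      rw [div_le_one (by positivity)]
      rw [div_le_iff₀ (by positivity)] at h2
      calc S n ≤ B := hB
        _ ≤ n * (a₂ * φ ^ 2) := h2
        _ ≤ n * (a₂ * c ^ 2) := by gcongr
        _ = _ := by ring
    · rw [div_le_iff₀ hφ'] at h1
      calc (1 : ℝ) ≤ n * φ := h1
        _ ≤ n * c := by gcongr
        _ = _ := by ring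
    · rw [mul_pow, Real.sq_sqrt (by positivity), ← Real.rpow_natCast, ← Real.rpow_mul hn'.le]
      have : (n : ℝ) ^ (-(1 / 2 : ℝ) * (2 : ℕ)) = (n : ℝ)⁻¹ := by
        rw [← Real.rpow_neg_one]; congr 1; norm_num
      rw [this]
      calc (φ : ℝ) ≤ c := hc'
        _ ≤ ((m : ℝ) + 1) * c := le_mul_of_one_le_left hc0.le (by
            have : (0 : ℝ) ≤ m := by positivity
            linarith)
        _ = _ := by field_simp
  · refine ⟨a₃ ^ 2 / (4 * A₄), by positivity, ?_⟩
    set K := 2 * A₄ / (a₂ * a₃ ^ 2) + 4 * A₄ / a₃ ^ 2 + 16 * A₄ ^ 2 / (a₂ * a₃ ^ 2) with hK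
    have hk1 : 0 ≤ 2 * A₄ / (a₂ * a₃ ^ 2) := by positivity
    have hk2 : 0 ≤ 4 * A₄ / a₃ ^ 2 := by positivity
    have hk3 : 0 ≤ 16 * A₄ ^ 2 / (a₂ * a₃ ^ 2) := by positivity
    have hK0 : 0 ≤ K := by positivity
    -- The restriction `r < 1/4` enters here: `(m + 1)² log n = O(n^(2r) log n)` has to stay below a
    -- small multiple of `√n`.
    filter_upwards [hp, hS, eventually_gt_atTop 0, eventually_one_le_log, eventually_one_le_rpow hr0,
      eventually_mul_rpow_mul_log_sq_le (show 2 * r < 1 / 2 by linarith) (K * (A₁ + 1) ^ 2)]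
      with n hp hS hn hlog hnr hdom
    have hn' : (0 : ℝ) < n := by exact_mod_cast hn
    refine ae_of_all _ fun c m hm => ?_
    by_cases h : A₄ * ((m + 1) * Real.log n) ≤ S n / (2 * c + 1 / (a₂ * n))
    · exact Or.inr h
    left
    have hq2 : √(n : ℝ) ^ 2 = n := Real.sq_sqrt hn'.le
    have hM : ((m : ℝ) + 1) ≤ (A₁ + 1) * (n : ℝ) ^ r := by
      have : (m : ℝ) ≤ p n := by exact_mod_cast hm
      linarith
    have hdich := regime_dichotomy (q := √n) (l := Real.log n) (M := (m : ℝ) + 1) (S := S n)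
      (c := c) (K := K) ha₂ ha₃ hA₄ (Real.sqrt_pos.2 hn') hlog
      (by have : (0 : ℝ) ≤ m := by positivity
          linarith) hS
      (by
        rw [Real.sqrt_eq_rpow]
        refine le_trans ?_ hdom
        have e1 : (n : ℝ) ^ (2 * r) = ((n : ℝ) ^ r) ^ 2 := by
          rw [← Real.rpow_natCast, ← Real.rpow_mul hn'.le, mul_comm]; norm_num
        have e2 : Real.log n ≤ (1 + Real.log n) ^ 2 := by nlinarith
        rw [e1]
        calc K * (((m : ℝ) + 1) ^ 2 * Real.log n)
            ≤ K * (((A₁ + 1) * (n : ℝ) ^ r) ^ 2 * (1 + Real.log n) ^ 2) := by gcongr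
          _ = _ := by ring)
      (by linarith) (by linarith) (by linarith) c.2
      (by rw [hq2, mul_assoc]; exact not_le.1 h)
    rw [hq2] at hdich
    obtain ⟨h1, h2, h3, h4⟩ := hdich
    refine ⟨fun h => by simp [h] at h1, h2, h3, ?_⟩
    rw [mul_pow, Real.sq_sqrt (by positivity), ← Real.rpow_natCast ((n : ℝ) ^ _),
      ← Real.rpow_mul hn'.le]
    have : (n : ℝ) ^ (-(1 / 4 : ℝ) * (2 : ℕ)) = (√n)⁻¹ := by
      rw [Real.sqrt_eq_rpow, ← Real.rpow_neg hn'.le]; congr 1; norm_num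
    rw [this]
    have hq : 0 < √(n : ℝ) := Real.sqrt_pos.2 hn'
    calc a₃ ^ 2 / (4 * A₄) = a₃ ^ 2 / (4 * A₄) * √n * (√n)⁻¹ := by field_simp
      _ ≤ (((m : ℝ) + 1) * (c * n)) * (√n)⁻¹ := by gcongr
      _ = _ := by ring

/-- As `l > 1/z`, the residual `E ≥ l n v` exceeds `n v / z` by a fixed multiple of `n`, which
leaves room for the fitted noise `O(p) = o(n)` and for `ν`. The penalties are `o(n)` as well,
because `r < 1/2`. -/
theorem eventually_precision_conditions {ν v z l a₁ A₁ r L₁ L₂ : ℝ} (p : ℕ → ℕ) (hz : 1 < z)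
    (hv : 0 < v) (hl : 1 / z < l) (hr0 : 0 ≤ r) (hr : r < 1 / 2) (ha₁ : 0 ≤ a₁)
    (hp : ∀ᶠ n in atTop, (p n : ℝ) ≤ A₁ * (n : ℝ) ^ r) (hL₁ : 0 ≤ L₁) :
    ∀ᶠ n : ℕ in atTop, ∀ E : ℝ, l * n * v ≤ E →
      0 ≤ E - 2 * z ^ 2 * v * (a₁ * p n) ∧
      (n + ν) / 2 ≤ z / (2 * v) * (1 + (E - 2 * z ^ 2 * v * (a₁ * p n))) ∧
      (∀ m : ℕ, m ≤ p n → 1 + L₁ * ((m + 1) * Real.log n) ≤ 4 * n * v) ∧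
      1 + L₂ * (√n * Real.log n) ≤ 4 * n * v := by
  have hz0 : 0 < z := by linarith
  have hzl : 1 < z * l := by rwa [div_lt_iff₀ hz0, mul_comm] at hl
  have hlz : 0 < l - 1 / z := by linarith
  have hd0 : 0 < (l - 1 / z) * v / 2 := by positivity
  filter_upwards [hp, eventually_gt_atTop 0, eventually_one_le_log, eventually_one_le_rpow hr0,
    eventually_mul_rpow_mul_log_sq_le (show r < 1 by linarith)
      (2 * z ^ 2 * v * (a₁ * A₁) / ((l - 1 / z) * v / 2)),
    eventually_mul_rpow_mul_log_sq_le (show r < 1 by linarith) ((1 + L₁ * (A₁ + 1)) / (4 * v)),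
    eventually_mul_rpow_mul_log_sq_le (show (1 / 2 : ℝ) < 1 by norm_num) ((1 + |L₂|) / (4 * v)),
    tendsto_natCast_atTop_atTop.eventually_ge_atTop (2 * ν / (z * l - 1))]
    with n hp hn hlog hnr h1 h2 h3 h4 E hE
  have hn' : (0 : ℝ) < n := by exact_mod_cast hn
  rw [Real.rpow_one] at h1 h2 h3
  have hΛ : 1 ≤ (1 + Real.log n) ^ 2 := by nlinarith
  have hΛ2 : Real.log n ≤ (1 + Real.log n) ^ 2 := by nlinarith
  have hP0 : (0 : ℝ) ≤ p n := by positivity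
  have hA : 0 ≤ A₁ * (n : ℝ) ^ r := hP0.trans hp
  have hA₁ : 0 ≤ A₁ := by
    by_contra h
    nlinarith
  have e1 : 2 * z ^ 2 * v * (a₁ * p n) ≤ (l - 1 / z) * v / 2 * n := by
    rw [div_mul_eq_mul_div, div_mul_eq_mul_div, div_le_iff₀ hd0] at h1
    calc 2 * z ^ 2 * v * (a₁ * p n) ≤ 2 * z ^ 2 * v * (a₁ * (A₁ * (n : ℝ) ^ r)) := by gcongr
      _ ≤ 2 * z ^ 2 * v * (a₁ * (A₁ * (n : ℝ) ^ r)) * (1 + Real.log n) ^ 2 :=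
          le_mul_of_one_le_right (by positivity) hΛ
      _ = 2 * z ^ 2 * v * (a₁ * A₁) * (n : ℝ) ^ r * (1 + Real.log n) ^ 2 := by ring
      _ ≤ _ := h1
      _ = _ := by ring
  -- Half of the gap between `l` and `1/z` is spent on the fitted noise; the other half covers `ν`
  -- below.
  have e2 : n * v * ((l + 1 / z) / 2) ≤ E - 2 * z ^ 2 * v * (a₁ * p n) := by
    calc n * v * ((l + 1 / z) / 2) = l * n * v - (l - 1 / z) * v / 2 * n := by ring
      _ ≤ _ := by linarith
  have hiz : 0 < 1 / z := by positivity
  refine ⟨le_trans (by have : 0 < l := by linarith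
                       positivity) e2, ?_, ?_, ?_⟩
  · rw [div_le_iff₀ (by linarith)] at h4
    have e3 : z / (2 * v) * (n * v * ((l + 1 / z) / 2)) = n * (z * l + 1) / 4 := by
      field_simp
      norm_num
    have e4 : z / (2 * v) * (n * v * ((l + 1 / z) / 2)) ≤
        z / (2 * v) * (1 + (E - 2 * z ^ 2 * v * (a₁ * p n))) := by
      gcongr; linarith
    rw [e3] at e4
    nlinarith
  · intro m hm
    have hM : ((m : ℝ) + 1) ≤ (A₁ + 1) * (n : ℝ) ^ r := by
      have : (m : ℝ) ≤ p n := by exact_mod_cast hm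
      linarith
    rw [div_mul_eq_mul_div, div_mul_eq_mul_div, div_le_iff₀ (by positivity)] at h2
    calc 1 + L₁ * ((m + 1) * Real.log n)
        ≤ (n : ℝ) ^ r * (1 + Real.log n) ^ 2 +
            L₁ * ((A₁ + 1) * (n : ℝ) ^ r * (1 + Real.log n) ^ 2) := by
          gcongr
          nlinarith
      _ = (1 + L₁ * (A₁ + 1)) * (n : ℝ) ^ r * (1 + Real.log n) ^ 2 := by ring
      _ ≤ _ := h2
      _ = _ := by ring
  · rw [div_mul_eq_mul_div, div_mul_eq_mul_div, div_le_iff₀ (by positivity),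
      ← Real.sqrt_eq_rpow] at h3
    have hq : 1 ≤ √(n : ℝ) := Real.one_le_sqrt.2 (by exact_mod_cast hn)
    have : L₂ * (√n * Real.log n) ≤ |L₂| * (√n * (1 + Real.log n) ^ 2) :=
      mul_le_mul (le_abs_self _) (by gcongr) (by positivity) (abs_nonneg _)
    have h5 : 1 ≤ √(n : ℝ) * (1 + Real.log n) ^ 2 := by nlinarith
    linarith

/-- After taking logarithms, everything except the penalty `C₃ √n log n` is `O(n^r (1 + log n)²)`
with `r < 1/2`. -/
theorem eventually_missing_weight_le {Φ b C₁ C₂ C₃ A₁ r ε : ℝ} (p : ℕ → ℕ) (K₀ : ℕ) (hΦ : 0 ≤ Φ)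
    (hb : 0 < b) (hr0 : 0 ≤ r) (hr : r < 1 / 2) (hC₁ : 0 ≤ C₁) (hC₃ : 0 < C₃)
    (hp : ∀ᶠ n in atTop, (p n : ℝ) ≤ A₁ * (n : ℝ) ^ r) (hε : 0 < ε) :
    ∀ᶠ n : ℕ in atTop, ∀ k : ℕ, k ≤ K₀ →
      2 ^ p n * (√(1 + Φ * (n * b)) ^ k *
        Real.exp (C₁ * p n + C₂ - C₃ * (√n * Real.log n))) ≤ ε := by
  filter_upwards [hp, eventually_gt_atTop 0, eventually_one_le_log, eventually_one_le_rpow hr0,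
    eventually_mul_rpow_mul_log_sq_le hr ((A₁ + K₀ * (Real.log (1 + Φ * b) + 1) + C₁ * A₁ + |C₂| +
      |Real.log ε|) / C₃)] with n hp hn hlog hnr hdom k hk
  have hn' : (1 : ℝ) ≤ n := by exact_mod_cast hn
  have hn0 : (0 : ℝ) < n := by linarith
  have hΛ : 1 ≤ (1 + Real.log n) ^ 2 := by nlinarith
  have hΛ2 : Real.log n ≤ (1 + Real.log n) ^ 2 := by nlinarith
  have hb1 : 1 ≤ 1 + Φ * b := by
    have : 0 ≤ Φ * b := by positivity
    linarith
  have hlb : 0 ≤ Real.log (1 + Φ * b) := Real.log_nonneg hb1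
  have h1 : √(1 + Φ * (n * b)) ^ k ≤ Real.exp (K₀ * (Real.log (1 + Φ * b) + Real.log n)) := by
    rw [← Real.log_mul (by linarith) hn0.ne', Real.exp_nat_mul, Real.exp_log (by positivity)]
    have h2 : √(1 + Φ * (n * b)) ≤ (1 + Φ * b) * n := by
      have h3 : 1 + Φ * (n * b) ≤ (1 + Φ * b) * n := by
        have : (1 + Φ * b) * n = n + Φ * (n * b) := by ring
        linarith
      refine (Real.sqrt_le_sqrt h3).trans ?_
      rw [Real.sqrt_le_left (by positivity)]
      nlinarith [mul_le_mul hb1 hn' zero_le_one (by linarith)]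
    calc √(1 + Φ * (n * b)) ^ k ≤ ((1 + Φ * b) * n) ^ k := by gcongr
      _ ≤ _ := pow_le_pow_right₀ (by nlinarith) hk
  have h2 : (2 : ℝ) ^ p n ≤ Real.exp (p n) := by
    rw [← mul_one (p n : ℝ), Real.exp_nat_mul]
    exact pow_le_pow_left₀ (by norm_num) (by linarith [Real.add_one_le_exp (1 : ℝ)]) _
  have hX1 : 1 ≤ (n : ℝ) ^ r * (1 + Real.log n) ^ 2 := by nlinarith
  have hX2 : Real.log n ≤ (n : ℝ) ^ r * (1 + Real.log n) ^ 2 := by nlinarith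
  have hP : (p n : ℝ) ≤ A₁ * ((n : ℝ) ^ r * (1 + Real.log n) ^ 2) := by
    have : (p n : ℝ) * 1 ≤ (A₁ * (n : ℝ) ^ r) * (1 + Real.log n) ^ 2 :=
      mul_le_mul hp hΛ zero_le_one ((by positivity : (0 : ℝ) ≤ p n).trans hp)
    linarith
  rw [div_mul_eq_mul_div, div_mul_eq_mul_div, div_le_iff₀ hC₃, ← Real.sqrt_eq_rpow, mul_assoc]
    at hdom
  set Y := (n : ℝ) ^ r * (1 + Real.log n) ^ 2 with hY
  have h3 : (p n : ℝ) + (K₀ * (Real.log (1 + Φ * b) + Real.log n) +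
      (C₁ * p n + C₂ - C₃ * (√n * Real.log n))) ≤ Real.log ε := by
    have e1 : (K₀ : ℝ) * (Real.log (1 + Φ * b) + Real.log n) ≤
        K₀ * (Real.log (1 + Φ * b) + 1) * Y := by
      have : Real.log (1 + Φ * b) + Real.log n ≤ (Real.log (1 + Φ * b) + 1) * Y := by nlinarith
      rw [mul_assoc]
      exact mul_le_mul_of_nonneg_left this (by positivity)
    have e2 : C₁ * p n ≤ C₁ * A₁ * Y := by
      rw [mul_assoc]; exact mul_le_mul_of_nonneg_left hP hC₁
    have e3 : C₂ ≤ |C₂| * Y := (le_abs_self _).trans (le_mul_of_one_le_right (abs_nonneg _) hX1)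
    have e4 : -Real.log ε ≤ |Real.log ε| * Y :=
      (neg_le_abs _).trans (le_mul_of_one_le_right (abs_nonneg _) hX1)
    have e5 : √(n : ℝ) * C₃ ≤ C₃ * (√n * Real.log n) := by
      have : √(n : ℝ) * 1 ≤ √n * Real.log n := by gcongr
      nlinarith
    linarith
  calc 2 ^ p n * (√(1 + Φ * (n * b)) ^ k * Real.exp (C₁ * p n + C₂ - C₃ * (√n * Real.log n)))
      ≤ Real.exp (p n) * (Real.exp (K₀ * (Real.log (1 + Φ * b) + Real.log n)) *
          Real.exp (C₁ * p n + C₂ - C₃ * (√n * Real.log n))) := by gcongr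
    _ ≤ ε := by
        rw [← Real.exp_add, ← Real.exp_add, ← Real.le_log_iff_exp_le hε]
        exact h3

theorem sqrt_one_add_pow_le {Φ b N : ℝ} {k K : ℕ} (hΦ : 0 ≤ Φ) (hb : 0 < b) (hN : 1 ≤ N)
    (hk : k ≤ K) : √(1 + Φ * (N * b)) ^ k ≤ (1 + Φ * b) ^ K * N ^ K := by
  have hb1 : 1 ≤ 1 + Φ * b := by
    have : 0 ≤ Φ * b := by positivity
    linarith
  have hbN : 1 ≤ (1 + Φ * b) * N := by nlinarith
  have h2 : √(1 + Φ * (N * b)) ≤ (1 + Φ * b) * N := by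
    rw [Real.sqrt_le_left (by linarith)]
    nlinarith
  rw [← mul_pow]
  exact (pow_le_pow_left₀ (by positivity) h2 k).trans (pow_le_pow_right₀ hbN hk)

/-! ### All wrong models together, on the good event. -/

theorem eq_zero_of_notMem_trueModel {p : ℕ} {β : Fin p → ℝ} :
    ∀ j ∉ trueModel β, β j = 0 := by
  intro j hj
  simpa [trueModel] using hj

set_option maxHeartbeats 1000000 in
/-- On the event that the error vector is well behaved, the total marginal likelihood of the wrong
models is negligible. -/
theorem eventually_sum_marginalLikelihood_le (p : ℕ → ℕ) (β₀ : ∀ n, Fin (p n) → ℝ)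
    (g : Measure ℝ≥0) [IsProbabilityMeasure g] {ν b v z r r' ρ l a₁ a₃ A₁ B ε : ℝ} {K₀ : ℕ}
    {φ Φ : ℝ≥0} (hb : 0 < b) (hν : 0 < ν) (hv : 0 < v) (hz : 1 < z) (hl : 1 / z < l)
    (hr0 : 0 ≤ r) (hr : r < 1 / 2) (hr' : r' ≤ 1) (hρ : z ^ 3 * r' < ρ) (ha₁ : 0 ≤ a₁)
    (ha₃ : 0 < a₃) (hA₁ : 0 ≤ A₁) (hp : ∀ᶠ n in atTop, (p n : ℝ) ≤ A₁ * (n : ℝ) ^ r)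
    (hk : ∀ᶠ n in atTop, (trueModel (β₀ n)).card ≤ K₀)
    (hB : ∀ᶠ n in atTop, nsq (β₀ n) ≤ B)
    (hne : ∀ᶠ n in atTop, (trueModel (β₀ n)).Nonempty)
    (hsig : ∀ᶠ n : ℕ in atTop, ∀ j ∈ trueModel (β₀ n),
      a₃ * ((n : ℝ) ^ (-(1 / 4) : ℝ) * √(Real.log n)) ≤ |β₀ n j|)
    (hφ : φ ≠ 0) (hg : g (Set.Icc φ Φ) ≠ 0)
    (hreg : (ρ = 1 / 2 ∧ ∀ᵐ c ∂g, φ ≤ c) ∨ (ρ = 1 / 4 ∧ r < 1 / 4)) (hε : 0 < ε) :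
    ∀ᶠ n : ℕ in atTop, ∀ (X : Matrix (Fin n) (Fin (p n)) ℝ) (e : Fin n → ℝ),
      IsConditioned b X → l * n * v ≤ nsq e → nsq e ≤ 4 * n * v →
      fitStat √(1 / (z * v)) b Finset.univ X e ≤ ENNReal.ofReal (Real.exp (a₁ * p n)) →
      ∑ γ ∈ Finset.univ.filter (trueModel (β₀ n) ⊂ ·),
        ENNReal.ofReal (((n : ℝ) ^ (-r')) ^ (γ \ trueModel (β₀ n)).card *
          (γ \ trueModel (β₀ n)).card.factorial) * fitStat √(1 / (z * v)) b γ X e ≤ 1 →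
      ∑ γ ∈ Finset.univ.filter (· ≠ trueModel (β₀ n)),
        marginalLikelihood ν g X (X.mulVec (β₀ n) + e) γ ≤
          ENNReal.ofReal ε *
            marginalLikelihood ν g X (X.mulVec (β₀ n) + e) (trueModel (β₀ n)) := by
  have hz0 : 0 < z := by linarith
  have hz1 : 0 < 1 - 1 / z := by
    rw [sub_pos, div_lt_one hz0]; exact hz
  have hs : 1 ≤ z ^ 3 := one_le_pow₀ hz.le
  have hφ' : (0 : ℝ) < φ := by exact_mod_cast pos_iff_ne_zero.2 hφ
  set q₀ := (g (Set.Icc φ Φ)).toReal with hq₀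
  have hq₀0 : 0 < q₀ := ENNReal.toReal_pos hg (measure_ne_top _ _)
  set a₂ := (1 - 1 / z) / (2 * b) with ha₂def
  have ha₂ : 0 < a₂ := by positivity
  -- The factor `16v` cancels the rate `κ' = 1/(16v)`; the rest is the exponent required by
  -- `eventually_diffuse_weight_le`.
  set A₄ := 16 * v * (K₀ + z ^ 3 + 1) with hA₄def
  have hA₄ : 0 < A₄ := by positivity
  set L₂ := (1 - 1 / z) / b * a₃ ^ 2 with hL₂
  have hL₂0 : 0 < L₂ := by positivity
  have hsigsq : ∀ n : ℕ, 0 < n → 1 ≤ Real.log n →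
      (a₃ * ((n : ℝ) ^ (-(1 / 4) : ℝ) * √(Real.log n))) ^ 2 = a₃ ^ 2 * Real.log n / √n := by
    intro n hn hlog
    have hn' : (0 : ℝ) < n := by exact_mod_cast hn
    rw [mul_pow, mul_pow, Real.sq_sqrt (by linarith), ← Real.rpow_natCast ((n : ℝ) ^ _),
      ← Real.rpow_mul hn'.le]
    have : (n : ℝ) ^ (-(1 / 4 : ℝ) * (2 : ℕ)) = (√n)⁻¹ := by
      rw [Real.sqrt_eq_rpow, ← Real.rpow_neg hn'.le]; congr 1; norm_num
    rw [this]; ring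
  have hS : ∀ᶠ n : ℕ in atTop, a₃ ^ 2 * Real.log n / √n ≤ nsq (β₀ n) := by
    filter_upwards [hne, hsig, eventually_gt_atTop 0, eventually_one_le_log] with n hne hsig hn hlog
    obtain ⟨j, hj⟩ := hne
    rw [← hsigsq n hn hlog]
    calc _ ≤ |β₀ n j| ^ 2 := pow_le_pow_left₀ (by positivity) (hsig j hj) 2
      _ = β₀ n j ^ 2 := sq_abs _
      _ ≤ _ := Finset.single_le_sum (f := fun i => β₀ n i ^ 2)
          (fun _ _ => sq_nonneg _) (Finset.mem_univ j)
  obtain ⟨a₅, ha₅, hregime⟩ := eventually_regime g (S := fun n => nsq (β₀ n)) (A₄ := A₄) p ha₂ ha₃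
    hA₄ hφ hr0 hA₁ hp (fun n => nsq_nonneg _) hB hS hreg
  set Q := 1 + √(1 / a₂) + √(1 + b) with hQ
  have hQ1 : 1 ≤ Q := by
    have : 0 ≤ √(1 / a₂) := by positivity
    have : 0 ≤ √(1 + b) := by positivity
    linarith
  have hw₁ := eventually_precise_weight_le (ρ := ρ) (r := r') (s := z ^ 3)
    (K₁ := Q ^ (2 * K₀) * Real.exp (z / (2 * v))) (K₂ := Q / √a₅) (ε := ε / 4) hs hρ (by positivity)
    (by positivity) (by positivity)
  set C₉ := 2 ^ K₀ * (1 + Φ * b) ^ K₀ * Real.exp (z / (2 * v) * (B / φ)) / q₀ with hC₉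
  have hC₉0 : 0 < C₉ := by positivity
  have hw₂ := eventually_diffuse_weight_le (r := r') (s := z ^ 3) (C := C₉) (ε := ε / 4) K₀ hs hr'
    (by positivity) (by positivity)
  have hprec := eventually_precision_conditions (ν := ν) (L₁ := A₄) (L₂ := L₂) p hz hv hl hr0 hr
    ha₁ hp hA₄.le
  have hmiss := eventually_missing_weight_le (Φ := Φ) (b := b) (C₁ := z ^ 3 * a₁)
    (C₂ := z / (2 * v) * (B / φ)) (C₃ := 1 / (16 * v) * L₂) (ε := ε / 2 * q₀) p K₀ Φ.2 hb hr0 hr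
    (by positivity) (by positivity) hp (by positivity)
  clear_value a₂ A₄ L₂ C₉ Q q₀
  filter_upwards [hregime, hw₁, hw₂, hprec, hmiss, hk, hB, hsig, eventually_gt_atTop 0,
    eventually_one_le_log] with n hregime hw₁ hw₂ hprec hmiss hk hB hsig hn hlog
    X e hX hlo hhi huniv hsum
  have hn1 : (1 : ℝ) ≤ n := by exact_mod_cast hn
  have hn' : (0 : ℝ) < n := by linarith
  obtain ⟨hT, hκ, hL, hL2⟩ := hprec _ hlo
  set γ₀ := trueModel (β₀ n) with hγ₀
  have hBφ : nsq (β₀ n) / φ ≤ B / φ := div_le_div_of_nonneg_right hB hφ'.le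
  -- From `nsq e ≤ 4nv` the bracket is at most `8nv`, and `8nv / (16v) = n/2`.
  have hκ' : ∀ L, 1 + L ≤ 4 * n * v → 1 / (16 * v) * (1 + nsq e + L) ≤ (n + ν) / 2 := by
    intro L hL
    rw [div_mul_eq_mul_div, div_le_iff₀ (by positivity)]
    nlinarith
  rw [sum_ne_eq, show ε = ε / 2 + ε / 2 by ring, ENNReal.ofReal_add (by positivity) (by positivity),
    add_mul]
  refine add_le_add ?_ ?_
  · refine sum_superset_le (F := fun γ => fitStat √(1 / (z * v)) b γ X e) (s := z ^ 3)
      (u := fun m => ((n : ℝ) ^ (-r')) ^ m * m.factorial)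
      (W := fun m => Q ^ (2 * K₀) * (Q / √a₅ * (√((m : ℝ) + 1) * (n : ℝ) ^ (-ρ))) ^ m *
        Real.exp (z / (2 * v)) + C₉ * 2 ^ m * (n : ℝ) ^ K₀ *
          Real.exp (-((K₀ + z ^ 3 + 1) * ((m + 1) * Real.log n)))) hs
      (fun m => by positivity) hsum ?_ (by positivity) ?_
    · intro γ hγ
      have hm : 1 ≤ (γ \ γ₀).card := by
        rw [Nat.one_le_iff_ne_zero, Finset.card_ne_zero, Finset.sdiff_nonempty]
        exact hγ.2
      have h1 := hw₁ _ hm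
      have h2 := hw₂ (γ \ γ₀).card
      have h3 : Q ^ (2 * K₀) * Real.exp (z / (2 * v)) *
          (Q / √a₅ * (√(((γ \ γ₀).card : ℝ) + 1) * (n : ℝ) ^ (-ρ))) ^ (γ \ γ₀).card =
          Q ^ (2 * K₀) * (Q / √a₅ * (√(((γ \ γ₀).card : ℝ) + 1) * (n : ℝ) ^ (-ρ))) ^ (γ \ γ₀).card *
          Real.exp (z / (2 * v)) := by ring
      rw [h3] at h1
      linarith
    · intro γ hγ G hG
      set m := (γ \ γ₀).card with hm
      have hmp : m ≤ p n := by
        simpa using Finset.card_le_univ (γ \ γ₀)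
      have hcard : γ.card = γ₀.card + m := by
        rw [hm, add_comm, Finset.card_sdiff_add_card_eq_card hγ.1]
      have hQ0 : 0 < Q := by linarith
      have hL0 : 0 ≤ A₄ * ((m + 1) * Real.log n) :=
        mul_nonneg hA₄.le (mul_nonneg (by positivity) (by linarith))
      have hW₁0 : 0 ≤ Q ^ (2 * K₀) * (Q / √a₅ * (√((m : ℝ) + 1) * (n : ℝ) ^ (-ρ))) ^ m := by
        positivity
      have hW₂0 : 0 ≤ C₉ * 2 ^ m * (n : ℝ) ^ K₀ *
          Real.exp (-((K₀ + z ^ 3 + 1) * ((m + 1) * Real.log n))) := by positivity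
      refine marginalLikelihood_le_of_superset (A := a₂ * n) (L := A₄ * ((m + 1) * Real.log n))
        (κ' := 1 / (16 * v))
        (W₁ := Q ^ (2 * K₀) * (Q / √a₅ * (√((m : ℝ) + 1) * (n : ℝ) ^ (-ρ))) ^ m)
        (W₂ := C₉ * 2 ^ m * (n : ℝ) ^ K₀ *
          Real.exp (-((K₀ + z ^ 3 + 1) * ((m + 1) * Real.log n))))
        g hn hb hν hv hz (by rw [ha₂def]) hX eq_zero_of_notMem_trueModel hγ.1
        hG huniv hT hκ hL0 (by positivity) (hκ' _ (hL m hmp)) hφ hg hBφ hW₁0 hW₂0 ?_ ?_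
      · have e1 : 1 / (16 * v) * (A₄ * ((m + 1) * Real.log n)) =
            (K₀ + z ^ 3 + 1) * ((m + 1) * Real.log n) := by
          rw [hA₄def]; field_simp
        have e2 : √2 ^ γ.card ≤ 2 ^ K₀ * 2 ^ m := by
          have h2 : √2 ≤ 2 := by rw [Real.sqrt_le_left (by norm_num)]; norm_num
          rw [← pow_add, hcard]
          exact (pow_le_pow_left₀ (by positivity) h2 _).trans
            (pow_le_pow_right₀ (by norm_num) (by omega))
        have e3 := sqrt_one_add_pow_le (Φ := Φ) Φ.2 hb hn1 hk
        rw [e1, sub_eq_add_neg, Real.exp_add, ← hq₀]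
        calc √2 ^ γ.card * √(1 + Φ * (n * b)) ^ γ₀.card * (Real.exp (z / (2 * v) * (B / φ)) *
              Real.exp (-((K₀ + z ^ 3 + 1) * ((m + 1) * Real.log n))))
            ≤ (2 ^ K₀ * 2 ^ m) * ((1 + Φ * b) ^ K₀ * (n : ℝ) ^ K₀) *
              (Real.exp (z / (2 * v) * (B / φ)) *
              Real.exp (-((K₀ + z ^ 3 + 1) * ((m + 1) * Real.log n)))) := by gcongr
          _ = _ := by rw [hC₉]; field_simp
      · filter_upwards [hregime] with c hc
        rcases hc m hmp with ⟨hc0, hdrop, hc1, hct⟩ | h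
        · left
          refine ⟨hc0, hdrop, ?_⟩
          rw [hcard]
          refine precise_factor_le ha₂ ha₅ hb hn' (by positivity) hc1 hct hk hQ1 ?_ ?_
          · have : 0 ≤ √(1 + b) := by positivity
            linarith
          · have : 0 ≤ √(1 / a₂) := by positivity
            linarith
        · exact Or.inr h
  -- Squaring the signal bound of order `n^(-1/4) √(log n)` and multiplying by the curvature of
  -- order `n` gives the penalty of order `√n log n`.
  · have hψsq : (1 - 1 / z) / b * n * (a₃ * ((n : ℝ) ^ (-(1 / 4) : ℝ) * √(Real.log n))) ^ 2 =
        L₂ * (√n * Real.log n) := by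
      rw [hsigsq n hn hlog, hL₂]
      have : (n : ℝ) = √n * √n := (Real.mul_self_sqrt hn'.le).symm
      have hq : 0 < √(n : ℝ) := Real.sqrt_pos.2 hn'
      field_simp
      rw [Real.sq_sqrt hn'.le]
    have h := hmiss γ₀.card hk
    set W := √(1 + Φ * (n * b)) ^ γ₀.card * Real.exp (z ^ 3 * a₁ * p n + z / (2 * v) * (B / φ) -
      1 / (16 * v) * L₂ * (√n * Real.log n)) with hW
    refine (sum_missing_le (W := W / q₀) fun γ hγ => ?_).trans
      (mul_le_mul_left (ENNReal.ofReal_le_ofReal ?_) _)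
    · obtain ⟨j, hj₀, hj⟩ := Finset.not_subset.1 hγ
      refine marginalLikelihood_le_of_missing (κ' := 1 / (16 * v)) (B' := B / φ) g hn hb hν hv hz hX
        eq_zero_of_notMem_trueModel (by positivity) hj (hsig j hj₀) huniv hT hκ (by positivity)
        (by rw [hψsq]; exact hκ' _ hL2) hφ hg hBφ ?_
      rw [← hq₀, div_mul_cancel₀ _ hq₀0.ne', hψsq, hW, ← mul_assoc (z ^ 3), ← mul_assoc (1 / (16 * v))]
    · rw [mul_div_assoc', div_le_iff₀ hq₀0]
      exact h

/-! ### Probability of the bad event. -/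

theorem sum_ssuperset_card_le {p : ℕ} (γ₀ : Finset (Fin p)) {f : ℕ → ℝ} (hf : ∀ m, 0 ≤ f m) :
    ∑ γ ∈ Finset.univ.filter (γ₀ ⊂ ·), f (γ \ γ₀).card ≤
      ∑ m ∈ Finset.range p, p.choose (m + 1) * f (m + 1) := by
  -- Setting the value at `0` to zero removes the empty difference from the sum over all subsets, so
  -- the final sum starts at size `1`.
  set f' : ℕ → ℝ := fun m => if m = 0 then 0 else f m with hf'
  have hf'0 : ∀ m, 0 ≤ f' m := fun m => by
    simp only [hf']; split_ifs <;> [exact le_rfl; exact hf m]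
  calc ∑ γ ∈ Finset.univ.filter (γ₀ ⊂ ·), f (γ \ γ₀).card
      = ∑ γ ∈ Finset.univ.filter (γ₀ ⊂ ·), f' (γ \ γ₀).card := by
        refine Finset.sum_congr rfl fun γ hγ => ?_
        have h : γ₀ ⊂ γ := by simpa using hγ
        have hne : (γ \ γ₀).card ≠ 0 := by
          rw [Finset.card_ne_zero, Finset.sdiff_nonempty]; exact h.2
        simp [hf', hne]
    _ = ∑ η ∈ (Finset.univ.filter (γ₀ ⊂ ·)).image (· \ γ₀), f' η.card := by
        rw [Finset.sum_image]
        intro γ hγ γ' hγ' h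
        have h1 : γ₀ ⊂ γ := by simpa using hγ
        have h2 : γ₀ ⊂ γ' := by simpa using hγ'
        simp only at h
        rw [← Finset.sdiff_union_of_subset h1.1, h, Finset.sdiff_union_of_subset h2.1]
    _ ≤ ∑ η ∈ (Finset.univ : Finset (Fin p)).powerset, f' η.card :=
        Finset.sum_le_sum_of_subset_of_nonneg (fun η _ => by simp) fun _ _ _ => hf'0 _
    _ = _ := by
        rw [Finset.sum_powerset_apply_card, Finset.card_univ, Fintype.card_fin,
          Finset.sum_range_succ']
        simp [hf']

/-- The factorial turns the binomial coefficient into at most `p^(m+1)`, so the sum is geometric of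
ratio `p x ≤ 1/2`. -/
theorem sum_choose_mul_factorial_le {p : ℕ} {x : ℝ} (hx : 0 ≤ x) (hy : p * x ≤ 1 / 2) :
    ∑ m ∈ Finset.range p, (p.choose (m + 1) : ℝ) * (x ^ (m + 1) * (m + 1).factorial) ≤
      2 * (p * x) := by
  have hy0 : 0 ≤ p * x := by positivity
  calc ∑ m ∈ Finset.range p, (p.choose (m + 1) : ℝ) * (x ^ (m + 1) * (m + 1).factorial)
      ≤ ∑ m ∈ Finset.range p, p * x * (1 / 2 : ℝ) ^ m := by
        refine Finset.sum_le_sum fun m _ => ?_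
        have h1 : ((p.choose (m + 1) : ℝ)) * (m + 1).factorial ≤ (p : ℝ) ^ (m + 1) := by
          have := Nat.descFactorial_le_pow p (m + 1)
          rw [Nat.descFactorial_eq_factorial_mul_choose, mul_comm] at this
          exact_mod_cast this
        calc (p.choose (m + 1) : ℝ) * (x ^ (m + 1) * (m + 1).factorial)
            = (p.choose (m + 1) * (m + 1).factorial) * x ^ (m + 1) := by ring
          _ ≤ (p : ℝ) ^ (m + 1) * x ^ (m + 1) := by gcongr
          _ = p * x * (p * x) ^ m := by ring
          _ ≤ p * x * (1 / 2) ^ m := by gcongr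
    _ = p * x * ∑ m ∈ Finset.range p, (1 / 2 : ℝ) ^ m := by rw [Finset.mul_sum]
    _ ≤ p * x * 2 := mul_le_mul_of_nonneg_left (sum_geometric_two_le p) hy0
    _ = _ := by ring

theorem measurable_fitStat_right {n p : ℕ} (a b : ℝ) (γ : Finset (Fin p))
    (X : Matrix (Fin n) (Fin p) ℝ) : Measurable fun e => fitStat a b γ X e :=
  (measurable_fitStat (n := n) a b γ).of_uncurry_left (x := (X : Fin n → Fin p → ℝ))

theorem lintegral_sum_fitStat_le {n p : ℕ} {a b η x R : ℝ} {v : ℝ≥0} {K₀ : ℕ} (hn : 0 < n)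
    (hb : 0 < b) (hη : 0 < η) (hav : a ^ 2 * v = 1 - η) {γ₀ : Finset (Fin p)} (hk : γ₀.card ≤ K₀)
    {X : Matrix (Fin n) (Fin p) ℝ} (hX : IsConditioned b X) (hR1 : 1 ≤ R) (hR : √(b ^ 2 / η) ≤ R)
    (hx : 0 ≤ x) (hy : p * (R * x) ≤ 1 / 2) :
    ∫⁻ e, ∑ γ ∈ Finset.univ.filter (γ₀ ⊂ ·), ENNReal.ofReal (x ^ (γ \ γ₀).card *
      (γ \ γ₀).card.factorial) * fitStat a b γ X e ∂(Measure.pi fun _ : Fin n => gaussianReal 0 v) ≤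
      ENNReal.ofReal (R ^ K₀ * (2 * (p * (R * x)))) := by
  have hmeas := fun γ => measurable_fitStat_right a b γ X
  rw [lintegral_finsetSum _ fun γ _ => (hmeas γ).const_mul _]
  have h1 : ∀ γ ∈ Finset.univ.filter (γ₀ ⊂ ·), ∫⁻ e, ENNReal.ofReal (x ^ (γ \ γ₀).card *
      (γ \ γ₀).card.factorial) * fitStat a b γ X e ∂(Measure.pi fun _ : Fin n => gaussianReal 0 v) ≤
      ENNReal.ofReal (R ^ K₀ * ((R * x) ^ (γ \ γ₀).card * (γ \ γ₀).card.factorial)) := by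
    intro γ hγ
    have hlt : γ₀ ⊂ γ := by simpa using hγ
    rw [lintegral_const_mul' _ _ ENNReal.ofReal_ne_top]
    refine (mul_le_mul_right (lintegral_fitStat_le hn hb hη hav γ hX) _).trans ?_
    rw [← ENNReal.ofReal_mul (by positivity)]
    refine ENNReal.ofReal_le_ofReal ?_
    have hcard : γ.card = γ₀.card + (γ \ γ₀).card := by
      rw [add_comm, Finset.card_sdiff_add_card_eq_card hlt.1]
    set m := (γ \ γ₀).card
    calc x ^ m * m.factorial * √(b ^ 2 / η) ^ γ.card
        ≤ x ^ m * m.factorial * R ^ γ.card := by gcongr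
      _ = x ^ m * m.factorial * (R ^ γ₀.card * R ^ m) := by rw [hcard, pow_add]
      _ ≤ x ^ m * m.factorial * (R ^ K₀ * R ^ m) := by gcongr
      _ = _ := by ring
  refine (Finset.sum_le_sum h1).trans ?_
  rw [← ENNReal.ofReal_sum_of_nonneg fun γ _ => by positivity]
  refine ENNReal.ofReal_le_ofReal ?_
  rw [← Finset.mul_sum]
  refine mul_le_mul_of_nonneg_left ?_ (by positivity)
  exact (sum_ssuperset_card_le γ₀ (f := fun m => (R * x) ^ m * m.factorial)
    fun m => by positivity).trans (sum_choose_mul_factorial_le (by positivity) hy)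

/-- The set of designs and error vectors for which the posterior analysis may fail. -/
def badSet (n p : ℕ) (a b lo hi K : ℝ) (u : ℕ → ℝ) (γ₀ : Finset (Fin p)) :
    Set ((Fin n → Fin p → ℝ) × (Fin n → ℝ)) :=
  {q | IsConditioned b (Matrix.of q.1) ∧ (nsq q.2 < lo ∨ hi < nsq q.2 ∨
    ENNReal.ofReal K < fitStat a b Finset.univ (Matrix.of q.1) q.2 ∨
    1 < ∑ γ ∈ Finset.univ.filter (γ₀ ⊂ ·),
      ENNReal.ofReal (u (γ \ γ₀).card) * fitStat a b γ (Matrix.of q.1) q.2)}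

theorem measurableSet_badSet (n p : ℕ) (a b lo hi K : ℝ) (u : ℕ → ℝ) (γ₀ : Finset (Fin p)) :
    MeasurableSet (badSet n p a b lo hi K u γ₀) := by
  have hn : Measurable fun q : (Fin n → Fin p → ℝ) × (Fin n → ℝ) => nsq q.2 := by fun_prop
  have hs : Measurable fun q : (Fin n → Fin p → ℝ) × (Fin n → ℝ) =>
      ∑ γ ∈ Finset.univ.filter (γ₀ ⊂ ·),
        ENNReal.ofReal (u (γ \ γ₀).card) * fitStat a b γ (Matrix.of q.1) q.2 :=
    Finset.measurable_fun_sum _ fun γ _ => (measurable_fitStat a b γ).const_mul _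
  exact ((isClosed_isConditioned n p b).measurableSet.preimage measurable_fst).inter
    ((measurableSet_lt hn measurable_const).union ((measurableSet_lt measurable_const hn).union
      ((measurableSet_lt measurable_const (measurable_fitStat a b _)).union
        (measurableSet_lt measurable_const hs))))

/-- With the design fixed the errors are Gaussian, and the four failures are bounded by two
chi-square tails and two Markov inequalities. The bound is the same for all designs, hence holds for
any law `μ`; ill-conditioned designs have an empty section. -/
theorem prod_badSet_le {n p K₀ : ℕ} {a b η x R l q₁ q₂ : ℝ} {v : ℝ≥0} (hn : 0 < n) (hb : 0 < b)
    (hη : 0 < η) (hav : a ^ 2 * v = 1 - η) {γ₀ : Finset (Fin p)} (hk : γ₀.card ≤ K₀)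
    (hR1 : 1 ≤ R) (hR : √(b ^ 2 / η) ≤ R) (hx : 0 ≤ x) (hy : p * (R * x) ≤ 1 / 2)
    (hq₁ : (Measure.pi fun _ : Fin n => gaussianReal 0 v) {e | nsq e < l * n * v} ≤
      ENNReal.ofReal q₁ ^ n)
    (hq₂ : (Measure.pi fun _ : Fin n => gaussianReal 0 v) {e | 4 * n * v < nsq e} ≤
      ENNReal.ofReal q₂ ^ n)
    (μ : Measure (Fin n → Fin p → ℝ)) [IsProbabilityMeasure μ] :
    μ.prod (Measure.pi fun _ : Fin n => gaussianReal 0 v)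
      (badSet n p a b (l * n * v) (4 * n * v) (Real.exp (R * p))
        (fun m => x ^ m * m.factorial) γ₀) ≤
      ENNReal.ofReal q₁ ^ n + (ENNReal.ofReal q₂ ^ n + (ENNReal.ofReal (Real.exp (-1)) ^ p +
        ENNReal.ofReal (R ^ K₀ * (2 * (p * (R * x)))))) := by
  rw [Measure.prod_apply (measurableSet_badSet _ _ _ _ _ _ _ _ _)]
  set D := ENNReal.ofReal q₁ ^ n + (ENNReal.ofReal q₂ ^ n + (ENNReal.ofReal (Real.exp (-1)) ^ p +
        ENNReal.ofReal (R ^ K₀ * (2 * (p * (R * x)))))) with hD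
  have hsec : ∀ X : Fin n → Fin p → ℝ, (Measure.pi fun _ : Fin n => gaussianReal 0 v)
      (Prod.mk X ⁻¹' badSet n p a b (l * n * v) (4 * n * v) (Real.exp (R * p))
        (fun m => x ^ m * m.factorial) γ₀) ≤ D := by
    intro X
    by_cases hX : IsConditioned b (Matrix.of X)
    swap
    · have : Prod.mk X ⁻¹' badSet n p a b (l * n * v) (4 * n * v) (Real.exp (R * p))
        (fun m => x ^ m * m.factorial) γ₀ = ∅ := by
        ext e; simp [badSet, hX]
      rw [this, measure_empty]; exact zero_le
    have hmeas := fun γ => measurable_fitStat_right a b γ (Matrix.of X)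
    have hsub : Prod.mk X ⁻¹' badSet n p a b (l * n * v) (4 * n * v) (Real.exp (R * p))
        (fun m => x ^ m * m.factorial) γ₀ ⊆ {e | nsq e < l * n * v} ∪ ({e | 4 * n * v < nsq e} ∪
          ({e | ENNReal.ofReal (Real.exp (R * p)) ≤ fitStat a b Finset.univ (Matrix.of X) e} ∪
          {e | 1 ≤ ∑ γ ∈ Finset.univ.filter (γ₀ ⊂ ·), ENNReal.ofReal (x ^ (γ \ γ₀).card *
            (γ \ γ₀).card.factorial) * fitStat a b γ (Matrix.of X) e})) := by
      rintro e ⟨-, h | h | h | h⟩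
      · exact Or.inl h
      · exact Or.inr (Or.inl h)
      · exact Or.inr (Or.inr (Or.inl h.le))
      · exact Or.inr (Or.inr (Or.inr h.le))
    refine (measure_mono hsub).trans ((measure_union_le _ _).trans (add_le_add hq₁
      ((measure_union_le _ _).trans (add_le_add hq₂ ((measure_union_le _ _).trans
        (add_le_add ?_ ?_))))))
    · refine (meas_ge_le_lintegral_div (hmeas _).aemeasurable (by simp [Real.exp_pos])
        ENNReal.ofReal_ne_top).trans ?_
      refine (ENNReal.div_le_div_right (lintegral_fitStat_le hn hb hη hav _ hX) _).trans ?_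
      rw [← ENNReal.ofReal_div_of_pos (Real.exp_pos _), ← ENNReal.ofReal_pow (Real.exp_nonneg _),
        Finset.card_univ, Fintype.card_fin]
      refine ENNReal.ofReal_le_ofReal ?_
      rw [mul_comm R, Real.exp_nat_mul, ← div_pow]
      refine pow_le_pow_left₀ (by positivity) ?_ _
      rw [div_le_iff₀ (Real.exp_pos _), ← Real.exp_add]
      -- The mean is at most `R^p` and the threshold is `exp (R p)`; the ratio is at most `exp (-p)`
      -- because `R ≤ exp (R - 1)`.
      have := Real.add_one_le_exp (-1 + R)
      linarith
    · refine (meas_le_lintegral₀ (f := fun e => ∑ γ ∈ Finset.univ.filter (γ₀ ⊂ ·),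
        ENNReal.ofReal (x ^ (γ \ γ₀).card * (γ \ γ₀).card.factorial) *
          fitStat a b γ (Matrix.of X) e)
        (Finset.measurable_fun_sum _ fun γ _ => (hmeas γ).const_mul _).aemeasurable
        fun e he => he).trans ?_
      exact lintegral_sum_fitStat_le hn hb hη hav hk hX hR1 hR hx hy
  calc _ ≤ ∫⁻ _, D ∂μ := lintegral_mono hsec
    _ = D := by simp

/-! ### From marginal likelihoods to posterior probabilities. -/

section Posterior

variable {n p : ℕ} {ν : ℝ} {g : Measure ℝ≥0} {π : PMF (Finset (Fin p))}
  {X : Matrix (Fin n) (Fin p) ℝ} {y : Fin n → ℝ} {γ₀ : Finset (Fin p)}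

theorem posterior_eq_div (hm : ∀ γ, marginalLikelihood ν g X y γ ≠ ∞) (γ : Finset (Fin p)) :
    posterior ν g π X y γ = (π γ * marginalLikelihood ν g X y γ).toReal /
      ∑ γ', (π γ' * marginalLikelihood ν g X y γ').toReal := by
  rw [posterior, ENNReal.toReal_div,
    ENNReal.toReal_sum fun γ' _ => ENNReal.mul_ne_top (π.apply_ne_top γ') (hm γ')]

theorem pmf_ne_zero_of_forall_le {C₀ : ℝ≥0} (hπ : ∀ γ, π γ ≤ C₀ * π γ₀) : π γ₀ ≠ 0 := by
  intro h
  have h0 : ∀ γ, π γ = 0 := fun γ => by simpa [h] using hπ γ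
  simpa [h0] using π.tsum_coe

theorem sum_toReal_le {C₀ : ℝ≥0} {θ : ℝ} (hθ : 0 ≤ θ) (hπ : ∀ γ, π γ ≤ C₀ * π γ₀)
    (hm : ∀ γ, marginalLikelihood ν g X y γ ≠ ∞)
    (h : ∑ γ ∈ Finset.univ.filter (· ≠ γ₀), marginalLikelihood ν g X y γ ≤
      ENNReal.ofReal θ * marginalLikelihood ν g X y γ₀) :
    ∑ γ ∈ Finset.univ.filter (· ≠ γ₀), (π γ * marginalLikelihood ν g X y γ).toReal ≤
      C₀ * θ * (π γ₀ * marginalLikelihood ν g X y γ₀).toReal := by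
  rw [← ENNReal.toReal_sum fun γ' _ => ENNReal.mul_ne_top (π.apply_ne_top γ') (hm γ')]
  have h1 : ∑ γ ∈ Finset.univ.filter (· ≠ γ₀), π γ * marginalLikelihood ν g X y γ ≤
      C₀ * ENNReal.ofReal θ * (π γ₀ * marginalLikelihood ν g X y γ₀) :=
    calc _ ≤ ∑ γ ∈ Finset.univ.filter (· ≠ γ₀), C₀ * π γ₀ * marginalLikelihood ν g X y γ :=
          Finset.sum_le_sum fun γ _ => mul_le_mul_left (hπ γ) _
      _ = C₀ * π γ₀ * ∑ γ ∈ Finset.univ.filter (· ≠ γ₀), marginalLikelihood ν g X y γ := by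
          rw [Finset.mul_sum]
      _ ≤ C₀ * π γ₀ * (ENNReal.ofReal θ * marginalLikelihood ν g X y γ₀) :=
          mul_le_mul_right h _
      _ = _ := by ring
  refine (ENNReal.toReal_mono ?_ h1).trans ?_
  · exact ENNReal.mul_ne_top (ENNReal.mul_ne_top ENNReal.coe_ne_top ENNReal.ofReal_ne_top)
      (ENNReal.mul_ne_top (π.apply_ne_top _) (hm _))
  · rw [ENNReal.toReal_mul (a := C₀ * ENNReal.ofReal θ), ENNReal.toReal_mul (a := (C₀ : ℝ≥0∞)),
      ENNReal.toReal_ofReal hθ, ENNReal.coe_toReal]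

theorem norm_posterior_sub_one_le {C₀ : ℝ≥0} {θ : ℝ} (hθ : 0 ≤ θ)
    (hπ : ∀ γ, π γ ≤ C₀ * π γ₀) (hm : ∀ γ, marginalLikelihood ν g X y γ ≠ ∞)
    (hm₀ : marginalLikelihood ν g X y γ₀ ≠ 0)
    (h : ∑ γ ∈ Finset.univ.filter (· ≠ γ₀), marginalLikelihood ν g X y γ ≤
      ENNReal.ofReal θ * marginalLikelihood ν g X y γ₀) :
    ‖posterior ν g π X y γ₀ - 1‖ ≤ C₀ * θ := by
  have h1 := sum_toReal_le hθ hπ hm h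
  have hw : 0 < (π γ₀ * marginalLikelihood ν g X y γ₀).toReal := ENNReal.toReal_pos
    (mul_ne_zero (pmf_ne_zero_of_forall_le hπ) hm₀)
    (ENNReal.mul_ne_top (π.apply_ne_top _) (hm _))
  have hr : 0 ≤ ∑ γ ∈ Finset.univ.filter (· ≠ γ₀),
      (π γ * marginalLikelihood ν g X y γ).toReal :=
    Finset.sum_nonneg fun _ _ => ENNReal.toReal_nonneg
  rw [posterior_eq_div hm, ← Finset.add_sum_erase _ _ (Finset.mem_univ γ₀), ← Finset.filter_ne']
  set w := (π γ₀ * marginalLikelihood ν g X y γ₀).toReal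
  set s := ∑ γ ∈ Finset.univ.filter (· ≠ γ₀), (π γ * marginalLikelihood ν g X y γ).toReal
  have h2 : w / (w + s) - 1 = -(s / (w + s)) := by field_simp; ring
  rw [h2, norm_neg, Real.norm_of_nonneg (by positivity), div_le_iff₀ (by positivity)]
  refine h1.trans ?_
  gcongr
  linarith

/-- The normalizing constant cancels in each ratio, and one term is at most the sum over all wrong
models. -/
theorem norm_maxPosteriorOdds_le {C₀ : ℝ≥0} {θ : ℝ} (hθ : 0 ≤ θ)
    (hπ : ∀ γ, π γ ≤ C₀ * π γ₀) (hm : ∀ γ, marginalLikelihood ν g X y γ ≠ ∞)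
    (hm₀ : marginalLikelihood ν g X y γ₀ ≠ 0)
    (h : ∑ γ ∈ Finset.univ.filter (· ≠ γ₀), marginalLikelihood ν g X y γ ≤
      ENNReal.ofReal θ * marginalLikelihood ν g X y γ₀) :
    ‖maxPosteriorOdds ν g π X y γ₀‖ ≤ C₀ * θ := by
  have h1 := sum_toReal_le hθ hπ hm h
  have hw : 0 < (π γ₀ * marginalLikelihood ν g X y γ₀).toReal := ENNReal.toReal_pos
    (mul_ne_zero (pmf_ne_zero_of_forall_le hπ) hm₀)
    (ENNReal.mul_ne_top (π.apply_ne_top _) (hm _))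
  have hS : 0 < ∑ γ', (π γ' * marginalLikelihood ν g X y γ').toReal :=
    hw.trans_le (Finset.single_le_sum
      (f := fun γ => (π γ * marginalLikelihood ν g X y γ).toReal)
      (fun _ _ => ENNReal.toReal_nonneg) (Finset.mem_univ γ₀))
  have h0 : 0 ≤ maxPosteriorOdds ν g π X y γ₀ :=
    Real.iSup_nonneg fun _ => div_nonneg ENNReal.toReal_nonneg ENNReal.toReal_nonneg
  rw [Real.norm_of_nonneg h0]
  refine Real.iSup_le (fun ⟨γ, hγ⟩ => ?_) (by positivity)
  simp only [posterior_eq_div hm]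
  rw [div_div_div_cancel_right₀ hS.ne', div_le_iff₀ hw]
  exact (Finset.single_le_sum (f := fun γ => (π γ * marginalLikelihood ν g X y γ).toReal)
    (fun _ _ => ENNReal.toReal_nonneg) (by simpa using hγ)).trans h1

end Posterior

theorem marginalLikelihood_ne_zero {n p : ℕ} {b ν : ℝ} (hb : 0 < b) (hν : 0 < ν)
    {g : Measure ℝ≥0} {φ Φ : ℝ≥0} (hφ : φ ≠ 0) (hg : g (Set.Icc φ Φ) ≠ 0)
    {X : Matrix (Fin n) (Fin p) ℝ} (hX : IsConditioned b X) (β₀ : Fin p → ℝ) (e : Fin n → ℝ) :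
    marginalLikelihood ν g X (X.mulVec β₀ + e) (trueModel β₀) ≠ 0 := by
  intro h
  have h1 := tauInt_le_marginalLikelihood (ν := ν) (e := e) (γ := trueModel β₀) (β₀ := β₀) g
    (D := n * b) (by positivity) (by simp [trueModel]) (fun δ => (hX δ).2) hφ (Φ := Φ)
  rw [h, mul_zero, nonpos_iff_eq_zero, mul_eq_zero] at h1
  refine h1.elim hg (tauInt_pos n hν ?_).ne'
  have := nsq_nonneg e
  have h3 := nsq_nonneg β₀
  have : 0 ≤ nsq e + nsq β₀ / φ := by positivity
  linarith

/-! ### Choice of parameters and passage to the limit. -/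

theorem exists_one_lt_pow_mul_lt {r ρ : ℝ} (h : r < ρ) : ∃ z : ℝ, 1 < z ∧ z ^ 3 * r < ρ := by
  have h1 : Tendsto (fun z : ℝ => z ^ 3 * r) (𝓝[>] 1) (𝓝 (1 ^ 3 * r)) :=
    ((continuous_id.pow 3).mul continuous_const).continuousAt.tendsto.mono_left nhdsWithin_le_nhds
  have h2 : ∀ᶠ z : ℝ in 𝓝[>] 1, z ^ 3 * r < ρ := h1.eventually_lt_const (by simpa using h)
  obtain ⟨z, hz, hz1⟩ := (h2.and self_mem_nhdsWithin).exists
  exact ⟨z, hz1, hz⟩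

theorem tendsto_mul_rpow_neg {p : ℕ → ℕ} {A r r' : ℝ} (hr : r < r')
    (hp : ∀ᶠ n in atTop, (p n : ℝ) ≤ A * (n : ℝ) ^ r) (R : ℝ) :
    Tendsto (fun n : ℕ => (p n : ℝ) * (R * (n : ℝ) ^ (-r'))) atTop (𝓝 0) := by
  have h1 : Tendsto (fun n : ℕ => A * (n : ℝ) ^ (-(r' - r))) atTop (𝓝 (A * 0)) :=
    ((tendsto_rpow_neg_atTop (sub_pos.2 hr)).comp tendsto_natCast_atTop_atTop).const_mul A
  have h2 : Tendsto (fun n : ℕ => (p n : ℝ) * (n : ℝ) ^ (-r')) atTop (𝓝 0) := by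
    rw [mul_zero] at h1
    refine squeeze_zero' (Eventually.of_forall fun n => by positivity) ?_ h1
    filter_upwards [hp, eventually_gt_atTop 0] with n hn hn0
    have hn0' : (0 : ℝ) < n := by exact_mod_cast hn0
    calc (p n : ℝ) * (n : ℝ) ^ (-r') ≤ A * (n : ℝ) ^ r * (n : ℝ) ^ (-r') := by gcongr
      _ = _ := by rw [mul_assoc, ← Real.rpow_add hn0']; congr 2; ring
  have h3 := h2.const_mul R
  rw [mul_zero] at h3
  refine h3.congr fun n => by ring

theorem tendsto_badSet_bound {p : ℕ → ℕ} {x : ℕ → ℝ} {q₁ q₂ R : ℝ} {K₀ : ℕ} (hq₁ : q₁ < 1)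
    (hq₂ : q₂ < 1) (hp : Tendsto p atTop atTop)
    (hx : Tendsto (fun n => (p n : ℝ) * (R * x n)) atTop (𝓝 0)) :
    Tendsto (fun n => ENNReal.ofReal q₁ ^ n + (ENNReal.ofReal q₂ ^ n +
      (ENNReal.ofReal (Real.exp (-1)) ^ (p n) +
        ENNReal.ofReal (R ^ K₀ * (2 * ((p n : ℝ) * (R * x n))))))) atTop (𝓝 0) := by
  have h1 : Tendsto (fun n => ENNReal.ofReal (R ^ K₀ * (2 * ((p n : ℝ) * (R * x n))))) atTop
      (𝓝 0) := by
    have := ENNReal.tendsto_ofReal ((hx.const_mul 2).const_mul (R ^ K₀))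
    simpa using this
  have h2 := (ENNReal.tendsto_pow_atTop_nhds_zero_of_lt_one
    (r := ENNReal.ofReal (Real.exp (-1))) (by simp)).comp hp
  have h3 := ENNReal.tendsto_pow_atTop_nhds_zero_of_lt_one
    (r := ENNReal.ofReal q₁) (by simpa using hq₁)
  have h4 := ENNReal.tendsto_pow_atTop_nhds_zero_of_lt_one
    (r := ENNReal.ofReal q₂) (by simpa using hq₂)
  simpa using h3.add (h4.add (h2.add h1))

/-- By independence the joint law is a product, so a bound uniform in the law of the design covers
deterministic and random designs alike. -/
theorem measure_preimage_prodMk_le {Ω E F : Type*} [MeasurableSpace Ω] [MeasurableSpace E]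
    [MeasurableSpace F] {P : Measure Ω} [IsProbabilityMeasure P] {X : Ω → E} {ε : Ω → F}
    {κ : Measure F} (hX : AEMeasurable X P) (hε : HasLaw ε κ P) (hind : IndepFun X ε P)
    {s : Set (E × F)} (hs : MeasurableSet s) {t : ℝ≥0∞}
    (h : ∀ μ : Measure E, IsProbabilityMeasure μ → μ.prod κ s ≤ t) :
    P {ω | (X ω, ε ω) ∈ s} ≤ t := by
  have h1 := (indepFun_iff_map_prod_eq_prod_map_map hX hε.aemeasurable).1 hind
  rw [hε.map_eq] at h1
  have h2 := h _ (Measure.isProbabilityMeasure_map hX)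
  rw [← h1, Measure.map_apply_of_aemeasurable (hX.prodMk hε.aemeasurable) hs] at h2
  exact h2

/-- The intervals `[1/(k+1), k]` exhaust the positive numbers; if all were null, `g` would be
concentrated at `0`. -/
theorem exists_Icc_ne_zero_of_ne_dirac {g : Measure ℝ≥0} [IsProbabilityMeasure g]
    (hg : g ≠ Measure.dirac 0) : ∃ φ Φ : ℝ≥0, φ ≠ 0 ∧ g (Set.Icc φ Φ) ≠ 0 := by
  by_contra! h
  refine hg ?_
  have h1 : g {0}ᶜ = 0 := by
    refine measure_mono_null (t := ⋃ k : ℕ, Set.Icc ((k : ℝ≥0) + 1)⁻¹ k) (fun c hc => ?_)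
      (measure_iUnion_null fun k => h _ _ (by positivity))
    have hc' : c ≠ 0 := hc
    obtain ⟨k, hk⟩ := exists_nat_ge (max c c⁻¹)
    refine Set.mem_iUnion.2 ⟨k, ?_, (le_max_left _ _).trans hk⟩
    refine inv_le_of_inv_le₀ (pos_iff_ne_zero.2 hc') ?_
    exact ((le_max_right _ _).trans hk).trans (le_add_of_nonneg_right zero_le_one)
  have h2 : (id : ℝ≥0 → ℝ≥0) =ᵐ[g] fun _ => 0 := by
    rw [Filter.EventuallyEq, ae_iff]; exact h1
  calc g = g.map id := Measure.map_id.symm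
    _ = g.map fun _ => 0 := Measure.map_congr h2
    _ = Measure.dirac 0 := by rw [Measure.map_const, measure_univ, one_smul]

theorem tendsto_measure_sum_marginalLikelihood_not_le {Ω : Type*} [MeasurableSpace Ω]
    {P : Measure Ω} [IsProbabilityMeasure P] {p : ℕ → ℕ} {X : ∀ n, Ω → Fin n → Fin (p n) → ℝ}
    {ε : ∀ n, Ω → Fin n → ℝ} {β₀ : ∀ n, Fin (p n) → ℝ} {v : ℝ≥0} {g : Measure ℝ≥0}
    [IsProbabilityMeasure g] {ν b ρ r a₃ A₁ B θ : ℝ} {K₀ : ℕ} {φ Φ : ℝ≥0}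
    (hv : v ≠ 0) (hν : 0 < ν) (hb : 0 < b) (hX : ∀ n, AEMeasurable (X n) P)
    (hε : ∀ n, HasLaw (ε n) (Measure.pi fun _ : Fin n => gaussianReal 0 v) P)
    (hind : ∀ n, IndepFun (X n) (ε n) P)
    (hwell : ∀ᶠ n in atTop, ∀ᵐ ω ∂P, WellConditioned b (Matrix.of (X n ω)))
    (hr0 : 0 ≤ r) (ha₃ : 0 < a₃) (hA₁ : 0 ≤ A₁) (hp_top : Tendsto p atTop atTop)
    (hp : ∀ᶠ n in atTop, (p n : ℝ) ≤ A₁ * (n : ℝ) ^ r)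
    (hk : ∀ᶠ n in atTop, (trueModel (β₀ n)).card ≤ K₀)
    (hB : ∀ᶠ n in atTop, nsq (β₀ n) ≤ B)
    (hne : ∀ᶠ n in atTop, (trueModel (β₀ n)).Nonempty)
    (hsig : ∀ᶠ n : ℕ in atTop, ∀ j ∈ trueModel (β₀ n),
      a₃ * ((n : ℝ) ^ (-(1 / 4) : ℝ) * √(Real.log n)) ≤ |β₀ n j|)
    (hφ : φ ≠ 0) (hg : g (Set.Icc φ Φ) ≠ 0) (hrρ : r < ρ)
    (hreg : (ρ = 1 / 2 ∧ ∀ᵐ c ∂g, φ ≤ c) ∨ ρ = 1 / 4) (hθ : 0 < θ) :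
    Tendsto (fun n => P {ω | ¬ (IsConditioned b (Matrix.of (X n ω)) ∧
      ∑ γ ∈ Finset.univ.filter (· ≠ trueModel (β₀ n)),
        marginalLikelihood ν g (Matrix.of (X n ω))
          ((Matrix.of (X n ω)).mulVec (β₀ n) + ε n ω) γ ≤
      ENNReal.ofReal θ * marginalLikelihood ν g (Matrix.of (X n ω))
          ((Matrix.of (X n ω)).mulVec (β₀ n) + ε n ω) (trueModel (β₀ n)))}) atTop (𝓝 0) := by
  have hρ : ρ ≤ 1 / 2 := by rcases hreg with h | h <;> [exact h.1.le; linarith]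
  -- The midpoint `r'` of `r` and `ρ` makes `p n^(-r') → 0`, as the first-moment bound needs. Then
  -- `z` is taken so close to `1` that `z³ r' < ρ`, as the weights need.
  obtain ⟨z, hz, hzρ⟩ := exists_one_lt_pow_mul_lt (r := (r + ρ) / 2) (ρ := ρ) (by linarith)
  set r' := (r + ρ) / 2 with hr'
  have hrr' : r < r' := by rw [hr']; linarith
  have hz0 : 0 < z := by linarith
  have hv' : (0 : ℝ) < v := by exact_mod_cast pos_iff_ne_zero.2 hv
  have hz1 : 1 / z < 1 := by rwa [div_lt_one hz0]
  have hzp : 0 < 1 / z := by positivity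
  set η := 1 - 1 / z with hη
  have hη0 : 0 < η := by rw [hη]; linarith
  set a := √(1 / (z * v)) with ha
  have hav : a ^ 2 * v = 1 - η := by
    rw [ha, Real.sq_sqrt (by positivity), hη]; field_simp; ring
  -- Between `1/z`, required by `eventually_precision_conditions`, and `1`, required by the lower
  -- tail.
  set l := (1 + 1 / z) / 2 with hl
  obtain ⟨q₁, -, hq₁, H₁⟩ := exists_nsq_lower_tail (l := l) (by positivity) (by rw [hl]; linarith)
  obtain ⟨q₂, -, hq₂, H₂⟩ := exists_nsq_upper_tail
  set R := max 1 √(b ^ 2 / η) with hR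
  have hR1 : 1 ≤ R := le_max_left _ _
  have hpx := tendsto_mul_rpow_neg hrr' hp R
  have hmain := eventually_sum_marginalLikelihood_le p β₀ g (v := v) (ν := ν) (b := b) (z := z)
    (r := r) (r' := r') (ρ := ρ) (l := l) (a₁ := R) (a₃ := a₃) (A₁ := A₁) (B := B) (ε := θ)
    (K₀ := K₀) (φ := φ) (Φ := Φ) hb hν hv' hz (by rw [hl]; linarith) hr0 (by linarith)
    (by rw [hr']; linarith) hzρ (by linarith) ha₃ hA₁ hp hk hB hne hsig hφ hg
    (hreg.imp_right fun h => ⟨h, by linarith⟩) hθ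
  refine tendsto_of_tendsto_of_tendsto_of_le_of_le' tendsto_const_nhds
    (tendsto_badSet_bound (K₀ := K₀) hq₁ hq₂ hp_top hpx) (Eventually.of_forall fun _ => zero_le) ?_
  filter_upwards [hmain, hwell, hk, eventually_gt_atTop 0,
    hpx.eventually_le_const (show (0 : ℝ) < 1 / 2 by norm_num)] with n hn hw hkn hn0 hxn
  refine le_trans (measure_mono_ae ?_) (measure_preimage_prodMk_le (hX n) (hε n) (hind n)
    (measurableSet_badSet n (p n) a b (l * n * v) (4 * n * v) (Real.exp (R * p n))
      (fun m => ((n : ℝ) ^ (-r')) ^ m * m.factorial) (trueModel (β₀ n))) fun μ hμ =>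
    prod_badSet_le hn0 hb hη0 hav hkn hR1 (le_max_right _ _) (by positivity) hxn
      (H₁ n v hv) (H₂ n v hv) μ)
  filter_upwards [hw] with ω hω
  intro hbad
  by_contra hmem
  have hc := isConditioned_of_wellConditioned hn0 hω
  refine hbad ⟨hc, hn _ _ hc ?_ ?_ ?_ ?_⟩
  · by_contra h; exact hmem ⟨hc, Or.inl (not_le.1 h)⟩
  · by_contra h; exact hmem ⟨hc, Or.inr (Or.inl (not_le.1 h))⟩
  · by_contra h; exact hmem ⟨hc, Or.inr (Or.inr (Or.inl (not_le.1 h)))⟩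
  · by_contra h; exact hmem ⟨hc, Or.inr (Or.inr (Or.inr (not_le.1 h)))⟩

theorem tendstoInMeasure_of_forall_sum_le {Ω : Type*} [MeasurableSpace Ω]
    {P : Measure Ω} {f : ℕ → Ω → ℝ} {c : ℝ} {C₀ : ℝ≥0} {G : ℝ → ℕ → Set Ω}
    (hG : ∀ θ, 0 < θ → Tendsto (fun n => P (G θ n)) atTop (𝓝 0))
    (h : ∀ θ, 0 < θ → ∀ᶠ n in atTop, ∀ ω ∉ G θ n, ‖f n ω - c‖ ≤ C₀ * θ) :
    TendstoInMeasure P f atTop fun _ => c := by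
  refine tendstoInMeasure_iff_norm.2 fun δ hδ => ?_
  have hθ : 0 < δ / (C₀ + 1) := by positivity
  refine tendsto_of_tendsto_of_tendsto_of_le_of_le' tendsto_const_nhds (hG _ hθ)
    (Eventually.of_forall fun _ => zero_le) ?_
  filter_upwards [h _ hθ] with n hn
  refine measure_mono fun ω hω => ?_
  by_contra hmem
  have h1 : (C₀ : ℝ) * (δ / (C₀ + 1)) < δ := by
    rw [mul_div_assoc', div_lt_iff₀ (by positivity)]; nlinarith
  exact absurd (hn ω hmem) (not_le.2 (h1.trans_le hω))

end BayesVarSel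

theorem mainTheorem6 {Ω : Type*} [MeasurableSpace Ω] (P : Measure Ω) [IsProbabilityMeasure P]
    -- dimensions, design matrices (random or deterministic), errors, true coefficients
    (p : ℕ → ℕ) (X : ∀ n, Ω → Fin n → Fin (p n) → ℝ) (ε : ∀ n, Ω → Fin n → ℝ)
    (β₀ : ∀ n, Fin (p n) → ℝ)
    -- error variance, hyperparameter of the variance prior, prior of `c`, priors on the models
    (σ₀ : ℝ≥0) (ν : ℝ) (g : Measure ℝ≥0) [IsProbabilityMeasure g]
    (π : ∀ n, PMF (Finset (Fin (p n)))) (ψ : ℕ → ℝ) (C₀ : ℝ≥0) (b : ℝ)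
    (hσ₀ : 0 < σ₀) (hν : 0 < ν) (hb : 0 < b)
    -- `ε ∼ N(0, σ₀² Iₙ)`, independent of `X`
    (hX : ∀ n, AEMeasurable (X n) P)
    (hε : ∀ n, HasLaw (ε n) (Measure.pi fun _ : Fin n => gaussianReal 0 (σ₀ ^ 2)) P)
    (hind : ∀ n, IndepFun (X n) (ε n) P)
    -- the eigenvalues of `Xᵀ X / n` are bounded above and away from zero
    (hwell : ∀ᶠ n in atTop, ∀ᵐ ω ∂P, BayesVarSel.WellConditioned b (Matrix.of (X n ω)))
    -- the prior odds are bounded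
    (hπ : ∀ᶠ n in atTop, ∀ γ, π n γ ≤ C₀ * π n (BayesVarSel.trueModel (β₀ n)))
    -- the true model is nonnull, of bounded size, with bounded coefficient vector
    (hnonnull : ∀ᶠ n in atTop, (BayesVarSel.trueModel (β₀ n)).Nonempty)
    (hsize : (fun n => ((BayesVarSel.trueModel (β₀ n)).card : ℝ)) =O[atTop] fun _ => (1 : ℝ))
    (hβ₀ : (fun n => ‖WithLp.toLp 2 (β₀ n)‖) =O[atTop] fun _ => (1 : ℝ))
    -- the signal strength
    (hψpos : ∀ᶠ n in atTop, 0 < ψ n)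
    (hψ : ψ =Θ[atTop] fun n : ℕ => (n : ℝ) ^ (-(1 / 4) : ℝ) * √(Real.log n))
    (hsignal : ∀ᶠ n in atTop, ∀ j ∈ BayesVarSel.trueModel (β₀ n), ψ n ≤ |β₀ n j|) :
    (∀ φ Φ : ℝ≥0, 0 < φ → g.support ⊆ Set.Icc φ Φ →
      ∀ r : ℝ, 0 < r → r < 1 / 2 →
      (fun n => (p n : ℝ)) =Θ[atTop] (fun n : ℕ => (n : ℝ) ^ r) →
      TendstoInMeasure P
        (fun n ω => BayesVarSel.maxPosteriorOdds ν g (π n) (Matrix.of (X n ω))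
          ((Matrix.of (X n ω)).mulVec (β₀ n) + ε n ω) (BayesVarSel.trueModel (β₀ n)))
        atTop (fun _ => 0)) ∧
    (g ≠ Measure.dirac 0 →
      ∀ r : ℝ, 0 < r → r < 1 / 4 →
      (fun n => (p n : ℝ)) =Θ[atTop] (fun n : ℕ => (n : ℝ) ^ r) →
      TendstoInMeasure P
        (fun n ω => BayesVarSel.posterior ν g (π n) (Matrix.of (X n ω))
          ((Matrix.of (X n ω)).mulVec (β₀ n) + ε n ω) (BayesVarSel.trueModel (β₀ n)))
        atTop (fun _ => 1)) := by
  obtain ⟨C₁, hC₁, hsize'⟩ := hsize.exists_pos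
  have hk : ∀ᶠ n in atTop, (BayesVarSel.trueModel (β₀ n)).card ≤ ⌈C₁⌉₊ := by
    filter_upwards [hsize'.bound] with n hn
    rw [Real.norm_natCast, norm_one, mul_one] at hn
    exact_mod_cast hn.trans (Nat.le_ceil C₁)
  obtain ⟨C₂, hC₂, hβ₀'⟩ := hβ₀.exists_pos
  have hB : ∀ᶠ n in atTop, BayesVarSel.nsq (β₀ n) ≤ C₂ ^ 2 := by
    filter_upwards [hβ₀'.bound] with n hn
    rw [norm_norm, norm_one, mul_one] at hn
    have : BayesVarSel.nsq (β₀ n) = ‖WithLp.toLp 2 (β₀ n)‖ ^ 2 := by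
      rw [EuclideanSpace.norm_sq_eq]; simp [BayesVarSel.nsq]
    rw [this]
    exact pow_le_pow_left₀ (norm_nonneg _) hn 2
  obtain ⟨C₃, hC₃, hψ'⟩ := hψ.2.exists_pos
  have hsig : ∀ᶠ n : ℕ in atTop, ∀ j ∈ BayesVarSel.trueModel (β₀ n),
      C₃⁻¹ * ((n : ℝ) ^ (-(1 / 4) : ℝ) * √(Real.log n)) ≤ |β₀ n j| := by
    filter_upwards [hψ'.bound, hψpos, hsignal] with n hn hpos hs j hj
    rw [Real.norm_of_nonneg (by positivity), Real.norm_of_nonneg hpos.le] at hn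
    rw [inv_mul_le_iff₀ hC₃]
    exact hn.trans (mul_le_mul_of_nonneg_left (hs j hj) hC₃.le)
  have hv : σ₀ ^ 2 ≠ 0 := (pow_pos hσ₀ 2).ne'
  have hm := fun n ω => BayesVarSel.marginalLikelihood_ne_top g hν (Matrix.of (X n ω))
    ((Matrix.of (X n ω)).mulVec (β₀ n) + ε n ω)
  have key : ∀ r ρ : ℝ, 0 < r → r < ρ → ((fun n => (p n : ℝ)) =Θ[atTop] fun n : ℕ => (n : ℝ) ^ r) →
      ∀ φ Φ : ℝ≥0, φ ≠ 0 → g (Set.Icc φ Φ) ≠ 0 →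
      ((ρ = 1 / 2 ∧ ∀ᵐ c ∂g, φ ≤ c) ∨ ρ = 1 / 4) → ∀ θ : ℝ, 0 < θ →
      Tendsto (fun n => P {ω | ¬ (BayesVarSel.IsConditioned b (Matrix.of (X n ω)) ∧
        ∑ γ ∈ Finset.univ.filter (· ≠ BayesVarSel.trueModel (β₀ n)),
          BayesVarSel.marginalLikelihood ν g (Matrix.of (X n ω))
            ((Matrix.of (X n ω)).mulVec (β₀ n) + ε n ω) γ ≤
        ENNReal.ofReal θ * BayesVarSel.marginalLikelihood ν g (Matrix.of (X n ω))
          ((Matrix.of (X n ω)).mulVec (β₀ n) + ε n ω) (BayesVarSel.trueModel (β₀ n)))})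
        atTop (𝓝 0) := by
    intro r ρ hr hrρ hp φ Φ hφ hg hreg θ hθ
    obtain ⟨A₁, hA₁, hpA⟩ := hp.1.exists_pos
    have hpA' : ∀ᶠ n in atTop, (p n : ℝ) ≤ A₁ * (n : ℝ) ^ r := by
      filter_upwards [hpA.bound] with n hn
      rwa [Real.norm_natCast, Real.norm_of_nonneg (by positivity)] at hn
    -- Growth of `p` is what makes the failure probability `exp (-p)` of the full-model fit vanish.
    have hp_top : Tendsto p atTop atTop := by
      rw [← tendsto_natCast_atTop_iff (R := ℝ)]
      have h1 : Tendsto (fun n : ℕ => ‖(n : ℝ) ^ r‖) atTop atTop :=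
        tendsto_norm_atTop_atTop.comp ((tendsto_rpow_atTop hr).comp tendsto_natCast_atTop_atTop)
      simpa [Function.comp_def] using hp.tendsto_norm_atTop_iff.2 h1
    exact BayesVarSel.tendsto_measure_sum_marginalLikelihood_not_le hv hν hb hX hε hind hwell hr.le
      (inv_pos.2 hC₃) hA₁.le hp_top hpA' hk hB hnonnull hsig hφ hg hrρ hreg hθ
  refine ⟨fun φ Φ hφ hsupp r hr hr2 hp => ?_, fun hg r hr hr4 hp => ?_⟩
  · have hae : ∀ᵐ c ∂g, c ∈ Set.Icc φ Φ :=
      Filter.mem_of_superset Measure.support_mem_ae hsupp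
    have hg1 : g (Set.Icc φ Φ) ≠ 0 := by
      rw [(prob_compl_eq_zero_iff measurableSet_Icc).1 hae]; exact one_ne_zero
    refine BayesVarSel.tendstoInMeasure_of_forall_sum_le (C₀ := C₀)
      (key r (1 / 2) hr hr2 hp φ Φ hφ.ne' hg1 (Or.inl ⟨rfl, hae.mono fun c hc => hc.1⟩))
      fun θ hθ => ?_
    filter_upwards [hπ] with n hn ω hω
    obtain ⟨hc, hs⟩ := not_not.1 hω
    rw [sub_zero]
    exact BayesVarSel.norm_maxPosteriorOdds_le hθ.le hn (hm n ω)
      (BayesVarSel.marginalLikelihood_ne_zero hb hν hφ.ne' hg1 hc _ _) hs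
  -- An interval of positive mass suffices to bound the marginal likelihood of the true model from
  -- below; small `c` is handled by the regime with `ρ = 1/4`.
  · obtain ⟨φ, Φ, hφ, hg1⟩ := BayesVarSel.exists_Icc_ne_zero_of_ne_dirac hg
    refine BayesVarSel.tendstoInMeasure_of_forall_sum_le (C₀ := C₀)
      (key r (1 / 4) hr hr4 hp φ Φ hφ hg1 (Or.inr rfl)) fun θ hθ => ?_
    filter_upwards [hπ] with n hn ω hω
    obtain ⟨hc, hs⟩ := not_not.1 hω
    exact BayesVarSel.norm_posterior_sub_one_le hθ.le hn (hm n ω)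
      (BayesVarSel.marginalLikelihood_ne_zero hb hν hφ hg1 hc _ _) hs
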